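/- All superspaces are complex: a superspace is a topological space with a sheaf of supercommutative $\mathbb Z/2$-graded $\mathbb C$-algebras, and morphisms are pairs (continuous map, parity-preserving local morphism of sheaves of algebras). A morphism $f:\mathcal X\to\mathcal Y$ is a closed embedding (it identifies $\mathcal X$ with a closed sub-supermanifold of $\mathcal Y$, when these are supermanifolds) if the map of spaces is a closed embedding and $\mathcal O_{\mathcal Y}\to f_*\mathcal O_{\mathcal X}$ is surjective on stalks at the points of $\mathcal X$. For $\lambda\in\mathbb C$ let $\mathcal M_\lambda=(\mathbb P^2,\Pi\Omega^1_{\mathbb P^2},\lambda)$ be the complex supermanifold of dimension $2|2$ with reduced space $\mathbb P^2$, fermionic sheaf $\mathcal J/\mathcal J^2=\Pi\Omega^1_{\mathbb P^2}$ (so $\mathcal J^2=\mathrm{Sym}^2\Pi\Omega^1=\Omega^2_{\mathbb P^2}\cong\mathcal O(-3)$), and obstruction class $\lambda$ times the generator of $H^1(\mathbb P^2,\mathcal T_{\mathbb P^2}\otimes\Omega^2_{\mathbb P^2})\cong H^2(\mathbb P^2,\mathcal O(-3))\cong\mathbb C$ given by $\frac{1}{X_0X_1X_2}$. Explicitly,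 with $U_i=\{X_i\neq0\}$ and $\Omega_0=X_0\,dX_1\wedge dX_2+X_1\,dX_2\wedge dX_0+X_2\,dX_0\wedge dX_1$, it is obtained by gluing the split supermanifolds $(U_i,\mathcal O\oplus\Pi\Omega^1\oplus\Omega^2)$: sections $s_i$ on $U_i$ and $s_j$ on $U_j$ with functions $a$ as common degree-zero part are identified if $s_i=s_j+\lambda\,\omega_{ij}(a)$, where $\omega_{ij}(a)=\frac{X_k\,\partial a/\partial X_k}{X_0X_1X_2}\,\Omega_0$ for $(i,j,k)$ a cyclic permutation of $(0,1,2)$. Let $G(1|1,\mathbb C^{3|3})$ be the super Grassmannian of $1|1$-dimensional subspaces of $\mathbb C^{3|3}$, that is the quotient by $GL(1|1)$ (row operations) of the space of frames $\begin{pmatrix}x&\xi\\ \eta&y\end{pmatrix}$, with $x,y$ even vectors in $\mathbb C^3$ with non-zero reduction and $\xi,\eta$ odd. Let $\mathbb P^2_\Pi$ be the $\Pi$-projective plane, that is the Grassmannian of those $1|1$-dimensional subspaces of $\mathbb C^{3|3}$ that are invariant under its standard odd involution; they have frames $\begin{pmatrix}z&\theta\\-\theta&z\end{pmatrix}$. **Corollary.**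 Let $\lambda\neq0$. There are an isomorphism of supermanifolds $\Phi:\mathcal M_\lambda\to\mathbb P^2_\Pi$ and a morphism $j:\mathbb P^2_\Pi\to G(1|1,\mathbb C^{3|3})$, the tautological inclusion, induced by the linear map of frames $(z\,|\,\theta)\mapsto\begin{pmatrix}z&\theta\\-\theta&z\end{pmatrix}$ (so $x,y\mapsto z$, $\xi\mapsto\theta$, $\eta\mapsto-\theta$), such that $j$ and $j\circ\Phi$ are closed embeddings. In particular $(\mathbb P^2,\Pi\Omega^1_{\mathbb P^2},\lambda)$ embeds as a closed sub-supermanifold of $G(1|1,\mathbb C^{3|3})$, by a linear embedding that comes from its identification with $\mathbb P^2_\Pi$. -/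

import Mathlib

open CategoryTheory

noncomputable section
namespace SuperGeometry
open TopologicalSpace Opposite

set_option linter.unusedVariables false
set_option linter.unusedSectionVars false

section Grassmann
variable {V : Type} [AddCommGroup V] [Module ℂ V]

theorem contract_mul (d : Module.Dual ℂ V) (a b : ExteriorAlgebra ℂ V) :
    CliffordAlgebra.contractLeft d (a * b) = CliffordAlgebra.contractLeft d a * b
      + CliffordAlgebra.involute a * CliffordAlgebra.contractLeft d b := by
  induction a using CliffordAlgebra.left_induction with
  | algebraMap r =>
    simp [CliffordAlgebra.contractLeft_algebraMap_mul, CliffordAlgebra.contractLeft_algebraMap]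
  | add x y hx hy => simp only [add_mul, map_add, hx, hy]; abel
  | ι_mul x m hx =>
    rw [mul_assoc, CliffordAlgebra.contractLeft_ι_mul, hx, CliffordAlgebra.contractLeft_ι_mul,
      map_mul, CliffordAlgebra.involute_ι]
    simp only [mul_add, sub_mul, smul_mul_assoc, mul_assoc, neg_mul]
    abel

theorem ι_mul_comm (v : V) (a : ExteriorAlgebra ℂ V) :
    ExteriorAlgebra.ι ℂ v * a = CliffordAlgebra.involute a * ExteriorAlgebra.ι ℂ v := by
  induction a using ExteriorAlgebra.induction with
  | algebraMap r => rw [AlgHom.commutes, Algebra.commutes]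
  | ι w =>
    have h := ExteriorAlgebra.ι_add_mul_swap (R := ℂ) v w
    have h2 : CliffordAlgebra.involute (ExteriorAlgebra.ι ℂ w) = -ExteriorAlgebra.ι ℂ w :=
      CliffordAlgebra.involute_ι w
    rw [h2, neg_mul]
    exact eq_neg_of_add_eq_zero_left h
  | mul x y hx hy => rw [← mul_assoc, hx, mul_assoc, hy, map_mul, mul_assoc]
  | add x y hx hy => rw [mul_add, hx, hy, map_add, add_mul]

theorem contract_involute (d : Module.Dual ℂ V) (a : ExteriorAlgebra ℂ V) :
    CliffordAlgebra.contractLeft d (CliffordAlgebra.involute a)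
      = -CliffordAlgebra.involute (CliffordAlgebra.contractLeft d a) := by
  induction a using CliffordAlgebra.left_induction with
  | algebraMap r => simp [CliffordAlgebra.contractLeft_algebraMap]
  | add x y hx hy => simp only [map_add, hx, hy]; abel
  | ι_mul x m hx =>
    rw [map_mul, CliffordAlgebra.involute_ι, neg_mul, map_neg, CliffordAlgebra.contractLeft_ι_mul,
      hx, CliffordAlgebra.contractLeft_ι_mul, map_sub, map_smul, map_mul,
      CliffordAlgebra.involute_ι]
    simp

theorem even_comm {a : ExteriorAlgebra ℂ V} (ha : CliffordAlgebra.involute a = a)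
    (b : ExteriorAlgebra ℂ V) : a * b = b * a := by
  induction b using ExteriorAlgebra.induction with
  | algebraMap r => exact (Algebra.commutes r a).symm
  | ι w => rw [ι_mul_comm, ha]
  | mul x y hx hy => rw [← mul_assoc, hx, mul_assoc, hy, mul_assoc]
  | add x y hx hy => rw [mul_add, hx, hy, add_mul]

theorem odd_comm {a : ExteriorAlgebra ℂ V} (ha : CliffordAlgebra.involute a = -a)
    (b : ExteriorAlgebra ℂ V) : a * b = CliffordAlgebra.involute b * a := by
  induction b using ExteriorAlgebra.induction with
  | algebraMap r => rw [AlgHom.commutes, Algebra.commutes]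
  | ι w =>
    have h2 : CliffordAlgebra.involute (ExteriorAlgebra.ι ℂ w) = -ExteriorAlgebra.ι ℂ w :=
      CliffordAlgebra.involute_ι w
    rw [h2, neg_mul, ι_mul_comm, ha, neg_mul, neg_neg]
  | mul x y hx hy => rw [← mul_assoc, hx, mul_assoc, hy, map_mul, mul_assoc]
  | add x y hx hy => rw [mul_add, hx, hy, map_add, add_mul]

theorem map_involute {W : Type} [AddCommGroup W] [Module ℂ W] (L : V →ₗ[ℂ] W)
    (a : ExteriorAlgebra ℂ V) :
    ExteriorAlgebra.map L (CliffordAlgebra.involute a)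
      = CliffordAlgebra.involute (ExteriorAlgebra.map L a) := by
  induction a using ExteriorAlgebra.induction with
  | algebraMap r => simp
  | ι w =>
    have h2 : CliffordAlgebra.involute (ExteriorAlgebra.ι ℂ w) = -ExteriorAlgebra.ι ℂ w :=
      CliffordAlgebra.involute_ι w
    have h3 : CliffordAlgebra.involute (ExteriorAlgebra.ι ℂ (L w)) = -ExteriorAlgebra.ι ℂ (L w) :=
      CliffordAlgebra.involute_ι (L w)
    rw [h2, map_neg, ExteriorAlgebra.map_apply_ι, h3]
  | mul x y hx hy => rw [map_mul, map_mul, hx, hy, map_mul, map_mul]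
  | add x y hx hy => rw [map_add, map_add, hx, hy, map_add, map_add]

theorem body_involute (a : ExteriorAlgebra ℂ V) :
    ExteriorAlgebra.algebraMapInv (CliffordAlgebra.involute a)
      = ExteriorAlgebra.algebraMapInv a := by
  induction a using ExteriorAlgebra.induction with
  | algebraMap r => simp
  | ι w =>
    have h2 : CliffordAlgebra.involute (ExteriorAlgebra.ι ℂ w) = -ExteriorAlgebra.ι ℂ w :=
      CliffordAlgebra.involute_ι w
    rw [h2]
    simp [ExteriorAlgebra.algebraMapInv]
  | mul x y hx hy => rw [map_mul, map_mul, hx, hy, map_mul]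
  | add x y hx hy => rw [map_add, map_add, hx, hy, map_add]

instance finite_exterior [Module.Finite ℂ V] : Module.Finite ℂ (ExteriorAlgebra ℂ V) :=
  Module.Finite.of_basis (Module.finBasis ℂ V).ExteriorAlgebra

end Grassmann

section Deriv
variable {E A : Type} [NormedAddCommGroup E] [NormedSpace ℂ E] [FiniteDimensional ℂ E]
  [Ring A] [Algebra ℂ A]

/-- `f` is complex differentiable at `x` with derivative `f'`, for a function with values in a
(finite-dimensional) algebra `A` which carries no chosen norm: every linear coordinate of `f` is
differentiable, with derivative the same coordinate of `f'`. -/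
def HasSuperDerivAt (f : E → A) (f' : E →ₗ[ℂ] A) (x : E) : Prop :=
  ∀ ℓ : Module.Dual ℂ A,
    HasFDerivAt (fun y => ℓ (f y)) (LinearMap.toContinuousLinearMap (ℓ ∘ₗ f')) x

theorem HasSuperDerivAt.congr {f g : E → A} {f' : E →ₗ[ℂ] A} {x : E}
    (h : HasSuperDerivAt f f' x) (hfg : g =ᶠ[nhds x] f) : HasSuperDerivAt g f' x :=
  fun ℓ => (h ℓ).congr_of_eventuallyEq (hfg.mono fun y hy => by simp only [hy])

theorem HasSuperDerivAt.const (a : A) (x : E) : HasSuperDerivAt (fun _ : E => a) 0 x :=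
  fun ℓ => (hasFDerivAt_const (𝕜 := ℂ) (ℓ a) x).congr_fderiv (by ext; simp)

theorem HasSuperDerivAt.add {f g : E → A} {f' g' : E →ₗ[ℂ] A} {x : E}
    (hf : HasSuperDerivAt f f' x) (hg : HasSuperDerivAt g g' x) :
    HasSuperDerivAt (fun y => f y + g y) (f' + g') x := by
  intro ℓ
  simp only [map_add]
  exact ((hf ℓ).fun_add (hg ℓ)).congr_fderiv (by ext; simp)

theorem HasSuperDerivAt.comp_linear {B : Type} [Ring B] [Algebra ℂ B] {f : E → A}
    {f' : E →ₗ[ℂ] A} {x : E} (hf : HasSuperDerivAt f f' x) (L : A →ₗ[ℂ] B) :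
    HasSuperDerivAt (fun y => L (f y)) (L ∘ₗ f') x :=
  fun ℓ => hf (ℓ ∘ₗ L)

theorem HasSuperDerivAt.mul [Module.Finite ℂ A] {f g : E → A} {f' g' : E →ₗ[ℂ] A} {x : E}
    (hf : HasSuperDerivAt f f' x) (hg : HasSuperDerivAt g g' x) :
    HasSuperDerivAt (fun y => f y * g y)
      (LinearMap.mulRight ℂ (g x) ∘ₗ f' + LinearMap.mulLeft ℂ (f x) ∘ₗ g') x := by
  intro ℓ
  let b := Module.finBasis ℂ A
  have key : ∀ u v : A, ℓ (u * v) = ∑ i, ∑ j, b.coord i u * b.coord j v * ℓ (b i * b j) := by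
    intro u v
    conv_lhs => rw [← b.sum_repr u, ← b.sum_repr v]
    simp only [Finset.sum_mul, Finset.mul_sum, map_sum, smul_mul_assoc, mul_smul_comm, map_smul,
      smul_eq_mul, Module.Basis.coord_apply]
    rw [Finset.sum_comm]
    refine Finset.sum_congr rfl fun i _ => Finset.sum_congr rfl fun j _ => by ring
  have h := HasFDerivAt.fun_sum (u := Finset.univ) fun i _ =>
    HasFDerivAt.fun_sum (u := Finset.univ) fun j _ =>
      (((hf (b.coord i)).fun_mul (hg (b.coord j))).mul_const (ℓ (b i * b j)))
  have hfun : (fun y => ℓ (f y * g y)) = fun y =>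
      ∑ i, ∑ j, b.coord i (f y) * b.coord j (g y) * ℓ (b i * b j) := funext fun y => key _ _
  rw [hfun]
  refine h.congr_fderiv ?_
  ext e
  simp only [LinearMap.coe_toContinuousLinearMap', LinearMap.comp_apply, LinearMap.add_apply,
    map_add, LinearMap.mulRight_apply, LinearMap.mulLeft_apply,
    sum_apply, smul_apply, add_apply, smul_eq_mul]
  rw [key (f' e) (g x), key (f x) (g' e)]
  rw [← Finset.sum_add_distrib]
  refine Finset.sum_congr rfl fun i _ => ?_
  rw [← Finset.sum_add_distrib]
  refine Finset.sum_congr rfl fun j _ => by ring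

end Deriv


/-- A superspace: a topological space with a sheaf of supercommutative complex superalgebras. The
`ℤ/2`-grading of the sheaf is given by its parity automorphism, which is `1` on even sections and
`-1` on odd sections. -/
structure SuperSpace extends AlgebraicGeometry.SheafedSpace (AlgCat.{0} ℂ) where
  parity : presheaf ⟶ presheaf
  parity_comp_parity : parity ≫ parity = 𝟙 presheaf
  even_mul : ∀ (U : Opens carrier) (a b : presheaf.obj (op U)),
    parity.app (op U) a = a → a * b = b * a
  odd_mul_odd : ∀ (U : Opens carrier) (a b : presheaf.obj (op U)),
    parity.app (op U) a = -a → parity.app (op U) b = -b → a * b = -(b * a)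

namespace SuperSpace

/-- Morphisms of superspaces: a continuous map with a pull-back of sections that is a morphism of
sheaves of superalgebras (it preserves parity) and is local (if the pull-back of `s` is invertible
near `x`, then `s` is invertible near the image of `x`). -/
structure Hom (X Y : SuperSpace) where
  toHom : X.toSheafedSpace ⟶ Y.toSheafedSpace
  parity_comm : ∀ (V : Opens Y.carrier) (s : Y.presheaf.obj (op V)),
    toHom.hom.c.app (op V) (Y.parity.app (op V) s)
      = X.parity.app (op ((Opens.map toHom.hom.base).obj V)) (toHom.hom.c.app (op V) s)
  isLocal : ∀ (V : Opens Y.carrier) (s : Y.presheaf.obj (op V)) (x : X.carrier),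
    (∃ (W : Opens X.carrier) (hW : W ≤ (Opens.map toHom.hom.base).obj V),
      x ∈ W ∧ IsUnit (X.presheaf.map (homOfLE hW).op (toHom.hom.c.app (op V) s))) →
    ∃ (W : Opens Y.carrier) (hW : W ≤ V),
      toHom.hom.base x ∈ W ∧ IsUnit (Y.presheaf.map (homOfLE hW).op s)

theorem isUnit_res (X : SuperSpace) {U V W : Opens X.carrier} (hVU : V ≤ U) (hWV : W ≤ V)
    (s : X.presheaf.obj (op U)) (h : IsUnit (X.presheaf.map (homOfLE hVU).op s)) :
    IsUnit (X.presheaf.map (homOfLE (hWV.trans hVU)).op s) := by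
  have := h.map (X.presheaf.map (homOfLE hWV).op).hom
  have e : (homOfLE (hWV.trans hVU)).op = (homOfLE hVU).op ≫ (homOfLE hWV).op := rfl
  rw [e, X.presheaf.map_comp]
  exact this

def Hom.id (X : SuperSpace) : Hom X X where
  toHom := 𝟙 X.toSheafedSpace
  parity_comm _ _ := rfl
  isLocal _ _ _ h := h

def Hom.comp {X Y Z : SuperSpace} (f : Hom X Y) (g : Hom Y Z) : Hom X Z where
  toHom := f.toHom ≫ g.toHom
  parity_comm V s := by
    have h1 := g.parity_comm V s
    have h2 := f.parity_comm ((Opens.map g.toHom.hom.base).obj V) (g.toHom.hom.c.app (op V) s)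
    exact (congrArg (f.toHom.hom.c.app (op ((Opens.map g.toHom.hom.base).obj V))) h1).trans h2
  isLocal V s x := by
    rintro ⟨W, hW, hx, hu⟩
    obtain ⟨W₁, hW₁, hx₁, hu₁⟩ := f.isLocal ((Opens.map g.toHom.hom.base).obj V)
      (g.toHom.hom.c.app (op V) s) x ⟨W, hW, hx, hu⟩
    exact g.isLocal V s (f.toHom.hom.base x) ⟨W₁, hW₁, hx₁, hu₁⟩

instance : Category SuperSpace where
  Hom := Hom
  id := Hom.id
  comp := Hom.comp
  id_comp f := by
    cases f; simp only [Hom.comp, Hom.id, Category.id_comp]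
  comp_id f := by
    cases f; simp only [Hom.comp, Hom.id, Category.comp_id]
  assoc f g h := by
    simp only [Hom.comp, Category.assoc]

/-- `f` identifies `X` with a closed sub-superspace of `Y`: it is a closed embedding of topological
spaces and the pull-back of sections is surjective on stalks. -/
structure IsClosedEmbedding {X Y : SuperSpace} (f : X ⟶ Y) : Prop where
  base : Topology.IsClosedEmbedding f.toHom.hom.base
  locally_surjective : ∀ (U : Opens X.carrier) (s : X.presheaf.obj (op U)) (x : X.carrier),
    x ∈ U → ∃ (V : Opens Y.carrier) (t : Y.presheaf.obj (op V)) (W : Opens X.carrier)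
      (hWU : W ≤ U) (hWV : W ≤ (Opens.map f.toHom.hom.base).obj V), x ∈ W ∧
      X.presheaf.map (homOfLE hWU).op s
        = X.presheaf.map (homOfLE hWV).op (f.toHom.hom.c.app (op V) t)

end SuperSpace

section FunctionSheaf

variable {X : TopCat.{0}} {T A : Type} [Ring A] [Algebra ℂ A]

/-- The part of `T` lying over `U`. -/
abbrev Over (π : T → X) (U : Opens X) : Type := {t : T // π t ∈ U}

def restr (π : T → X) {U V : Opens X} (h : V ≤ U) (s : Over π U → A) : Over π V → A :=
  fun t => s ⟨t.1, h t.2⟩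

/-- A family of algebras of `A`-valued functions on the sets `π ⁻¹ U`, cut out by a condition
`P U s t` at every point `t` that depends only on `s` over a neighbourhood of `π t`. -/
structure LocalSubalgebra (π : T → X) (A : Type) [Ring A] [Algebra ℂ A] where
  P : ∀ U : Opens X, (Over π U → A) → Over π U → Prop
  P_res : ∀ {U V : Opens X} (h : V ≤ U) (s : Over π U → A) (t : Over π V),
    P V (restr π h s) t ↔ P U s ⟨t.1, h t.2⟩
  P_const : ∀ (U : Opens X) (r : ℂ) (t : Over π U), P U (fun _ => algebraMap ℂ A r) t
  P_add : ∀ (U : Opens X) (f g : Over π U → A) (t : Over π U),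
    P U f t → P U g t → P U (fun u => f u + g u) t
  P_mul : ∀ (U : Opens X) (f g : Over π U → A) (t : Over π U),
    P U f t → P U g t → P U (fun u => f u * g u) t

namespace LocalSubalgebra
variable {π : T → X} (S : LocalSubalgebra π A)

def sections (U : Opens X) : Subalgebra ℂ (Over π U → A) where
  carrier := {f | ∀ t, S.P U f t}
  mul_mem' hf hg t := S.P_mul U _ _ t (hf t) (hg t)
  add_mem' hf hg t := S.P_add U _ _ t (hf t) (hg t)
  algebraMap_mem' r t := S.P_const U r t

def resHom {U V : Opens X} (h : V ≤ U) : S.sections U →ₐ[ℂ] S.sections V where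
  toFun s := ⟨restr π h s.1, fun t => (S.P_res h s.1 t).2 (s.2 _)⟩
  map_one' := rfl
  map_mul' _ _ := rfl
  map_zero' := rfl
  map_add' _ _ := rfl
  commutes' _ := rfl

def presheaf : TopCat.Presheaf (AlgCat.{0} ℂ) X where
  obj U := AlgCat.of ℂ (S.sections U.unop)
  map i := AlgCat.ofHom (S.resHom i.unop.le)
  map_id _ := rfl
  map_comp _ _ := rfl

theorem isSheaf : S.presheaf.IsSheaf := by
  rw [TopCat.Presheaf.isSheaf_iff_isSheafUniqueGluing]
  intro ι U sf hsf
  have hex : ∀ t : Over π (iSup U), ∃ i, π t.1 ∈ U i := fun t => Opens.mem_iSup.1 t.2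
  choose k hk using hex
  have hcompat : ∀ (i j : ι) (t : T) (hi : π t ∈ U i) (hj : π t ∈ U j),
      (show S.sections (U i) from sf i).1 ⟨t, hi⟩ = (show S.sections (U j) from sf j).1 ⟨t, hj⟩ := by
    intro i j t hi hj
    have h := hsf i j
    exact congrFun (congrArg Subtype.val h) ⟨t, ⟨hi, hj⟩⟩
  let g : Over π (iSup U) → A := fun t => (show S.sections (U (k t)) from sf (k t)).1 ⟨t.1, hk t⟩
  have hg : ∀ i, restr π (le_iSup U i) g = (show S.sections (U i) from sf i).1 := fun i =>
    funext fun t => hcompat _ _ _ _ _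
  have hgm : g ∈ S.sections (iSup U) := by
    intro t
    have h1 := (S.P_res (le_iSup U (k t)) g ⟨t.1, hk t⟩).1
    apply h1
    rw [hg]
    exact (show S.sections (U (k t)) from sf (k t)).2 _
  refine ⟨(show S.sections (iSup U) from ⟨g, hgm⟩), ?_, ?_⟩
  · intro i
    exact Subtype.ext (hg i)
  · intro s hs
    refine Subtype.ext (funext fun t => ?_)
    exact congrFun (congrArg Subtype.val (hs (k t))) ⟨t.1, hk t⟩

end LocalSubalgebra

variable {V : Type} [AddCommGroup V] [Module ℂ V]

/-- The superspace `X` with the sheaf of those functions, when they are valued in a Grassmann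
algebra; parity is taken pointwise. -/
def LocalSubalgebra.toSuperSpace {π : T → X} (S : LocalSubalgebra π (ExteriorAlgebra ℂ V))
    (hS : ∀ (U : Opens X) (f : Over π U → ExteriorAlgebra ℂ V) (t : Over π U),
      S.P U f t → S.P U (fun u => CliffordAlgebra.involute (f u)) t) : SuperSpace where
  carrier := X
  presheaf := S.presheaf
  IsSheaf := S.isSheaf
  parity :=
    { app := fun U => AlgCat.ofHom
        { toFun := fun s => ⟨fun u => CliffordAlgebra.involute (s.1 u), fun t => hS _ _ t (s.2 t)⟩
          map_one' := Subtype.ext (funext fun _ => map_one _)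
          map_mul' := fun _ _ => Subtype.ext (funext fun _ => map_mul _ _ _)
          map_zero' := Subtype.ext (funext fun _ => map_zero _)
          map_add' := fun _ _ => Subtype.ext (funext fun _ => map_add _ _ _)
          commutes' := fun _ => Subtype.ext (funext fun _ => AlgHom.commutes _ _) }
      naturality := fun _ _ _ => rfl }
  parity_comp_parity := by
    ext U s
    exact Subtype.ext (funext fun _ => CliffordAlgebra.involute_involute _)
  even_mul _ _ _ h := Subtype.ext (funext fun t =>
    even_comm (congrFun (congrArg Subtype.val h) t) _)
  odd_mul_odd _ a b ha hb := Subtype.ext (funext fun t => by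
    have h1 := odd_comm (congrFun (congrArg Subtype.val ha) t) (b.1 t)
    have h2 := congrFun (congrArg Subtype.val hb) t
    exact h1.trans ((congrArg (· * a.1 t) h2).trans (neg_mul _ _)))

end FunctionSheaf

section Frames

variable {X : TopCat.{0}} {Y A E : Type} [TopologicalSpace Y] [Ring A] [Algebra ℂ A]
  [NormedAddCommGroup E] [NormedSpace ℂ E] [FiniteDimensional ℂ E]
  {D : Set Y} {π : D → X} {U : Opens X}

/-- Extension of a section by zero outside its (open) domain. -/
def extZero (s : Over π U → A) : Y → A := Function.extend (fun t : Over π U => (t.1 : Y)) s 0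

theorem extZero_apply (s : Over π U → A) (t : Over π U) : extZero s (t.1 : Y) = s t :=
  Function.Injective.extend_apply
    (fun a b h => Subtype.ext (Subtype.ext h)) s 0 t

theorem eventually_over (hD : IsOpen D) (hπ : Continuous π) (t : Over π U) (m : E → Y)
    (hm : Continuous m) (x : E) (hx : m x = t.1) :
    ∀ᶠ y in nhds x, ∃ u : Over π U, (u.1 : Y) = m y := by
  have hO : IsOpen ((Subtype.val : D → Y) '' (π ⁻¹' (U : Set X))) :=
    hD.isOpenMap_subtype_val _ (U.isOpen.preimage hπ)
  have hmem : m x ∈ (Subtype.val : D → Y) '' (π ⁻¹' (U : Set X)) := ⟨t.1, t.2, hx.symm⟩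
  filter_upwards [hm.continuousAt.preimage_mem_nhds (hO.mem_nhds hmem)] with y hy
  obtain ⟨d, hd, hdy⟩ := hy
  exact ⟨⟨d, hd⟩, hdy⟩

theorem superDeriv_const (hD : IsOpen D) (hπ : Continuous π) (t : Over π U) (m : E → Y)
    (hm : Continuous m) (x : E) (hx : m x = t.1) (r : A) :
    HasSuperDerivAt (fun y => extZero (fun _ : Over π U => r) (m y)) 0 x := by
  refine (HasSuperDerivAt.const r x).congr ?_
  filter_upwards [eventually_over hD hπ t m hm x hx] with y ⟨u, hu⟩
  rw [← hu, extZero_apply]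

theorem superDeriv_add (hD : IsOpen D) (hπ : Continuous π) (t : Over π U) (m : E → Y)
    (hm : Continuous m) (x : E) (hx : m x = t.1) {f g : Over π U → A} {f' g' : E →ₗ[ℂ] A}
    (hf : HasSuperDerivAt (fun y => extZero f (m y)) f' x)
    (hg : HasSuperDerivAt (fun y => extZero g (m y)) g' x) :
    HasSuperDerivAt (fun y => extZero (fun u => f u + g u) (m y)) (f' + g') x := by
  refine (hf.add hg).congr ?_
  filter_upwards [eventually_over hD hπ t m hm x hx] with y ⟨u, hu⟩
  rw [← hu, extZero_apply, extZero_apply, extZero_apply]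

theorem superDeriv_mul [Module.Finite ℂ A] (hD : IsOpen D) (hπ : Continuous π) (t : Over π U)
    (m : E → Y) (hm : Continuous m) (x : E) (hx : m x = t.1) {f g : Over π U → A}
    {f' g' : E →ₗ[ℂ] A}
    (hf : HasSuperDerivAt (fun y => extZero f (m y)) f' x)
    (hg : HasSuperDerivAt (fun y => extZero g (m y)) g' x) :
    HasSuperDerivAt (fun y => extZero (fun u => f u * g u) (m y))
      (LinearMap.mulRight ℂ (g t) ∘ₗ f' + LinearMap.mulLeft ℂ (f t) ∘ₗ g') x := by
  have h := hf.mul hg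
  rw [hx, extZero_apply, extZero_apply] at h
  refine h.congr ?_
  filter_upwards [eventually_over hD hπ t m hm x hx] with y ⟨u, hu⟩
  rw [← hu, extZero_apply, extZero_apply, extZero_apply]

theorem superDeriv_linear (hD : IsOpen D) (hπ : Continuous π) (t : Over π U) (m : E → Y)
    (hm : Continuous m) (x : E) (hx : m x = t.1) {f : Over π U → A} {f' : E →ₗ[ℂ] A}
    (hf : HasSuperDerivAt (fun y => extZero f (m y)) f' x) (L : A →ₗ[ℂ] A) :
    HasSuperDerivAt (fun y => extZero (fun u => L (f u)) (m y)) (L ∘ₗ f') x := by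
  refine (hf.comp_linear L).congr ?_
  filter_upwards [eventually_over hD hπ t m hm x hx] with y ⟨u, hu⟩
  rw [← hu, extZero_apply, extZero_apply]

theorem superDeriv_res {V : Opens X} (h : V ≤ U) (hD : IsOpen D) (hπ : Continuous π)
    (t : Over π V) (m : E → Y) (hm : Continuous m) (x : E) (hx : m x = t.1) (f : Over π U → A)
    (f' : E →ₗ[ℂ] A) :
    HasSuperDerivAt (fun y => extZero (restr π h f) (m y)) f' x
      ↔ HasSuperDerivAt (fun y => extZero f (m y)) f' x := by
  have key : (fun y => extZero (restr π h f) (m y)) =ᶠ[nhds x] fun y => extZero f (m y) := by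
    filter_upwards [eventually_over hD hπ t m hm x hx] with y ⟨u, hu⟩
    rw [← hu, extZero_apply]
    exact (extZero_apply f ⟨u.1, h u.2⟩).symm
  exact ⟨fun hh => hh.congr key.symm, fun hh => hh.congr key⟩

end Frames

section OddField

variable {V E κ : Type} [AddCommGroup V] [Module ℂ V] [AddCommGroup E] [Module ℂ E] [Fintype κ]

/-- The value at a point of the odd vector field `d + ∑ k, w k • ∂/∂(e k)` applied to a superfunction
with value `a` and derivative `a'` in the even directions at that point. The odd coordinates span
`V`, the functional `d` acts on them as an odd derivation (contraction), and `w k` is multiplied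
from the left. -/
def oddField (d : Module.Dual ℂ V) (w : κ → V) (e : κ → E) (a : ExteriorAlgebra ℂ V)
    (a' : E →ₗ[ℂ] ExteriorAlgebra ℂ V) : ExteriorAlgebra ℂ V :=
  CliffordAlgebra.contractLeft d a + ∑ k, ExteriorAlgebra.ι ℂ (w k) * a' (e k)

variable (d : Module.Dual ℂ V) (w : κ → V) (e : κ → E) (a b : ExteriorAlgebra ℂ V)
    (a' b' : E →ₗ[ℂ] ExteriorAlgebra ℂ V)

theorem oddField_const (r : ℂ) : oddField d w e (algebraMap ℂ _ r) 0 = 0 := by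
  simp [oddField, CliffordAlgebra.contractLeft_algebraMap]

theorem oddField_add : oddField d w e (a + b) (a' + b')
    = oddField d w e a a' + oddField d w e b b' := by
  simp only [oddField, map_add, LinearMap.add_apply, mul_add, Finset.sum_add_distrib]
  abel

theorem oddField_mul : oddField d w e (a * b)
      (LinearMap.mulRight ℂ b ∘ₗ a' + LinearMap.mulLeft ℂ a ∘ₗ b')
    = oddField d w e a a' * b + CliffordAlgebra.involute a * oddField d w e b b' := by
  simp only [oddField, contract_mul, LinearMap.add_apply, LinearMap.comp_apply,
    LinearMap.mulRight_apply, LinearMap.mulLeft_apply, mul_add, add_mul, Finset.sum_add_distrib,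
    Finset.sum_mul, Finset.mul_sum]
  have h : ∀ k, ExteriorAlgebra.ι ℂ (w k) * (a * b' (e k))
      = CliffordAlgebra.involute a * (ExteriorAlgebra.ι ℂ (w k) * b' (e k)) := fun k => by
    rw [← mul_assoc, ι_mul_comm, mul_assoc]
  simp only [h, mul_assoc]
  abel

theorem oddField_involute : oddField d w e (CliffordAlgebra.involute a)
      (CliffordAlgebra.involute.toLinearMap ∘ₗ a')
    = -CliffordAlgebra.involute (oddField d w e a a') := by
  have h2 : ∀ v : V, CliffordAlgebra.involute (ExteriorAlgebra.ι ℂ v) = -ExteriorAlgebra.ι ℂ v :=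
    fun v => CliffordAlgebra.involute_ι v
  simp only [oddField, contract_involute, map_add, map_sum, map_mul, h2, LinearMap.comp_apply,
    AlgHom.toLinearMap_apply, neg_add, neg_mul, Finset.sum_neg_distrib, neg_neg]

end OddField

abbrev C3 : Type := Fin 3 → ℂ

/-- The complex projective plane, with the quotient topology. -/
abbrev P2 : Type := Projectivization ℂ C3

instance : TopologicalSpace P2 :=
  inferInstanceAs (TopologicalSpace (Quotient (projectivizationSetoid ℂ C3)))

abbrev stdBasis (k : Fin 3) : C3 := Pi.single k 1

/-- The functional `e_k ↦ v k`; contraction with it is `∑ k, v k • ∂/∂θ_k`. -/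
def dualOf (v : C3) : Module.Dual ℂ C3 := ∑ k, v k • LinearMap.proj k

abbrev scal (c : ℂ) : C3 →ₗ[ℂ] C3 := c • LinearMap.id

def coneProj (z : {z : C3 // z ≠ 0}) : P2 := Projectivization.mk ℂ z.1 z.2

theorem coneProj_continuous : Continuous coneProj :=
  continuous_quotient_mk' (s := projectivizationSetoid ℂ C3)

theorem coneProj_smul (z w : {z : C3 // z ≠ 0}) (c : ℂ) (h : w.1 = c • z.1) :
    coneProj w = coneProj z :=
  (Projectivization.mk_eq_mk_iff' ℂ _ _ _ _).2 ⟨c, h.symm⟩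

section PiPlane

abbrev PiFrames : Set C3 := {z | z ≠ 0}

abbrev piProj : PiFrames → TopCat.of P2 := fun z => coneProj z

theorem isOpen_piFrames : IsOpen PiFrames := isOpen_ne

theorem piProj_continuous : Continuous piProj := coneProj_continuous

/-- Superfunctions on the space of frames of `Π`-symmetric `1|1`-subspaces of `ℂ^{3|3}`.
A `Π`-symmetric subspace has a frame `(v, p v)` with `v = (z | θ)` even, `p v = (-θ | z)`, and
`z ≠ 0`, so the superfunctions on frames are the holomorphic functions of `z` with values in the
Grassmann algebra on `θ_0, θ_1, θ_2`. Changes of frame `v ↦ c v + α p v`, with `c` even invertible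
and `α` odd, form a super Lie group with underlying group `ℂˣ`. A section is a superfunction that is
invariant under this group: it is invariant under the scalings `c`, and it is annihilated by the
odd generator `∑ (z_k ∂/∂θ_k - θ_k ∂/∂z_k)` of `z ↦ z - α θ`, `θ ↦ θ + α z`. -/
def piSections : LocalSubalgebra piProj (ExteriorAlgebra ℂ C3) where
  P U s t :=
    (∃ s' : C3 →ₗ[ℂ] ExteriorAlgebra ℂ C3, HasSuperDerivAt (fun z => extZero s z) s' t.1.1 ∧
      oddField (dualOf t.1.1) (fun k => -stdBasis k) stdBasis (s t) s' = 0) ∧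
    ∀ (c : ℂ) (u : Over piProj U), c ≠ 0 → u.1.1 = c • t.1.1 →
      ExteriorAlgebra.map (scal c) (s u) = s t
  P_res {U V} h s t := by
    refine and_congr (exists_congr fun s' => and_congr ?_ Iff.rfl) ?_
    · exact superDeriv_res h isOpen_piFrames piProj_continuous t _ continuous_id _ rfl s s'
    · refine ⟨fun H c u hc hu => H c ⟨u.1, ?_⟩ hc hu, fun H c u hc hu => H c ⟨u.1, h u.2⟩ hc hu⟩
      have : piProj u.1 = piProj t.1 := coneProj_smul _ _ c hu
      rw [this]; exact t.2
  P_const U r t := by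
    refine ⟨⟨0, superDeriv_const isOpen_piFrames piProj_continuous t _ continuous_id _ rfl _,
      oddField_const _ _ _ r⟩, fun c u _ _ => by simp⟩
  P_add U f g t := by
    rintro ⟨⟨f', hf, hf0⟩, hfc⟩ ⟨⟨g', hg, hg0⟩, hgc⟩
    refine ⟨⟨f' + g', superDeriv_add isOpen_piFrames piProj_continuous t _ continuous_id _ rfl
      hf hg, ?_⟩, fun c u hc hu => ?_⟩
    · rw [oddField_add, hf0, hg0, add_zero]
    · rw [map_add, hfc c u hc hu, hgc c u hc hu]
  P_mul U f g t := by
    rintro ⟨⟨f', hf, hf0⟩, hfc⟩ ⟨⟨g', hg, hg0⟩, hgc⟩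
    refine ⟨⟨_, superDeriv_mul isOpen_piFrames piProj_continuous t _ continuous_id _ rfl
      hf hg, ?_⟩, fun c u hc hu => ?_⟩
    · rw [oddField_mul, hf0, hg0, zero_mul, mul_zero, add_zero]
    · rw [map_mul, hfc c u hc hu, hgc c u hc hu]

/-- The `Π`-projective plane: the Grassmannian of `Π`-symmetric `1|1`-subspaces of `ℂ^{3|3}`. -/
def piPlane : SuperSpace := piSections.toSuperSpace (by
  rintro U f t ⟨⟨f', hf, hf0⟩, hfc⟩
  refine ⟨⟨_, superDeriv_linear isOpen_piFrames piProj_continuous t _ continuous_id _ rfl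
    hf CliffordAlgebra.involute.toLinearMap, ?_⟩, fun c u hc hu => ?_⟩
  · exact (oddField_involute _ _ _ _ _).trans (by rw [hf0]; simp)
  · rw [map_involute, hfc c u hc hu])

end PiPlane

section Grassmannian

/-- The reduced space of the space of frames of `1|1`-subspaces of `ℂ^{3|3}`: a frame has an even
row `(x | ξ)` and an odd row `(η | y)`, with `x` and `y` non-zero. -/
abbrev GrFrames : Set (C3 × C3) := {p | p.1 ≠ 0 ∧ p.2 ≠ 0}

abbrev grProj : GrFrames → TopCat.of (P2 × P2) :=
  fun p => (coneProj ⟨p.1.1, p.2.1⟩, coneProj ⟨p.1.2, p.2.2⟩)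

theorem isOpen_grFrames : IsOpen GrFrames :=
  (isOpen_ne.preimage continuous_fst).inter (isOpen_ne.preimage continuous_snd)

theorem grProj_continuous : Continuous grProj := by
  refine Continuous.prodMk ?_ ?_
  · exact coneProj_continuous.comp
      (Continuous.subtype_mk (continuous_fst.comp continuous_subtype_val) _)
  · exact coneProj_continuous.comp
      (Continuous.subtype_mk (continuous_snd.comp continuous_subtype_val) _)

/-- Superfunctions on the space of frames `[(x | ξ), (η | y)]` of `1|1`-subspaces of `ℂ^{3|3}` that
are invariant under row operations, that is under the super Lie group `GL(1|1)`. A superfunction on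
frames is a holomorphic function of `(x, y)` with values in the Grassmann algebra on the `ξ_k` (basis
of the first factor of `C3 × C3`) and the `η_k` (second factor). Invariance under `GL(1|1)` means
invariance under its underlying group `ℂˣ × ℂˣ` (scaling of the two rows) and annihilation by the two
odd generators of its Lie superalgebra: `∑ (y_k ∂/∂ξ_k + η_k ∂/∂x_k)`, which adds an odd multiple of
the second row to the first one, and `∑ (x_k ∂/∂η_k + ξ_k ∂/∂y_k)`, which adds an odd multiple of
the first row to the second one. -/
def grSections : LocalSubalgebra grProj (ExteriorAlgebra ℂ (C3 × C3)) where
  P U s t :=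
    (∃ s' : C3 × C3 →ₗ[ℂ] ExteriorAlgebra ℂ (C3 × C3),
      HasSuperDerivAt (fun z => extZero s z) s' t.1.1 ∧
      oddField (dualOf t.1.1.2 ∘ₗ LinearMap.fst ℂ C3 C3) (fun k => (0, stdBasis k))
        (fun k => (stdBasis k, 0)) (s t) s' = 0 ∧
      oddField (dualOf t.1.1.1 ∘ₗ LinearMap.snd ℂ C3 C3) (fun k => (stdBasis k, 0))
        (fun k => (0, stdBasis k)) (s t) s' = 0) ∧
    ∀ (c d : ℂ) (u : Over grProj U), c ≠ 0 → d ≠ 0 → u.1.1 = (c • t.1.1.1, d • t.1.1.2) →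
      ExteriorAlgebra.map (LinearMap.prodMap (scal c) (scal d)) (s u) = s t
  P_res {U V} h s t := by
    refine and_congr (exists_congr fun s' => and_congr ?_ Iff.rfl) ?_
    · exact superDeriv_res h isOpen_grFrames grProj_continuous t _ continuous_id _ rfl s s'
    · refine ⟨fun H c d u hc hd hu => H c d ⟨u.1, ?_⟩ hc hd hu,
        fun H c d u hc hd hu => H c d ⟨u.1, h u.2⟩ hc hd hu⟩
      have : grProj u.1 = grProj t.1 := Prod.ext
        (coneProj_smul _ _ c (congrArg Prod.fst hu)) (coneProj_smul _ _ d (congrArg Prod.snd hu))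
      rw [this]; exact t.2
  P_const U r t := by
    refine ⟨⟨0, superDeriv_const isOpen_grFrames grProj_continuous t _ continuous_id _ rfl _,
      oddField_const _ _ _ r, oddField_const _ _ _ r⟩, fun c d u _ _ _ => by simp⟩
  P_add U f g t := by
    rintro ⟨⟨f', hf, hf0, hf1⟩, hfc⟩ ⟨⟨g', hg, hg0, hg1⟩, hgc⟩
    refine ⟨⟨f' + g', superDeriv_add isOpen_grFrames grProj_continuous t _ continuous_id _ rfl
      hf hg, ?_, ?_⟩, fun c d u hc hd hu => ?_⟩
    · rw [oddField_add, hf0, hg0, add_zero]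
    · rw [oddField_add, hf1, hg1, add_zero]
    · rw [map_add, hfc c d u hc hd hu, hgc c d u hc hd hu]
  P_mul U f g t := by
    rintro ⟨⟨f', hf, hf0, hf1⟩, hfc⟩ ⟨⟨g', hg, hg0, hg1⟩, hgc⟩
    refine ⟨⟨_, superDeriv_mul isOpen_grFrames grProj_continuous t _ continuous_id _ rfl
      hf hg, ?_, ?_⟩, fun c d u hc hd hu => ?_⟩
    · rw [oddField_mul, hf0, hg0, zero_mul, mul_zero, add_zero]
    · rw [oddField_mul, hf1, hg1, zero_mul, mul_zero, add_zero]
    · rw [map_mul, hfc c d u hc hd hu, hgc c d u hc hd hu]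

/-- The super Grassmannian `G(1|1, ℂ^{3|3})`, the quotient of the space of frames by `GL(1|1)`. Its
reduced space is `Gr(1, ℂ³) × Gr(1, ℂ³)`. -/
def superGrassmannian : SuperSpace := grSections.toSuperSpace (by
  rintro U f t ⟨⟨f', hf, hf0, hf1⟩, hfc⟩
  refine ⟨⟨_, superDeriv_linear isOpen_grFrames grProj_continuous t _ continuous_id _ rfl
    hf CliffordAlgebra.involute.toLinearMap, ?_, ?_⟩, fun c d u hc hd hu => ?_⟩
  · exact (oddField_involute _ _ _ _ _).trans (by rw [hf0]; simp)
  · exact (oddField_involute _ _ _ _ _).trans (by rw [hf1]; simp)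
  · rw [map_involute, hfc c d u hc hd hu])

end Grassmannian

section Plane

/-- The disjoint union over `i` of the cones `{X_i ≠ 0}` in `ℂ³` over the standard affine charts
`U_i` of the projective plane. A function on the part of it over `U` is a triple `s_0, s_1, s_2` with
`s_i` a function on the cone over `U ∩ U_i`. -/
abbrev PlaneFrames : Set (Fin 3 × C3) := {p | p.2 p.1 ≠ 0}

theorem planeFrames_ne_zero (p : PlaneFrames) : p.1.2 ≠ 0 := fun h => p.2 (by rw [h]; rfl)

abbrev planeProj : PlaneFrames → TopCat.of P2 := fun p => coneProj ⟨p.1.2, planeFrames_ne_zero p⟩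

theorem isOpen_planeFrames : IsOpen PlaneFrames := by
  have h : Continuous fun p : Fin 3 × C3 => p.2 p.1 :=
    continuous_prod_of_discrete_left.2 fun i => continuous_apply i
  exact isOpen_ne.preimage h

theorem planeProj_continuous : Continuous planeProj :=
  coneProj_continuous.comp
    (Continuous.subtype_mk (continuous_snd.comp continuous_subtype_val) _)

/-- `dX_0 ∧ dX_1 ∧ dX_2` -/
def volForm : ExteriorAlgebra ℂ C3 := ExteriorAlgebra.ιMulti ℂ 3 stdBasis

/-- `X_0 dX_1 ∧ dX_2 + X_1 dX_2 ∧ dX_0 + X_2 dX_0 ∧ dX_1`, the contraction of `dX_0 ∧ dX_1 ∧ dX_2`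
with the Euler field. -/
def eulerForm (z : C3) : ExteriorAlgebra ℂ C3 := CliffordAlgebra.contractLeft (dualOf z) volForm

/-- The degree zero component of a form. -/
abbrev body : ExteriorAlgebra ℂ C3 →ₐ[ℂ] ℂ := ExteriorAlgebra.algebraMapInv

theorem body_ι (v : C3) : body (ExteriorAlgebra.ι ℂ v) = 0 := by
  simp [body, ExteriorAlgebra.algebraMapInv]

theorem ι_mul_volForm (v : C3) : ExteriorAlgebra.ι ℂ v * volForm = 0 := by
  have h : v = ∑ k, v k • stdBasis k := by
    ext j; simp [stdBasis, Finset.sum_apply, Pi.single_apply]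
  rw [h, map_sum, Finset.sum_mul]
  refine Finset.sum_eq_zero fun k _ => ?_
  rw [map_smul, smul_mul_assoc, volForm, ExteriorAlgebra.ιMulti_apply,
    ExteriorAlgebra.ι_mul_prod_list, smul_zero]

theorem mul_volForm (a : ExteriorAlgebra ℂ C3) : a * volForm = body a • volForm := by
  induction a using CliffordAlgebra.left_induction with
  | algebraMap r =>
    have : body (algebraMap ℂ _ r) = r := ExteriorAlgebra.algebraMap_leftInverse C3 r
    rw [this, Algebra.smul_def]
  | add x y hx hy => rw [add_mul, hx, hy, map_add, add_smul]
  | ι_mul x m hx =>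
    have h0 : body (CliffordAlgebra.ι 0 m) = 0 := body_ι m
    have h1 : CliffordAlgebra.ι (0 : QuadraticForm ℂ C3) m * volForm = 0 := ι_mul_volForm m
    rw [mul_assoc, hx, mul_smul_comm, h1, map_mul, h0, zero_mul, zero_smul, smul_zero]

theorem involute_volForm : CliffordAlgebra.involute volForm = -volForm := by
  have h2 : ∀ v : C3, CliffordAlgebra.involute (ExteriorAlgebra.ι ℂ v) = -ExteriorAlgebra.ι ℂ v :=
    fun v => CliffordAlgebra.involute_ι v
  rw [volForm, ExteriorAlgebra.ιMulti_apply]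
  simp [List.ofFn_succ, h2]

theorem involute_eulerForm (z : C3) : CliffordAlgebra.involute (eulerForm z) = eulerForm z := by
  have h := contract_involute (dualOf z) volForm
  rw [involute_volForm, map_neg, neg_inj] at h
  exact h.symm

theorem contract_eulerForm (z : C3) :
    CliffordAlgebra.contractLeft (dualOf z) (eulerForm z) = 0 :=
  CliffordAlgebra.contractLeft_contractLeft _ _

theorem horizontal_mul_eulerForm (z : C3) (a : ExteriorAlgebra ℂ C3)
    (ha : CliffordAlgebra.contractLeft (dualOf z) a = 0) :
    a * eulerForm z = body a • eulerForm z := by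
  have h := contract_mul (dualOf z) (CliffordAlgebra.involute a) volForm
  rw [mul_volForm, contract_involute, ha, CliffordAlgebra.involute_involute, map_smul, map_zero,
    neg_zero, zero_mul, zero_add] at h
  rw [← body_involute a]
  exact h.symm

theorem body_eulerForm (z : C3) : body (eulerForm z) = 0 := by
  have h3 : volForm = CliffordAlgebra.ι (0 : QuadraticForm ℂ C3) (stdBasis 0)
      * (CliffordAlgebra.ι 0 (stdBasis 1) * CliffordAlgebra.ι 0 (stdBasis 2)) := by
    rw [volForm, ExteriorAlgebra.ιMulti_apply]
    simp [List.ofFn_succ]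
  have h0 : ∀ v : C3, body (CliffordAlgebra.ι 0 v) = 0 := body_ι
  rw [eulerForm, h3, CliffordAlgebra.contractLeft_ι_mul]
  simp only [map_sub, map_smul, map_mul, h0, zero_mul, smul_zero, sub_zero]

/-- The structure sheaf of the supermanifold of the triple `(P², ΠΩ¹, l)`. Over the affine chart
`U_i` it is the split one, `O ⊕ ΠΩ¹ ⊕ Ω²` (the differential forms, `Sym² ΠΩ¹ = Ω²`), and these are
glued by the automorphisms `a + b + g ↦ a + b + (g + l ω_{ij}(a))`, where the `ω_{ij}` are derivations
`O → Ω²`. They form the Čech cocycle of the generator of `H¹(T ⊗ Ω²) ≅ H²(O(-3))` given by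
`1 / (X_0 X_1 X_2)`: for `(i, j, k)` a cyclic permutation of `(0, 1, 2)`,
`ω_{ij}(a) = X_k (∂a/∂X_k) / (X_0 X_1 X_2) • eulerForm`.

Functions and forms on open sets of `P²` are written on the cone: they are the holomorphic forms `s` in
`dX_0, dX_1, dX_2` whose contraction with the Euler field `∑ X_k ∂/∂X_k` is zero and that are
invariant under the scalings of the cone. The last condition is the gluing `s_i = s_{i+1} + l ω`. -/
def planeSections (l : ℂ) : LocalSubalgebra planeProj (ExteriorAlgebra ℂ C3) where
  P U s t :=
    ∃ s' : C3 →ₗ[ℂ] ExteriorAlgebra ℂ C3,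
      HasSuperDerivAt (fun z => extZero s (t.1.1.1, z)) s' t.1.1.2 ∧
      CliffordAlgebra.contractLeft (dualOf t.1.1.2) (s t) = 0 ∧
      (∀ (c : ℂ) (u : Over planeProj U), c ≠ 0 → u.1.1 = (t.1.1.1, c • t.1.1.2) →
        ExteriorAlgebra.map (scal c) (s u) = s t) ∧
      ∀ u : Over planeProj U, u.1.1 = (t.1.1.1 + 1, t.1.1.2) →
        s t = s u + (l * body (s' (stdBasis (t.1.1.1 + 2)))
          / (t.1.1.2 t.1.1.1 * t.1.1.2 (t.1.1.1 + 1))) • eulerForm t.1.1.2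
  P_res {U V} h s t := by
    refine exists_congr fun s' => and_congr ?_ (and_congr Iff.rfl (and_congr ?_ ?_))
    · exact superDeriv_res h isOpen_planeFrames planeProj_continuous t _
        (Continuous.prodMk_right _) _ rfl s s'
    · refine ⟨fun H c u hc hu => H c ⟨u.1, ?_⟩ hc hu, fun H c u hc hu => H c ⟨u.1, h u.2⟩ hc hu⟩
      have : planeProj u.1 = planeProj t.1 := coneProj_smul _ _ c (congrArg Prod.snd hu)
      rw [this]; exact t.2
    · refine ⟨fun H u hu => H ⟨u.1, ?_⟩ hu, fun H u hu => H ⟨u.1, h u.2⟩ hu⟩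
      have : planeProj u.1 = planeProj t.1 := coneProj_smul _ _ 1
        ((congrArg Prod.snd hu).trans (one_smul _ _).symm)
      rw [this]; exact t.2
  P_const U r t := by
    refine ⟨0, superDeriv_const isOpen_planeFrames planeProj_continuous t _
      (Continuous.prodMk_right _) _ rfl _, CliffordAlgebra.contractLeft_algebraMap _ _ _,
      fun c u _ _ => by simp, fun u _ => by simp⟩
  P_add U f g t := by
    rintro ⟨f', hf, hf0, hfc, hfg⟩ ⟨g', hg, hg0, hgc, hgg⟩
    refine ⟨f' + g', superDeriv_add isOpen_planeFrames planeProj_continuous t _ 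
      (Continuous.prodMk_right _) _ rfl hf hg, ?_, fun c u hc hu => ?_, fun u hu => ?_⟩
    · rw [map_add, hf0, hg0, add_zero]
    · rw [map_add, hfc c u hc hu, hgc c u hc hu]
    · beta_reduce
      rw [hfg u hu, hgg u hu, LinearMap.add_apply, map_add, mul_add, add_div, add_smul]
      abel
  P_mul U f g t := by
    rintro ⟨f', hf, hf0, hfc, hfg⟩ ⟨g', hg, hg0, hgc, hgg⟩
    refine ⟨_, superDeriv_mul isOpen_planeFrames planeProj_continuous t _ 
      (Continuous.prodMk_right _) _ rfl hf hg, ?_, fun c u hc hu => ?_, fun u hu => ?_⟩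
    · rw [contract_mul, hf0, hg0, zero_mul, mul_zero, add_zero]
    · rw [map_mul, hfc c u hc hu, hgc c u hc hu]
    · have h1 := hfg u hu
      have h2 := hgg u hu
      have hfu : f u = f t - (l * body (f' (stdBasis (t.1.1.1 + 2)))
          / (t.1.1.2 t.1.1.1 * t.1.1.2 (t.1.1.1 + 1))) • eulerForm t.1.1.2 := by
        rw [h1]; abel
      have hgu : g u = g t - (l * body (g' (stdBasis (t.1.1.1 + 2)))
          / (t.1.1.2 t.1.1.1 * t.1.1.2 (t.1.1.1 + 1))) • eulerForm t.1.1.2 := by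
        rw [h2]; abel
      have e1 := horizontal_mul_eulerForm t.1.1.2 (f t) hf0
      have e2 : eulerForm t.1.1.2 * g t = body (g t) • eulerForm t.1.1.2 := by
        rw [even_comm (involute_eulerForm _), horizontal_mul_eulerForm t.1.1.2 (g t) hg0]
      have e3 : eulerForm t.1.1.2 * eulerForm t.1.1.2 = 0 := by
        rw [horizontal_mul_eulerForm _ _ (contract_eulerForm _), body_eulerForm, zero_smul]
      beta_reduce
      rw [hfu, hgu]
      simp only [sub_mul, mul_sub, smul_mul_assoc, mul_smul_comm, e1, e2, e3, smul_zero, sub_zero,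
        LinearMap.add_apply, LinearMap.comp_apply, LinearMap.mulRight_apply,
        LinearMap.mulLeft_apply, map_add, map_mul]
      module

/-- The supermanifold `(P², ΠΩ¹, l)`, with reduced space `P²`, fermionic sheaf `ΠΩ¹` and
obstruction class `l` times the generator of `H¹(T ⊗ Ω²)`. -/
def omegaPlane (l : ℂ) : SuperSpace := (planeSections l).toSuperSpace (by
  rintro U f t ⟨f', hf, hf0, hfc, hfg⟩
  refine ⟨_, superDeriv_linear isOpen_planeFrames planeProj_continuous t _
    (Continuous.prodMk_right _) _ rfl hf CliffordAlgebra.involute.toLinearMap, ?_,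
    fun c u hc hu => ?_, fun u hu => ?_⟩
  · rw [contract_involute, hf0, map_zero, neg_zero]
  · rw [map_involute, hfc c u hc hu]
  · beta_reduce
    rw [hfg u hu, map_add, map_smul, involute_eulerForm, LinearMap.comp_apply]
    simp only [AlgHom.toLinearMap_apply, body_involute])

end Plane

/-- `j` is the inclusion of `Π`-symmetric subspaces into all `1|1`-subspaces. It is induced by the
linear inclusion of frames `(z | θ) ↦ [(z | θ), (-θ | z)]`: the coordinates `x, y` pull back to `z`,
the `ξ_k` to `θ_k` and the `η_k` to `-θ_k`. -/
structure IsLinearInclusion (j : piPlane ⟶ superGrassmannian) : Prop where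
  base : ∀ z : PiFrames, j.toHom.hom.base (piProj z) = grProj ⟨(z.1, z.1), z.2, z.2⟩
  pullback : ∀ (V : Opens superGrassmannian.carrier) (s : grSections.sections V) (z : PiFrames)
    (hz : piProj z ∈ (Opens.map j.toHom.hom.base).obj V)
    (hz' : grProj ⟨(z.1, z.1), z.2, z.2⟩ ∈ V),
    Subtype.val (show piSections.sections ((Opens.map j.toHom.hom.base).obj V) from
        j.toHom.hom.c.app (op V) s) ⟨z, hz⟩
      = ExteriorAlgebra.map (LinearMap.fst ℂ C3 C3 - LinearMap.snd ℂ C3 C3)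
          (s.1 ⟨⟨(z.1, z.1), z.2, z.2⟩, hz'⟩)

end SuperGeometry

end

/-!
# `(P², ΠΩ¹, l)` is the `Π`-projective plane, embedded linearly in the super Grassmannian

Read the odd coordinate `θ_k` of a `Π`-symmetric frame as `dz_k`. Let `E` be the Euler field, `ι_E`
the contraction with it and `d` the exterior derivative. A superfunction on the `Π`-projective
plane is then a holomorphic form `s` on the cone that is invariant under scalings and satisfies
`ι_E s = d s` (`oddField_eq`, `pi_contract`). A function on an affine chart of the split plane is a
form on the cone that is invariant under scalings and horizontal, that is killed by `ι_E`.

*The isomorphism.* On the chart `z_i ≠ 0` the form `e_i = dz_i / z_i` has `ι_E e_i = 1`, and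
`s ↦ s - e_i ∧ ι_E s` is an algebra homomorphism onto the horizontal forms (`horizontalPart`). Its
inverse on the forms with `ι_E s = d s` takes a horizontal form `f` to `f + e_i ∧ d f`
(`frameLift`); that this is again a solution follows from `d ∘ d = 0` and from Cartan's formula, by
which `d f` is horizontal (`contract_extDiff_eq_zero`). Two charts give different splittings, with
difference `(e_{i+1} - e_i) ∧ d f`, and this is exactly the cocycle `X_k (∂f/∂X_k) Ω_0 / (X_0 X_1 X_2)`
(`logForm_sub_mul_extDiff`). So the `Π`-projective plane is `(P², ΠΩ¹, 1)`. Multiplication of the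
odd coordinates by `c` multiplies `Ω²`, hence the obstruction class, by `c²` (`rescale_mem`), so
with a square root `c` of `l` it is also `(P², ΠΩ¹, l)` (`comparison`, `isoPiPlane`).

*The embedding.* On reduced spaces `j` is the diagonal of `P²`, which is closed since `P²` is
Hausdorff. On functions it is the substitution `x, y ↦ z`, `ξ ↦ θ`, `η ↦ -θ`. It maps invariant
functions to invariant functions, since the odd generator for `Π`-symmetric frames is the
difference of the two odd generators of `gl(1|1)` (`oddPullback_oddField`). It is local because a
superfunction on the Grassmannian with non-zero degree zero component has a local inverse
(`exists_isUnit_gr`). For surjectivity on stalks, let `f` be a superfunction of `(z | θ)`, and let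
`D` be the odd generator that adds a multiple of the row `(η | y)` to the row `(x | ξ)`. Where
`y_i ≠ 0`, the function `f(x | ξ) - (ξ_i / y_i) D f` is invariant under `GL(1|1)`: it is killed by `D`,
because `D (ξ_i / y_i) = 1` and `D ∘ D = 0`, and by the other odd generator, by Euler's identity
for the function `f`, which is invariant under scalings (`grExtension_mem`). It restricts to `f`,
since `D f` restricts to `ι_E f - d f = 0` (`oddPullback_grExtension`).

Sections are only required to be once complex differentiable at each point. The second derivatives
that `d ∘ d = 0` and `D ∘ D = 0` need come from Cauchy's formula (`differentiableAt_fderiv`).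
-/

noncomputable section
namespace SuperGeometry
open TopologicalSpace Opposite
open scoped Topology

/-! ### Second derivatives of holomorphic functions -/

section Holomorphic

variable {E : Type} [NormedAddCommGroup E] [NormedSpace ℂ E] [FiniteDimensional ℂ E]

/-- Directional derivatives of a holomorphic function of several variables are differentiable.
Cauchy's formula on the complex line through `y` in the direction `e` writes the derivative at `y`
as an integral of values of `g`, which can be differentiated under the integral sign. -/
theorem differentiableAt_fderiv_apply {g : E → ℂ} {x : E}
    (hg : ∀ᶠ y in 𝓝 x, DifferentiableAt ℂ g y) (e : E) :
    DifferentiableAt ℂ (fun y => fderiv ℂ g y e) x := by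
  borelize E
  have hcont : ∀ᶠ y in 𝓝 x, dist (g y) (g x) < 1 :=
    Metric.tendsto_nhds.1 hg.self_of_nhds.continuousAt 1 one_pos
  obtain ⟨R, hR, hball⟩ := Metric.eventually_nhds_iff_ball.1 (hg.and hcont)
  have hd : DifferentiableOn ℂ g (Metric.ball x R) := fun y hy =>
    (hball y hy).1.differentiableWithinAt
  -- The first derivative is bounded on the ball of half the radius, by the Cauchy estimate.
  have hbound : ∀ p ∈ Metric.ball x (R / 2), ‖fderiv ℂ g p‖ ≤ 2 / (R / 2) := by
    intro p hp
    have hsub : Metric.ball p (R / 2) ⊆ Metric.ball x R :=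
      Metric.ball_subset_ball' (by rw [Metric.mem_ball] at hp; linarith)
    refine Complex.norm_fderiv_le_div_of_mapsTo_ball (hd.mono hsub) (fun q hq => ?_) (by positivity)
    have h1 := (hball q (hsub hq)).2
    have h2 := (hball p (hsub (Metric.mem_ball_self (by positivity)))).2
    rw [Metric.mem_closedBall]
    linarith [dist_triangle_right (g q) (g p) (g x)]
  -- The radius is such that `y + w • e`, for `|w| ≤ r`, stays in that ball if `y` is close to `x`.
  set r : ℝ := R / 4 / (‖e‖ + 1) with hr
  have hr0 : 0 < r := by positivity
  have hre : ∀ w : ℂ, ‖w‖ ≤ r → ‖w • e‖ ≤ R / 4 := by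
    intro w hw
    rw [norm_smul]
    calc ‖w‖ * ‖e‖ ≤ r * (‖e‖ + 1) := by gcongr; linarith
      _ = R / 4 := by rw [hr]; field_simp
  have hmem : ∀ y ∈ Metric.ball x (R / 4), ∀ w : ℂ, ‖w‖ ≤ r →
      y + w • e ∈ Metric.ball x (R / 2) := by
    intro y hy w hw
    rw [Metric.mem_ball] at hy ⊢
    calc dist (y + w • e) x ≤ dist (y + w • e) y + dist y x := dist_triangle _ _ _
      _ = ‖w • e‖ + dist y x := by rw [dist_eq_norm, add_sub_cancel_left]
      _ < R / 2 := by linarith [hre w hw]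
  have hsub2 : Metric.ball x (R / 2) ⊆ Metric.ball x R := Metric.ball_subset_ball (by linarith)
  -- The Cauchy kernel of the derivative on the circle of radius `r`.
  let K : ℝ → ℂ := fun θ => deriv (circleMap 0 r) θ * ((circleMap 0 r θ - 0) ^ 2)⁻¹
  have hK : Continuous K := by
    have : Continuous fun θ => ((circleMap 0 r θ - 0) ^ 2)⁻¹ := by
      refine Continuous.inv₀ (by fun_prop) fun θ => ?_
      simp [hr0.ne']
    simp only [K, deriv_circleMap]
    fun_prop
  have hcm : ∀ θ, ‖circleMap 0 r θ‖ ≤ r := fun θ => by simp [abs_of_pos hr0]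
  have hdiff : ∀ θ, ∀ y ∈ Metric.ball x (R / 4),
      HasFDerivAt (fun y => K θ • g (y + circleMap 0 r θ • e))
        (K θ • fderiv ℂ g (y + circleMap 0 r θ • e)) y := by
    intro θ y hy
    have h := (hball _ (hsub2 (hmem y hy _ (hcm θ)))).1.hasFDerivAt
    have h2 : HasFDerivAt (fun y : E => y + circleMap 0 r θ • e) (ContinuousLinearMap.id ℂ E) y :=
      (hasFDerivAt_id y).add_const _
    exact (h.comp y h2).const_smul (K θ)
  have hFcont : ∀ y ∈ Metric.ball x (R / 4),
      Continuous fun θ => K θ • g (y + circleMap 0 r θ • e) := by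
    intro y hy
    refine hK.smul (continuous_iff_continuousAt.2 fun θ => ?_)
    have h := (hball _ (hsub2 (hmem y hy _ (hcm θ)))).1.continuousAt
    exact ContinuousAt.comp' h (by fun_prop)
  have main : HasFDerivAt (fun y => ∫ θ in (0 : ℝ)..2 * Real.pi, K θ • g (y + circleMap 0 r θ • e))
      (∫ θ in (0 : ℝ)..2 * Real.pi, K θ • fderiv ℂ g (x + circleMap 0 r θ • e)) x := by
    have hx4 : Metric.ball x (R / 4) ∈ 𝓝 x := Metric.ball_mem_nhds _ (by positivity)
    refine intervalIntegral.hasFDerivAt_integral_of_dominated_of_fderiv_le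
      (F' := fun y θ => K θ • fderiv ℂ g (y + circleMap 0 r θ • e))
      (bound := fun θ => ‖K θ‖ * (2 / (R / 2))) hx4 ?_ ?_ ?_ ?_ ?_ ?_
    · filter_upwards [hx4] with y hy
      exact (hFcont y hy).aestronglyMeasurable
    · exact (hFcont x (Metric.mem_ball_self (by positivity))).intervalIntegrable _ _
    · have : FiniteDimensional ℂ (E →L[ℂ] ℂ) :=
        LinearEquiv.finiteDimensional (LinearMap.toContinuousLinearMap (𝕜 := ℂ) (E := E) (F' := ℂ))
      have : ProperSpace (E →L[ℂ] ℂ) := FiniteDimensional.proper ℂ _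
      refine hK.aestronglyMeasurable.smul (Measurable.aestronglyMeasurable ?_)
      exact (measurable_fderiv ℂ g).comp
        (by fun_prop : Continuous fun θ => x + circleMap 0 r θ • e).measurable
    · refine Filter.Eventually.of_forall fun θ _ y hy => ?_
      rw [norm_smul]
      gcongr
      exact hbound _ (hmem y hy _ (hcm θ))
    · exact (hK.norm.mul continuous_const).intervalIntegrable _ _
    · exact Filter.Eventually.of_forall fun θ _ y hy => hdiff θ y hy
  -- Cauchy's formula expresses the directional derivative as a circle integral of `g`.
  have hcauchy : ∀ y ∈ Metric.ball x (R / 4), fderiv ℂ g y e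
      = (2 * Real.pi * Complex.I : ℂ)⁻¹ •
        ∫ θ in (0 : ℝ)..2 * Real.pi, K θ • g (y + circleMap 0 r θ • e) := by
    intro y hy
    have hc : Continuous fun w : ℂ => y + w • e := by fun_prop
    have hline : ∀ w : ℂ, HasDerivAt (fun w : ℂ => y + w • e) e w := fun w => by
      simpa using ((hasDerivAt_id w).smul_const e).const_add y
    have h1 : deriv (fun w : ℂ => g (y + w • e)) 0 = fderiv ℂ g y e := by
      have h := (hball y (by simpa using hsub2 (hmem y hy 0 (by simpa using hr0.le)))).1.hasFDerivAt
      have h' : HasFDerivAt g (fderiv ℂ g y) (y + (0 : ℂ) • e) := by simpa using h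
      exact (h'.comp_hasDerivAt (0 : ℂ) (hline 0)).deriv
    have h2 := Complex.cderiv_eq_deriv (E := ℂ) (r := r) (z := 0)
      (f := fun w : ℂ => g (y + w • e)) (Metric.isOpen_ball.preimage hc)
      (fun w hw => ((hball _ hw).1.comp w (hline w).differentiableAt).differentiableWithinAt) hr0
      (fun w hw => hsub2 (hmem y hy w (by simpa using hw)))
    rw [← h1, ← h2, Complex.cderiv, circleIntegral]
    simp only [K, smul_eq_mul, mul_assoc]
  refine DifferentiableAt.congr_of_eventuallyEq
    (main.const_smul ((2 * Real.pi * Complex.I : ℂ)⁻¹)).differentiableAt ?_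
  filter_upwards [Metric.ball_mem_nhds x (by positivity : (0 : ℝ) < R / 4)] with y hy
  exact hcauchy y hy

/-- A holomorphic function of several variables is twice differentiable. -/
theorem differentiableAt_fderiv {g : E → ℂ} {x : E}
    (hg : ∀ᶠ y in 𝓝 x, DifferentiableAt ℂ g y) : DifferentiableAt ℂ (fderiv ℂ g) x := by
  let b := Module.finBasis ℂ E
  have h : fderiv ℂ g = fun y => ∑ i, fderiv ℂ g y (b i) •
      LinearMap.toContinuousLinearMap (b.coord i) := by
    funext y
    ext v
    conv_lhs => rw [← b.sum_repr v, map_sum]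
    simp [mul_comm]
  rw [h]
  exact DifferentiableAt.fun_sum fun i _ => (differentiableAt_fderiv_apply hg (b i)).smul_const _

end Holomorphic

/-! ### Calculus of algebra-valued holomorphic functions -/

section Calculus

variable {E A : Type} [NormedAddCommGroup E] [NormedSpace ℂ E] [FiniteDimensional ℂ E]
  [Ring A] [Algebra ℂ A]

theorem HasSuperDerivAt.unique {f : E → A} {f' g' : E →ₗ[ℂ] A} {x : E}
    (hf : HasSuperDerivAt f f' x) (hg : HasSuperDerivAt f g' x) : f' = g' := by
  ext e
  refine Module.forall_dual_apply_eq_zero_iff ℂ (f' e - g' e) |>.1 (fun ℓ => ?_) |> sub_eq_zero.1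
  have h := DFunLike.congr_fun ((hf ℓ).unique (hg ℓ)) e
  rw [map_sub, sub_eq_zero]
  exact h

theorem HasSuperDerivAt.of_eq {f : E → A} {f' g' : E →ₗ[ℂ] A} {x : E}
    (hf : HasSuperDerivAt f f' x) (h : ∀ e, f' e = g' e) : HasSuperDerivAt f g' x := by
  rwa [← LinearMap.ext h]

theorem HasSuperDerivAt.sum {κ : Type} [Fintype κ] {f : κ → E → A} {f' : κ → E →ₗ[ℂ] A} {x : E}
    (hf : ∀ k, HasSuperDerivAt (f k) (f' k) x) :
    HasSuperDerivAt (fun y => ∑ k, f k y) (∑ k, f' k) x := by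
  intro ℓ
  simp only [map_sum]
  refine (HasFDerivAt.fun_sum fun k _ => hf k ℓ).congr_fderiv ?_
  ext e
  simp

theorem HasSuperDerivAt.smul {c : E → ℂ} {c' : E →L[ℂ] ℂ} {f : E → A} {f' : E →ₗ[ℂ] A} {x : E}
    (hc : HasFDerivAt c c' x) (hf : HasSuperDerivAt f f' x) :
    HasSuperDerivAt (fun y => c y • f y)
      (c x • f' + (c' : E →ₗ[ℂ] ℂ).smulRight (f x)) x := by
  intro ℓ
  simp only [map_smul, smul_eq_mul]
  refine (hc.fun_mul (hf ℓ)).congr_fderiv ?_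
  ext e
  simp
  ring

theorem HasSuperDerivAt.comp_hasFDerivAt {F : Type} [NormedAddCommGroup F] [NormedSpace ℂ F]
    [FiniteDimensional ℂ F] {f : E → A} {f' : E →ₗ[ℂ] A} {m : F → E} {m' : F →L[ℂ] E} {x : F}
    (hf : HasSuperDerivAt f f' (m x)) (hm : HasFDerivAt m m' x) :
    HasSuperDerivAt (fun y => f (m y)) (f' ∘ₗ (m' : F →ₗ[ℂ] E)) x :=
  fun ℓ => ((hf ℓ).comp x hm).congr_fderiv (by ext; simp)

/-- Linear maps into a normed space turn the coordinatewise derivative into a Fréchet derivative. -/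
theorem HasSuperDerivAt.hasFDerivAt_comp [Module.Finite ℂ A] {N : Type} [NormedAddCommGroup N]
    [NormedSpace ℂ N] {f : E → A} {f' : E →ₗ[ℂ] A} {x : E} (hf : HasSuperDerivAt f f' x)
    (L : A →ₗ[ℂ] N) :
    HasFDerivAt (fun y => L (f y)) (LinearMap.toContinuousLinearMap (L ∘ₗ f')) x := by
  let b := Module.finBasis ℂ A
  have key : ∀ a, L a = ∑ i, b.coord i a • L (b i) := fun a => by
    conv_lhs => rw [← b.sum_repr a, map_sum]
    simp
  have h := HasFDerivAt.fun_sum (u := Finset.univ) fun i _ => (hf (b.coord i)).smul_const (L (b i))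
  have hfun : (fun y => L (f y)) = fun y => ∑ i, b.coord i (f y) • L (b i) :=
    funext fun y => key _
  rw [hfun]
  refine h.congr_fderiv ?_
  ext e
  simp [key (f' e)]

/-- The derivative of a differentiable function is differentiable, with symmetric derivative. -/
theorem HasSuperDerivAt.exists_second [Module.Finite ℂ A] {f : E → A} {f' : E → E →ₗ[ℂ] A} {x : E}
    (hf : ∀ᶠ y in 𝓝 x, HasSuperDerivAt f (f' y) y) :
    ∃ f'' : E →ₗ[ℂ] E →ₗ[ℂ] A, (∀ e, HasSuperDerivAt (fun y => f' y e) (f'' e) x) ∧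
      ∀ u v, f'' u v = f'' v u := by
  let b := Module.finBasis ℂ A
  let g := fun i y => b.coord i (f y)
  have hg : ∀ i, ∀ᶠ y in 𝓝 x, HasFDerivAt (g i)
      (LinearMap.toContinuousLinearMap (b.coord i ∘ₗ f' y)) y := fun i =>
    hf.mono fun y hy => hy (b.coord i)
  have hd : ∀ i, DifferentiableAt ℂ (fderiv ℂ (g i)) x := fun i =>
    differentiableAt_fderiv ((hg i).mono fun y hy => hy.differentiableAt)
  have hsymm : ∀ i u v, fderiv ℂ (fderiv ℂ (g i)) x u v = fderiv ℂ (fderiv ℂ (g i)) x v u :=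
    fun i u v => second_derivative_symmetric_of_eventually
      ((hg i).mono fun y hy => hy.differentiableAt.hasFDerivAt) (hd i).hasFDerivAt u v
  have hrep : ∀ᶠ y in 𝓝 x, ∀ e, f' y e = ∑ i, fderiv ℂ (g i) y e • b i := by
    filter_upwards [Filter.eventually_all.2 hg] with y hy e
    rw [← b.sum_repr (f' y e)]
    exact Finset.sum_congr rfl fun i _ => by rw [(hy i).fderiv]; simp
  refine ⟨LinearMap.mk₂ ℂ (fun e v => ∑ i, fderiv ℂ (fderiv ℂ (g i)) x v e • b i) ?_ ?_ ?_ ?_,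
    fun e ℓ => ?_, fun u v => ?_⟩
  · intro u v w; simp [add_smul, Finset.sum_add_distrib]
  · intro c u v; simp [Finset.smul_sum, mul_smul]
  · intro u v w; simp [add_smul, Finset.sum_add_distrib]
  · intro c u v; simp [Finset.smul_sum, mul_smul]
  · have h : HasFDerivAt (fun y => ∑ i, fderiv ℂ (g i) y e * ℓ (b i)) _ x :=
      HasFDerivAt.fun_sum (u := Finset.univ) fun i _ =>
        (((hd i).hasFDerivAt.clm_apply (hasFDerivAt_const e x)).mul_const (ℓ (b i)))
    refine (h.congr_of_eventuallyEq ?_).congr_fderiv ?_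
    · filter_upwards [hrep] with y hy
      rw [hy e, map_sum]
      simp
    · ext v
      simp [mul_comm]
  · simp only [LinearMap.mk₂_apply]
    exact Finset.sum_congr rfl fun i _ => by rw [hsymm]

/-- The pointwise inverse of a differentiable function is differentiable. -/
theorem HasSuperDerivAt.exists_inverse [Module.Finite ℂ A] {f g : E → A} {f' : E →ₗ[ℂ] A} {x : E}
    (hf : HasSuperDerivAt f f' x) (h : ∀ᶠ y in 𝓝 x, f y * g y = 1 ∧ g y * f y = 1) :
    ∃ g' : E →ₗ[ℂ] A, HasSuperDerivAt g g' x := by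
  -- Left multiplication embeds `A` into a complete normed algebra, where inversion is smooth.
  let b := Module.finBasis ℂ A
  let N := Fin (Module.finrank ℂ A) → ℂ
  let Φ : A →ₐ[ℂ] (N →L[ℂ] N) :=
    ((Module.End.toContinuousLinearMap N : (N →ₗ[ℂ] N) ≃ₐ[ℂ] (N →L[ℂ] N)) :
        (N →ₗ[ℂ] N) →ₐ[ℂ] (N →L[ℂ] N)).comp
      ((b.equivFun.conjAlgEquiv ℂ : Module.End ℂ A →ₐ[ℂ] Module.End ℂ N).comp (Algebra.lmul ℂ A))
  have hΦ : ∀ a c : A, b.equivFun.symm (Φ a (b.equivFun c)) = a * c := by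
    intro a c
    change b.equivFun.symm (b.equivFun (a * b.equivFun.symm (b.equivFun c))) = a * c
    simp only [LinearEquiv.symm_apply_apply]
  have hF := hf.hasFDerivAt_comp Φ.toLinearMap
  obtain ⟨h1, h2⟩ := h.self_of_nhds
  let u : (N →L[ℂ] N)ˣ := ⟨Φ (f x), Φ (g x), by rw [← map_mul, h1, map_one],
    by rw [← map_mul, h2, map_one]⟩
  have hinv := (hasFDerivAt_ringInverse (𝕜 := ℂ) u).comp x hF
  have hG : (fun y => Φ (g y)) =ᶠ[𝓝 x] Ring.inverse ∘ fun y => Φ.toLinearMap (f y) := by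
    filter_upwards [h] with y hy
    have hu : Φ (f y) = ((⟨Φ (f y), Φ (g y), by rw [← map_mul, hy.1, map_one],
      by rw [← map_mul, hy.2, map_one]⟩ : (N →L[ℂ] N)ˣ) : N →L[ℂ] N) := rfl
    rw [Function.comp_apply, AlgHom.toLinearMap_apply, hu, Ring.inverse_unit]
    rfl
  obtain ⟨G', hG'⟩ : ∃ G', HasFDerivAt (fun y => Φ (g y)) G' x :=
    ⟨_, hinv.congr_of_eventuallyEq hG⟩
  refine ⟨b.equivFun.symm.toLinearMap ∘ₗ
    ((ContinuousLinearMap.apply ℂ N (b.equivFun 1) : (N →L[ℂ] N) →L[ℂ] N) :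
      (N →L[ℂ] N) →ₗ[ℂ] N) ∘ₗ (G' : E →ₗ[ℂ] (N →L[ℂ] N)), fun ℓ => ?_⟩
  have h3 := ((LinearMap.toContinuousLinearMap
      (ℓ ∘ₗ b.equivFun.symm.toLinearMap)).hasFDerivAt).comp x
    (((ContinuousLinearMap.apply ℂ N (b.equivFun 1)).hasFDerivAt).comp x hG')
  refine (h3.congr_of_eventuallyEq (Filter.Eventually.of_forall fun y => ?_)).congr_fderiv ?_
  · change ℓ (g y) = ℓ (b.equivFun.symm (Φ (g y) (b.equivFun 1)))
    rw [hΦ, mul_one]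
  · ext e
    rfl

end Calculus

/-! ### Exterior algebras -/

section ExteriorAlgebra

variable {V W : Type} [AddCommGroup V] [Module ℂ V] [AddCommGroup W] [Module ℂ W]

/-- `CliffordAlgebra.involute_ι` in the notation of exterior algebras. -/
theorem involute_ι (v : V) :
    CliffordAlgebra.involute (ExteriorAlgebra.ι ℂ v) = -ExteriorAlgebra.ι ℂ v :=
  CliffordAlgebra.involute_ι v

/-- `CliffordAlgebra.contractLeft_ι_mul` in the notation of exterior algebras. -/
theorem contract_ι_mul (d : Module.Dual ℂ V) (v : V) (a : ExteriorAlgebra ℂ V) :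
    CliffordAlgebra.contractLeft d (ExteriorAlgebra.ι ℂ v * a)
      = d v • a - ExteriorAlgebra.ι ℂ v * CliffordAlgebra.contractLeft d a :=
  CliffordAlgebra.contractLeft_ι_mul d v a

theorem contract_map (L : V →ₗ[ℂ] W) (d : Module.Dual ℂ W) (a : ExteriorAlgebra ℂ V) :
    CliffordAlgebra.contractLeft d (ExteriorAlgebra.map L a)
      = ExteriorAlgebra.map L (CliffordAlgebra.contractLeft (d ∘ₗ L) a) := by
  induction a using CliffordAlgebra.left_induction with
  | algebraMap r =>
    rw [CliffordAlgebra.contractLeft_algebraMap, map_zero]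
    exact (congrArg _ (AlgHom.commutes (ExteriorAlgebra.map L) r)).trans
      (CliffordAlgebra.contractLeft_algebraMap _ _ _)
  | add x y hx hy => simp only [map_add, hx, hy]
  | ι_mul x m hx =>
    change CliffordAlgebra.contractLeft d (ExteriorAlgebra.map L (ExteriorAlgebra.ι ℂ m * x)) =
      ExteriorAlgebra.map L (CliffordAlgebra.contractLeft (d ∘ₗ L) (ExteriorAlgebra.ι ℂ m * x))
    rw [map_mul, ExteriorAlgebra.map_apply_ι, contract_ι_mul, contract_ι_mul, hx, map_sub,
      map_smul, map_mul, ExteriorAlgebra.map_apply_ι, LinearMap.comp_apply]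

theorem body_map (L : V →ₗ[ℂ] W) (a : ExteriorAlgebra ℂ V) :
    ExteriorAlgebra.algebraMapInv (ExteriorAlgebra.map L a)
      = ExteriorAlgebra.algebraMapInv a := by
  induction a using ExteriorAlgebra.induction with
  | algebraMap r => simp
  | ι w => simp [ExteriorAlgebra.algebraMapInv]
  | mul x y hx hy => rw [map_mul, map_mul, hx, hy, map_mul]
  | add x y hx hy => rw [map_add, map_add, hx, hy, map_add]

theorem ι_mul_ι_mul_self (v : V) (a : ExteriorAlgebra ℂ V) :
    ExteriorAlgebra.ι ℂ v * (ExteriorAlgebra.ι ℂ v * a) = 0 := by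
  rw [← mul_assoc, ExteriorAlgebra.ι_sq_zero, zero_mul]

theorem ι_mul_ι_mul_swap (v w : V) (a : ExteriorAlgebra ℂ V) :
    ExteriorAlgebra.ι ℂ v * (ExteriorAlgebra.ι ℂ w * a)
      = -(ExteriorAlgebra.ι ℂ w * (ExteriorAlgebra.ι ℂ v * a)) := by
  rw [← mul_assoc, ← mul_assoc, ← neg_mul,
    eq_neg_of_add_eq_zero_left (ExteriorAlgebra.ι_add_mul_swap (R := ℂ) v w)]

theorem mul_ι_mul (v : V) (a b : ExteriorAlgebra ℂ V) :
    a * (ExteriorAlgebra.ι ℂ v * b)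
      = ExteriorAlgebra.ι ℂ v * (CliffordAlgebra.involute a * b) := by
  rw [← mul_assoc, ← mul_assoc, ι_mul_comm, CliffordAlgebra.involute_involute]

/-- An element of a Grassmann algebra with non-zero degree zero component is invertible. The reason
is that its part without degree zero component is nilpotent. The even part of an element is
central, so it suffices that this even part minus the degree zero component is nilpotent. That is
preserved by products, because the product of two odd elements has square zero. -/
theorem isUnit_of_body_ne_zero {a : ExteriorAlgebra ℂ V}
    (ha : ExteriorAlgebra.algebraMapInv a ≠ 0) : IsUnit a := by
  let inv : ExteriorAlgebra ℂ V →ₐ[ℂ] ExteriorAlgebra ℂ V := CliffordAlgebra.involute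
  have hinv : ∀ x, inv (inv x) = x := CliffordAlgebra.involute_involute
  have hev : ∀ x, inv (x + inv x) = x + inv x := fun x => by rw [map_add, hinv, add_comm]
  have hod : ∀ x, inv (x - inv x) = -(x - inv x) := fun x => by rw [map_sub, hinv]; abel
  have hodd_sq : ∀ x, inv x = -x → x * x = 0 := fun x hx => by
    have h := odd_comm hx x
    rw [show CliffordAlgebra.involute x = -x from hx, neg_mul] at h
    have h2 : (2 : ℂ) • (x * x) = 0 := by rw [two_smul]; nth_rewrite 2 [h]; exact add_neg_cancel _
    exact (smul_eq_zero.1 h2).resolve_left two_ne_zero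
  have hnil : ∀ x : ExteriorAlgebra ℂ V, IsNilpotent
      ((x + inv x) - algebraMap ℂ _ (2 * ExteriorAlgebra.algebraMapInv x)) := by
    intro x
    induction x using ExteriorAlgebra.induction with
    | algebraMap r =>
      rw [AlgHom.commutes, ExteriorAlgebra.algebraMap_leftInverse V r, two_mul, map_add, sub_self]
      exact IsNilpotent.zero
    | ι w =>
      have h1 : inv (ExteriorAlgebra.ι ℂ w) = -ExteriorAlgebra.ι ℂ w := involute_ι w
      have h2 : ExteriorAlgebra.algebraMapInv (ExteriorAlgebra.ι ℂ w) = (0 : ℂ) := by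
        simp [ExteriorAlgebra.algebraMapInv]
      rw [h1, h2]
      simp
    | add x y hx hy =>
      have hcomm : ∀ z, Commute ((x + inv x) -
          algebraMap ℂ _ (2 * ExteriorAlgebra.algebraMapInv x)) z := fun z =>
        even_comm (show inv _ = _ by rw [map_sub, hev, AlgHom.commutes]) z
      convert (hcomm _).isNilpotent_add hx hy using 1
      simp only [map_add, mul_add]
      abel
    | mul x y hx hy =>
      set p := (x + inv x) - algebraMap ℂ _ (2 * ExteriorAlgebra.algebraMapInv x) with hp
      set q := (y + inv y) - algebraMap ℂ _ (2 * ExteriorAlgebra.algebraMapInv y) with hq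
      set m := x - inv x with hm
      set n := y - inv y with hn
      have cp : ∀ z, Commute p z := fun z =>
        even_comm (show inv _ = _ by rw [hp, map_sub, hev, AlgHom.commutes]) z
      have cq : ∀ z, Commute q z := fun z =>
        even_comm (show inv _ = _ by rw [hq, map_sub, hev, AlgHom.commutes]) z
      have hmn : inv (m * n) = m * n := by rw [map_mul, hod, hod, neg_mul_neg]
      have cmn : ∀ z, Commute (m * n) z := fun z => even_comm hmn z
      have hnm : IsNilpotent (m * n) := by
        refine ⟨2, ?_⟩
        rw [pow_two, ← mul_assoc, (cmn m).eq, ← mul_assoc, hodd_sq m (hod x), zero_mul, zero_mul]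
      set α := ExteriorAlgebra.algebraMapInv x
      set β := ExteriorAlgebra.algebraMapInv y
      have e : (x * y + inv (x * y)) - algebraMap ℂ (ExteriorAlgebra ℂ V)
            (2 * ExteriorAlgebra.algebraMapInv (x * y))
          = algebraMap ℂ _ (1 / 2 : ℂ) * (p * q) + (algebraMap ℂ _ β * p + (algebraMap ℂ _ α * q
            + algebraMap ℂ _ (1 / 2 : ℂ) * (m * n))) := by
        have hm' : ExteriorAlgebra.algebraMapInv (x * y) = α * β := map_mul _ _ _
        rw [hm', map_mul inv, hp, hq, hm, hn]
        simp only [Algebra.algebraMap_eq_smul_one, mul_sub, sub_mul, mul_add,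
          add_mul, smul_mul_assoc, mul_smul_comm, one_mul, mul_one]
        module
      rw [e]
      have ca : ∀ (r : ℂ) (z : ExteriorAlgebra ℂ V), Commute (algebraMap ℂ _ r) z :=
        fun r z => Algebra.commutes r z
      have h1 : IsNilpotent (algebraMap ℂ (ExteriorAlgebra ℂ V) (1 / 2 : ℂ) * (m * n)) :=
        (ca _ _).isNilpotent_mul_left hnm
      have h2 : IsNilpotent (algebraMap ℂ (ExteriorAlgebra ℂ V) α * q) :=
        (ca _ _).isNilpotent_mul_left hy
      have h3 : IsNilpotent (algebraMap ℂ (ExteriorAlgebra ℂ V) β * p) :=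
        (ca _ _).isNilpotent_mul_left hx
      have h4 : IsNilpotent (algebraMap ℂ (ExteriorAlgebra ℂ V) (1 / 2 : ℂ) * (p * q)) :=
        (ca _ _).isNilpotent_mul_left ((cp q).isNilpotent_mul_right hx)
      refine Commute.isNilpotent_add ?_ h4 (Commute.isNilpotent_add ?_ h3
        (Commute.isNilpotent_add ?_ h2 h1))
      · exact (ca _ _).mul_left ((cp _).mul_left (cq _))
      · exact (ca _ _).mul_left (cp _)
      · exact (ca _ _).mul_left (cq _)
  -- The even part is a non-zero scalar plus a nilpotent element, and the odd part has square zero.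
  have hu : IsUnit (a + inv a) := by
    have h := hnil a
    have hr : IsUnit (algebraMap ℂ (ExteriorAlgebra ℂ V) (2 * ExteriorAlgebra.algebraMapInv a)) :=
      (IsUnit.mk0 _ (mul_ne_zero two_ne_zero ha)).map _
    have := h.isUnit_add_left_of_commute hr (Algebra.commutes _ _).symm
    rwa [add_sub_cancel] at this
  have ce : ∀ z, Commute (a + inv a) z := fun z => even_comm (hev a) z
  have hsq : (a - inv a) * (a - inv a) = 0 := hodd_sq _ (hod a)
  have h2 : IsUnit ((a + inv a) + (a - inv a)) :=
    IsNilpotent.isUnit_add_left_of_commute ⟨2, by rw [pow_two, hsq]⟩ hu (ce _).symm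
  have h3 : (a + inv a) + (a - inv a) = algebraMap ℂ _ (2 : ℂ) * a := by
    rw [← Algebra.smul_def]; module
  rw [h3] at h2
  have h4 : IsUnit (algebraMap ℂ (ExteriorAlgebra ℂ V) (1 / 2 : ℂ)) :=
    (IsUnit.mk0 _ (by norm_num)).map _
  have h5 := h4.mul h2
  rwa [← mul_assoc, ← map_mul, show (1 / 2 : ℂ) * 2 = 1 by norm_num, map_one, one_mul] at h5

end ExteriorAlgebra

/-! ### Differential forms on `ℂ³` -/

section Forms

theorem dualOf_apply (v w : C3) : dualOf v w = ∑ k, v k * w k := by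
  simp [dualOf]

theorem dualOf_stdBasis (v : C3) (k : Fin 3) : dualOf v (stdBasis k) = v k := by
  simp [dualOf_apply, stdBasis, Pi.single_apply]

theorem dualOf_smul (c : ℂ) (v : C3) : dualOf (c • v) = c • dualOf v := by
  simp [dualOf, Finset.smul_sum, mul_smul]

theorem dualOf_add (v w : C3) : dualOf (v + w) = dualOf v + dualOf w := by
  simp [dualOf, add_smul, Finset.sum_add_distrib]

theorem eq_sum_stdBasis (v : C3) : v = ∑ k, v k • stdBasis k := by
  ext j; simp [stdBasis, Finset.sum_apply, Pi.single_apply]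

theorem contract_add_left (v w : C3) (a : ExteriorAlgebra ℂ C3) :
    CliffordAlgebra.contractLeft (dualOf (v + w)) a
      = CliffordAlgebra.contractLeft (dualOf v) a + CliffordAlgebra.contractLeft (dualOf w) a := by
  rw [dualOf_add, map_add, LinearMap.add_apply]

theorem contract_smul_left (c : ℂ) (v : C3) (a : ExteriorAlgebra ℂ C3) :
    CliffordAlgebra.contractLeft (dualOf (c • v)) a
      = c • CliffordAlgebra.contractLeft (dualOf v) a := by
  rw [dualOf_smul, map_smul, LinearMap.smul_apply]

theorem contract_eq_sum (v : C3) (a : ExteriorAlgebra ℂ C3) :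
    CliffordAlgebra.contractLeft (dualOf v) a
      = ∑ k, v k • CliffordAlgebra.contractLeft (dualOf (stdBasis k)) a := by
  conv_lhs => rw [eq_sum_stdBasis v]
  simp only [Fin.sum_univ_three, contract_add_left, contract_smul_left]

theorem HasSuperDerivAt.contract {f : C3 → ExteriorAlgebra ℂ C3}
    {f' : C3 →ₗ[ℂ] ExteriorAlgebra ℂ C3} {z : C3} (hf : HasSuperDerivAt f f' z) :
    ∃ g' : C3 →ₗ[ℂ] ExteriorAlgebra ℂ C3,
      HasSuperDerivAt (fun y => CliffordAlgebra.contractLeft (dualOf y) (f y)) g' z ∧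
      ∀ v, g' v = CliffordAlgebra.contractLeft (dualOf v) (f z)
        + CliffordAlgebra.contractLeft (dualOf z) (f' v) := by
  have h := HasSuperDerivAt.sum fun k : Fin 3 =>
    HasSuperDerivAt.smul (hasFDerivAt_apply (𝕜 := ℂ) k z)
      (hf.comp_linear (CliffordAlgebra.contractLeft (dualOf (stdBasis k))))
  refine ⟨_, h.congr (Filter.Eventually.of_forall fun y => contract_eq_sum y (f y)), fun v => ?_⟩
  rw [contract_eq_sum v, contract_eq_sum z]
  simp [Finset.sum_add_distrib, add_comm]

/-- The exterior derivative at a point of a form with derivative `F` in the coordinate directions,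
the odd coordinate `θ_k` being read as `dz_k`. -/
def extDiff (F : C3 →ₗ[ℂ] ExteriorAlgebra ℂ C3) : ExteriorAlgebra ℂ C3 :=
  ∑ k, ExteriorAlgebra.ι ℂ (stdBasis k) * F (stdBasis k)

theorem extDiff_sub (F G : C3 →ₗ[ℂ] ExteriorAlgebra ℂ C3) :
    extDiff (F - G) = extDiff F - extDiff G := by
  simp [extDiff, mul_sub]

/-- The odd generator of the changes of `Π`-symmetric frames is the contraction with the Euler field
minus the exterior derivative. -/
theorem oddField_eq (z : C3) (a : ExteriorAlgebra ℂ C3) (F : C3 →ₗ[ℂ] ExteriorAlgebra ℂ C3) :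
    oddField (dualOf z) (fun k => -stdBasis k) stdBasis a F
      = CliffordAlgebra.contractLeft (dualOf z) a - extDiff F := by
  simp [oddField, extDiff, sub_eq_add_neg]

/-- Cartan's formula: the derivative along the Euler field is what remains of the contraction of the
exterior derivative after the odd coordinates have been moved past the contraction. -/
theorem contract_extDiff (z : C3) (F : C3 →ₗ[ℂ] ExteriorAlgebra ℂ C3) :
    CliffordAlgebra.contractLeft (dualOf z) (extDiff F) = F z
      - ∑ k, ExteriorAlgebra.ι ℂ (stdBasis k)
        * CliffordAlgebra.contractLeft (dualOf z) (F (stdBasis k)) := by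
  conv_rhs => rw [eq_sum_stdBasis z]
  simp only [extDiff, map_sum, contract_ι_mul, dualOf_stdBasis, Finset.sum_sub_distrib, map_smul]
  rw [← eq_sum_stdBasis]

/-- The derivation that multiplies a form of degree `k` by `k`. -/
def degreeOp (a : ExteriorAlgebra ℂ C3) : ExteriorAlgebra ℂ C3 :=
  ∑ k, ExteriorAlgebra.ι ℂ (stdBasis k) * CliffordAlgebra.contractLeft (dualOf (stdBasis k)) a

theorem degreeOp_mul (a b : ExteriorAlgebra ℂ C3) :
    degreeOp (a * b) = degreeOp a * b + a * degreeOp b := by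
  simp only [degreeOp, contract_mul, mul_add, Finset.sum_add_distrib, Finset.sum_mul,
    Finset.mul_sum, mul_ι_mul, mul_assoc]

theorem degreeOp_ι (v : C3) : degreeOp (ExteriorAlgebra.ι ℂ v) = ExteriorAlgebra.ι ℂ v := by
  have h : ∀ d : Module.Dual ℂ C3, CliffordAlgebra.contractLeft d (ExteriorAlgebra.ι ℂ v)
      = algebraMap ℂ (ExteriorAlgebra ℂ C3) (d v) := fun d => CliffordAlgebra.contractLeft_ι _ d v
  conv_rhs => rw [eq_sum_stdBasis v, map_sum]
  refine Finset.sum_congr rfl fun k _ => ?_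
  have hk : dualOf (stdBasis k) v = v k := by simp [dualOf_apply, stdBasis, Pi.single_apply]
  rw [h, hk, ← Algebra.commutes, ← Algebra.smul_def, map_smul]

/-- The degree operator generates the scalings of the odd coordinates. -/
theorem hasSuperDerivAt_map_scal_inv (a : ExteriorAlgebra ℂ C3) :
    HasSuperDerivAt (fun c : ℂ => ExteriorAlgebra.map (scal c⁻¹) a)
      (LinearMap.toSpanSingleton ℂ _ (-degreeOp a)) 1 := by
  induction a using ExteriorAlgebra.induction with
  | algebraMap r =>
    simp only [AlgHom.commutes]
    refine (HasSuperDerivAt.const _ 1).of_eq fun e => ?_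
    simp [degreeOp, CliffordAlgebra.contractLeft_algebraMap]
  | ι w =>
    have h := HasSuperDerivAt.smul (hasDerivAt_inv (one_ne_zero (α := ℂ))).hasFDerivAt
      (HasSuperDerivAt.const (ExteriorAlgebra.ι ℂ w) (1 : ℂ))
    simp only [ExteriorAlgebra.map_apply_ι, LinearMap.smul_apply, LinearMap.id_apply, map_smul]
    refine h.of_eq fun e => ?_
    simp [degreeOp_ι]
  | mul x y hx hy =>
    simp only [map_mul]
    refine (hx.mul hy).of_eq fun e => ?_
    simp [degreeOp_mul]
    abel
  | add x y hx hy =>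
    simp only [map_add]
    refine (hx.add hy).of_eq fun e => ?_
    simp [degreeOp, mul_add, Finset.sum_add_distrib]
    abel

/-- Euler's identity for forms: a form that is invariant under the scalings of the cone is
annihilated by the Lie derivative along the Euler field. -/
theorem euler_identity {f : C3 → ExteriorAlgebra ℂ C3}
    {f' : C3 →ₗ[ℂ] ExteriorAlgebra ℂ C3} {z : C3}
    (hf : HasSuperDerivAt f f' z)
    (hs : ∀ᶠ c in 𝓝 (1 : ℂ), ExteriorAlgebra.map (scal c) (f (c • z)) = f z) :
    f' z + degreeOp (f z) = 0 := by
  have h1 : HasSuperDerivAt (fun c : ℂ => f (c • z)) _ 1 :=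
    HasSuperDerivAt.comp_hasFDerivAt (m := fun c : ℂ => c • z) (by rwa [one_smul])
      ((hasFDerivAt_id (1 : ℂ)).smul_const z)
  have h2 : (fun c : ℂ => f (c • z)) =ᶠ[𝓝 1] fun c => ExteriorAlgebra.map (scal c⁻¹) (f z) := by
    filter_upwards [hs, isOpen_ne.mem_nhds (one_ne_zero (α := ℂ))] with c hc hc0
    rw [← hc, ← AlgHom.comp_apply, ExteriorAlgebra.map_comp_map]
    have : scal c⁻¹ ∘ₗ scal c = LinearMap.id := by
      ext; simp [hc0]
    rw [this, ExteriorAlgebra.map_id, AlgHom.id_apply]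
  have h3 := DFunLike.congr_fun (h1.unique ((hasSuperDerivAt_map_scal_inv (f z)).congr h2)) 1
  simp at h3
  rw [h3, neg_add_cancel]

/-- Cartan's formula: the exterior derivative of a horizontal form that is invariant under scalings
is horizontal. -/
theorem contract_extDiff_eq_zero {f : C3 → ExteriorAlgebra ℂ C3}
    {f' : C3 →ₗ[ℂ] ExteriorAlgebra ℂ C3} {z : C3} (hf : HasSuperDerivAt f f' z)
    (hs : ∀ᶠ c in 𝓝 (1 : ℂ), ExteriorAlgebra.map (scal c) (f (c • z)) = f z)
    (hh : ∀ᶠ y in 𝓝 z, CliffordAlgebra.contractLeft (dualOf y) (f y) = 0) :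
    CliffordAlgebra.contractLeft (dualOf z) (extDiff f') = 0 := by
  obtain ⟨g', hg, hg'⟩ := hf.contract
  have h0 := hg.unique ((HasSuperDerivAt.const 0 z).congr hh)
  have h1 : ∀ v, CliffordAlgebra.contractLeft (dualOf z) (f' v)
      = -CliffordAlgebra.contractLeft (dualOf v) (f z) := fun v => by
    rw [eq_neg_iff_add_eq_zero, add_comm, ← hg', h0, LinearMap.zero_apply]
  rw [contract_extDiff, ← euler_identity hf hs, degreeOp]
  simp only [h1, mul_neg, Finset.sum_neg_distrib, sub_neg_eq_add]

/-- `dz_i / z_i`. Contraction with the Euler field takes it to `1`. -/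
def logForm (i : Fin 3) (z : C3) : ExteriorAlgebra ℂ C3 :=
  (z i)⁻¹ • ExteriorAlgebra.ι ℂ (stdBasis i)

theorem contract_logForm_mul {i : Fin 3} {z : C3} (hz : z i ≠ 0) (a : ExteriorAlgebra ℂ C3) :
    CliffordAlgebra.contractLeft (dualOf z) (logForm i z * a)
      = a - logForm i z * CliffordAlgebra.contractLeft (dualOf z) a := by
  simp only [logForm, smul_mul_assoc, map_smul, contract_ι_mul, dualOf_stdBasis, smul_sub,
    inv_smul_smul₀ hz]

theorem logForm_mul_self (i : Fin 3) (y z : C3) (a : ExteriorAlgebra ℂ C3) :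
    logForm i y * (logForm i z * a) = 0 := by
  simp [logForm, ι_mul_ι_mul_self]

theorem mul_logForm_mul (i : Fin 3) (z : C3) (a b : ExteriorAlgebra ℂ C3) :
    a * (logForm i z * b) = logForm i z * (CliffordAlgebra.involute a * b) := by
  simp only [logForm, smul_mul_assoc, mul_smul_comm, mul_ι_mul]

theorem involute_logForm (i : Fin 3) (z : C3) :
    CliffordAlgebra.involute (logForm i z) = -logForm i z := by
  rw [logForm, map_smul, involute_ι, smul_neg]

theorem body_logForm_mul (i : Fin 3) (z : C3) (a : ExteriorAlgebra ℂ C3) :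
    body (logForm i z * a) = 0 := by
  rw [map_mul, logForm, map_smul, body_ι, smul_zero, zero_mul]

theorem map_scal_logForm (c : ℂ) (hc : c ≠ 0) (i : Fin 3) (z : C3) :
    ExteriorAlgebra.map (scal c) (logForm i (c • z)) = logForm i z := by
  simp only [logForm, map_smul, ExteriorAlgebra.map_apply_ι, LinearMap.smul_apply,
    LinearMap.id_apply, Pi.smul_apply, smul_eq_mul, smul_smul]
  rw [mul_inv, mul_comm c⁻¹, mul_assoc, inv_mul_cancel₀ hc, mul_one]

theorem map_scal_contract (c : ℂ) (z : C3) (a : ExteriorAlgebra ℂ C3) :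
    ExteriorAlgebra.map (scal c) (CliffordAlgebra.contractLeft (dualOf (c • z)) a)
      = CliffordAlgebra.contractLeft (dualOf z) (ExteriorAlgebra.map (scal c) a) := by
  rw [contract_map, dualOf_smul]
  congr 3
  ext; simp

theorem ι_mul_volForm_eq (i : Fin 3) : ExteriorAlgebra.ι ℂ (stdBasis i)
    * (ExteriorAlgebra.ι ℂ (stdBasis (i + 1)) * ExteriorAlgebra.ι ℂ (stdBasis (i + 2)))
      = volForm := by
  have h3 : volForm = ExteriorAlgebra.ι ℂ (stdBasis 0)
      * (ExteriorAlgebra.ι ℂ (stdBasis 1) * ExteriorAlgebra.ι ℂ (stdBasis 2)) := by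
    rw [volForm, ExteriorAlgebra.ιMulti_apply]
    simp [List.ofFn_succ]
  have hs : ∀ v w : C3, ExteriorAlgebra.ι ℂ v * ExteriorAlgebra.ι ℂ w
      = -(ExteriorAlgebra.ι ℂ w * ExteriorAlgebra.ι ℂ v) := fun v w =>
    eq_neg_of_add_eq_zero_left (ExteriorAlgebra.ι_add_mul_swap (R := ℂ) v w)
  fin_cases i
  · exact h3.symm
  · change ExteriorAlgebra.ι ℂ (stdBasis 1)
      * (ExteriorAlgebra.ι ℂ (stdBasis 2) * ExteriorAlgebra.ι ℂ (stdBasis 0)) = _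
    rw [h3, hs (stdBasis 2), mul_neg, ι_mul_ι_mul_swap, neg_neg]
  · change ExteriorAlgebra.ι ℂ (stdBasis 2)
      * (ExteriorAlgebra.ι ℂ (stdBasis 0) * ExteriorAlgebra.ι ℂ (stdBasis 1)) = _
    rw [h3, ι_mul_ι_mul_swap, hs (stdBasis 2), mul_neg, neg_neg]

theorem volForm_mul (a : ExteriorAlgebra ℂ C3) : volForm * a = body a • volForm := by
  rw [odd_comm involute_volForm, mul_volForm, body_involute]

/-- The horizontal exact form `extDiff F` measures the difference of two logarithmic forms: this is
the Čech cocycle of the obstruction class. -/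
theorem logForm_sub_mul_extDiff {i : Fin 3} {z : C3} (hi : z i ≠ 0) (hj : z (i + 1) ≠ 0)
    (F : C3 →ₗ[ℂ] ExteriorAlgebra ℂ C3)
    (hF : CliffordAlgebra.contractLeft (dualOf z) (extDiff F) = 0) :
    (logForm (i + 1) z - logForm i z) * extDiff F
      = (body (F (stdBasis (i + 2))) / (z i * z (i + 1))) • eulerForm z := by
  have h1 : logForm i z * (logForm (i + 1) z * extDiff F)
      = (body (F (stdBasis (i + 2))) / (z i * z (i + 1))) • volForm := by
    have hsum : extDiff F = ExteriorAlgebra.ι ℂ (stdBasis i) * F (stdBasis i)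
        + ExteriorAlgebra.ι ℂ (stdBasis (i + 1)) * F (stdBasis (i + 1))
        + ExteriorAlgebra.ι ℂ (stdBasis (i + 2)) * F (stdBasis (i + 2)) := by
      rw [extDiff, Fin.sum_univ_three]
      fin_cases i
      · rfl
      · exact (add_assoc _ _ _).trans (add_comm _ _)
      · exact (add_comm _ _).trans (add_assoc _ _ _).symm
    have h0 : ExteriorAlgebra.ι ℂ (stdBasis i) * (ExteriorAlgebra.ι ℂ (stdBasis (i + 1))
        * (ExteriorAlgebra.ι ℂ (stdBasis i) * F (stdBasis i))) = 0 := by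
      rw [ι_mul_ι_mul_swap, ι_mul_ι_mul_self, mul_zero, neg_zero]
    rw [hsum]
    simp only [logForm, smul_mul_assoc, mul_smul_comm, mul_add, ι_mul_ι_mul_self, mul_zero, h0,
      smul_zero, zero_add]
    rw [← mul_assoc (ExteriorAlgebra.ι ℂ (stdBasis (i + 1))), ← mul_assoc, ι_mul_volForm_eq,
      volForm_mul, smul_smul, smul_smul]
    congr 1
    field_simp
  have h2 := congrArg (CliffordAlgebra.contractLeft (dualOf z)) h1
  rw [contract_logForm_mul hi, contract_logForm_mul hj, hF, mul_zero, sub_zero, map_smul] at h2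
  rw [sub_mul, h2, eulerForm]

theorem ι_mul_ι_mul_eulerForm (v w z : C3) :
    ExteriorAlgebra.ι ℂ v * (ExteriorAlgebra.ι ℂ w * eulerForm z) = 0 := by
  have h := contract_ι_mul (dualOf z) w volForm
  rw [ι_mul_volForm, map_zero] at h
  have h' : ExteriorAlgebra.ι ℂ w * eulerForm z = dualOf z w • volForm :=
    (sub_eq_zero.1 h.symm).symm
  rw [h', mul_smul_comm, ι_mul_volForm, smul_zero]

theorem map_scal_eulerForm (c : ℂ) (z : C3) :
    ExteriorAlgebra.map (scal c) (eulerForm z) = c ^ 2 • eulerForm z := by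
  rcases eq_or_ne c 0 with rfl | hc
  · rw [eulerForm, ← ι_mul_volForm_eq 0, contract_ι_mul, contract_ι_mul]
    simp [scal]
  · have hv : ExteriorAlgebra.map (scal c) volForm = c ^ 3 • volForm := by
      rw [← ι_mul_volForm_eq 0]
      simp only [map_mul, ExteriorAlgebra.map_apply_ι, LinearMap.smul_apply, LinearMap.id_apply,
        map_smul, smul_mul_assoc, mul_smul_comm, smul_smul]
      congr 1
      ring
    have h := map_scal_contract c z volForm
    rw [contract_smul_left, map_smul, hv, map_smul] at h
    have h2 := congrArg (fun a => c⁻¹ • a) h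
    simp only [inv_smul_smul₀ hc, smul_smul] at h2
    rw [eulerForm, h2]
    congr 1
    field_simp

end Forms

/-! ### Horizontal forms -/

section Horizontal

/-- The projection of forms onto horizontal forms along multiples of `dz_i / z_i`, that is the
substitution `dz_k ↦ dz_k - z_k dz_i / z_i`. -/
def horizontalPart (i : Fin 3) (z : C3) : ExteriorAlgebra ℂ C3 →ₗ[ℂ] ExteriorAlgebra ℂ C3 :=
  LinearMap.id - LinearMap.mulLeft ℂ (logForm i z) ∘ₗ CliffordAlgebra.contractLeft (dualOf z)

theorem horizontalPart_apply (i : Fin 3) (z : C3) (a : ExteriorAlgebra ℂ C3) :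
    horizontalPart i z a = a - logForm i z * CliffordAlgebra.contractLeft (dualOf z) a := rfl

theorem horizontalPart_algebraMap (i : Fin 3) (z : C3) (r : ℂ) :
    horizontalPart i z (algebraMap ℂ _ r) = algebraMap ℂ _ r := by
  have h : CliffordAlgebra.contractLeft (dualOf z) (algebraMap ℂ (ExteriorAlgebra ℂ C3) r) = 0 :=
    CliffordAlgebra.contractLeft_algebraMap _ _ _
  rw [horizontalPart_apply, h, mul_zero, sub_zero]

theorem horizontalPart_mul (i : Fin 3) (z : C3) (a b : ExteriorAlgebra ℂ C3) :
    horizontalPart i z (a * b) = horizontalPart i z a * horizontalPart i z b := by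
  have h0 : ∀ x, logForm i z * (CliffordAlgebra.involute (logForm i z) * x) = 0 := fun x => by
    rw [involute_logForm, neg_mul, mul_neg, logForm_mul_self, neg_zero]
  simp only [horizontalPart_apply, contract_mul, sub_mul, mul_sub, mul_add, mul_logForm_mul,
    mul_assoc, h0, sub_zero]
  abel

theorem horizontalPart_involute (i : Fin 3) (z : C3) (a : ExteriorAlgebra ℂ C3) :
    horizontalPart i z (CliffordAlgebra.involute a)
      = CliffordAlgebra.involute (horizontalPart i z a) := by
  simp only [horizontalPart_apply, contract_involute, map_sub, map_mul, involute_logForm, mul_neg,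
    neg_mul]

theorem contract_horizontalPart {i : Fin 3} {z : C3} (hz : z i ≠ 0) (a : ExteriorAlgebra ℂ C3) :
    CliffordAlgebra.contractLeft (dualOf z) (horizontalPart i z a) = 0 := by
  rw [horizontalPart_apply, map_sub, contract_logForm_mul hz,
    CliffordAlgebra.contractLeft_contractLeft, mul_zero, sub_zero, sub_self]

theorem map_scal_horizontalPart (c : ℂ) (hc : c ≠ 0) (i : Fin 3) (z : C3)
    (a : ExteriorAlgebra ℂ C3) :
    ExteriorAlgebra.map (scal c) (horizontalPart i (c • z) a)
      = horizontalPart i z (ExteriorAlgebra.map (scal c) a) := by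
  rw [horizontalPart_apply, horizontalPart_apply, map_sub, map_mul, map_scal_logForm c hc,
    map_scal_contract]

theorem hasFDerivAt_inv_coord {i : Fin 3} {z : C3} (hz : z i ≠ 0) :
    HasFDerivAt (fun y : C3 => (y i)⁻¹)
      (-(z i ^ 2)⁻¹ • (ContinuousLinearMap.proj i : C3 →L[ℂ] ℂ)) z :=
  (hasDerivAt_inv hz).comp_hasFDerivAt z (hasFDerivAt_apply i z)

theorem HasSuperDerivAt.logForm_mul {i : Fin 3} {z : C3} (hz : z i ≠ 0)
    {g : C3 → ExteriorAlgebra ℂ C3} {g' : C3 →ₗ[ℂ] ExteriorAlgebra ℂ C3}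
    (hg : HasSuperDerivAt g g' z) :
    ∃ h' : C3 →ₗ[ℂ] ExteriorAlgebra ℂ C3, HasSuperDerivAt (fun y => logForm i y * g y) h' z ∧
      ∀ v, h' v = logForm i z * g' v
        - ((z i ^ 2)⁻¹ * v i) • (ExteriorAlgebra.ι ℂ (stdBasis i) * g z) := by
  have h := HasSuperDerivAt.smul (hasFDerivAt_inv_coord hz)
    (hg.comp_linear (LinearMap.mulLeft ℂ (ExteriorAlgebra.ι ℂ (stdBasis i))))
  refine ⟨_, h.congr (Filter.Eventually.of_forall fun y => ?_), fun v => ?_⟩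
  · simp [logForm]
  · simp [logForm, sub_eq_add_neg]

theorem HasSuperDerivAt.horizontalPart {i : Fin 3} {z : C3} (hz : z i ≠ 0)
    {f : C3 → ExteriorAlgebra ℂ C3} {f' : C3 →ₗ[ℂ] ExteriorAlgebra ℂ C3}
    (hf : HasSuperDerivAt f f' z) :
    ∃ g' : C3 →ₗ[ℂ] ExteriorAlgebra ℂ C3,
      HasSuperDerivAt (fun y => SuperGeometry.horizontalPart i y (f y)) g' z ∧
      ∀ v, g' v = f' v - (logForm i z * (CliffordAlgebra.contractLeft (dualOf v) (f z)
          + CliffordAlgebra.contractLeft (dualOf z) (f' v)) - ((z i ^ 2)⁻¹ * v i) •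
            (ExteriorAlgebra.ι ℂ (stdBasis i)
              * CliffordAlgebra.contractLeft (dualOf z) (f z))) := by
  obtain ⟨c', hc, hc'⟩ := hf.contract
  obtain ⟨h', hh, hh'⟩ := hc.logForm_mul hz
  refine ⟨f' + (-1 : ℂ) • h', ?_, fun v => ?_⟩
  · have h := hf.add (hh.comp_linear ((-1 : ℂ) • LinearMap.id))
    refine (h.congr (Filter.Eventually.of_forall fun y => ?_)).of_eq fun v => ?_
    · simp [horizontalPart_apply, sub_eq_add_neg]
    · simp
  · simp only [LinearMap.add_apply, LinearMap.smul_apply, hh', hc']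
    rw [neg_one_smul, ← sub_eq_add_neg]

/-- The identity behind `d ∘ d = 0`: symmetric coefficients cancel against anticommuting
generators. -/
theorem sum_ι_mul_ι_mul_symm {V κ : Type} [AddCommGroup V] [Module ℂ V] [Fintype κ] (w : κ → V)
    {a : κ → κ → ExteriorAlgebra ℂ V} (ha : ∀ k m, a k m = a m k) :
    ∑ m, ∑ k, ExteriorAlgebra.ι ℂ (w m) * (ExteriorAlgebra.ι ℂ (w k) * a k m) = 0 := by
  set S := ∑ m, ∑ k, ExteriorAlgebra.ι ℂ (w m) * (ExteriorAlgebra.ι ℂ (w k) * a k m) with hS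
  have h : S = -S := by
    conv_lhs => rw [hS, Finset.sum_comm]
    rw [hS, ← Finset.sum_neg_distrib]
    refine Finset.sum_congr rfl fun m _ => ?_
    rw [← Finset.sum_neg_distrib]
    refine Finset.sum_congr rfl fun k _ => ?_
    rw [ι_mul_ι_mul_swap, ha]
  have h2 : (2 : ℂ) • S = 0 := by
    rw [two_smul]; nth_rewrite 2 [h]; exact add_neg_cancel _
  exact (smul_eq_zero.1 h2).resolve_left two_ne_zero

/-- A partial derivative of a form that is invariant under scalings has degree `-1`. -/
theorem map_scal_deriv {f : C3 → ExteriorAlgebra ℂ C3} {F G : C3 →ₗ[ℂ] ExteriorAlgebra ℂ C3}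
    {z : C3} {c : ℂ} (hc : c ≠ 0) (hF : HasSuperDerivAt f F z) (hG : HasSuperDerivAt f G (c • z))
    (h : ∀ᶠ y in 𝓝 z, ExteriorAlgebra.map (scal c) (f (c • y)) = f y) (v : C3) :
    ExteriorAlgebra.map (scal c) (G v) = c⁻¹ • F v := by
  have h1 := (HasSuperDerivAt.comp_hasFDerivAt (m := fun y : C3 => c • y) (x := z) hG
    ((hasFDerivAt_id z).const_smul c)).comp_linear (ExteriorAlgebra.map (scal c)).toLinearMap
  have h2 := hF.unique (h1.congr (h.mono fun y hy => hy.symm))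
  rw [h2]
  simp [smul_smul, hc]

/-- The derivative of `1 / z_i` does not contribute to the exterior derivative of `(dz_i / z_i) ∧ g`,
since `dz_i ∧ dz_i = 0`. -/
theorem sum_ι_mul_coord_smul (i : Fin 3) (r : ℂ) (a : ExteriorAlgebra ℂ C3) :
    ∑ k, ExteriorAlgebra.ι ℂ (stdBasis k)
      * ((r * stdBasis k i) • (ExteriorAlgebra.ι ℂ (stdBasis i) * a)) = 0 := by
  refine Finset.sum_eq_zero fun k _ => ?_
  rcases eq_or_ne k i with rfl | hk
  · rw [mul_smul_comm, ι_mul_ι_mul_self, smul_zero]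
  · have : stdBasis k i = 0 := by simp [stdBasis, hk.symm]
    rw [this, mul_zero, zero_smul, mul_zero]

theorem logForm_mul_ι_sum (i : Fin 3) (z : C3) (a : Fin 3 → ExteriorAlgebra ℂ C3) :
    logForm i z * ∑ k, ExteriorAlgebra.ι ℂ (stdBasis k) * (logForm i z * a k) = 0 := by
  rw [Finset.mul_sum]
  refine Finset.sum_eq_zero fun k _ => ?_
  rw [mul_logForm_mul, logForm_mul_self]

/-- Multiplication by `dz_i / z_i` kills the difference between the exterior derivatives of a form
and of its horizontal part. -/
theorem logForm_mul_extDiff_horizontalPart {i : Fin 3} {z : C3} (hz : z i ≠ 0)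
    {f : C3 → ExteriorAlgebra ℂ C3} {f' g' : C3 →ₗ[ℂ] ExteriorAlgebra ℂ C3}
    (hf : HasSuperDerivAt f f' z)
    (hg : HasSuperDerivAt (fun y => SuperGeometry.horizontalPart i y (f y)) g' z) :
    logForm i z * extDiff g' = logForm i z * extDiff f' := by
  obtain ⟨h', hh, hh'⟩ := hf.horizontalPart hz
  rw [hg.unique hh]
  have e : extDiff h' = extDiff f' - ∑ k, ExteriorAlgebra.ι ℂ (stdBasis k) * (logForm i z *
      (CliffordAlgebra.contractLeft (dualOf (stdBasis k)) (f z)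
          + CliffordAlgebra.contractLeft (dualOf z) (f' (stdBasis k))))
      + ∑ k, ExteriorAlgebra.ι ℂ (stdBasis k) * ((z i ^ 2)⁻¹ * stdBasis k i) •
            (ExteriorAlgebra.ι ℂ (stdBasis i) * CliffordAlgebra.contractLeft (dualOf z) (f z)) := by
    simp only [extDiff, hh', mul_sub, Finset.sum_sub_distrib]
    abel
  rw [e, sum_ι_mul_coord_smul, add_zero, mul_sub, logForm_mul_ι_sum, sub_zero]

end Horizontal

/-! ### The derivative as a function -/

section SuperDeriv

/-- The derivative of a function where it is differentiable, and `0` elsewhere. -/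
def superDeriv {E A : Type} [NormedAddCommGroup E] [NormedSpace ℂ E] [FiniteDimensional ℂ E]
    [Ring A] [Algebra ℂ A] (f : E → A) (x : E) : E →ₗ[ℂ] A :=
  open Classical in if h : ∃ f', HasSuperDerivAt f f' x then h.choose else 0

theorem HasSuperDerivAt.superDeriv_eq {E A : Type} [NormedAddCommGroup E] [NormedSpace ℂ E]
    [FiniteDimensional ℂ E] [Ring A] [Algebra ℂ A] {f : E → A} {f' : E →ₗ[ℂ] A} {x : E}
    (h : HasSuperDerivAt f f' x) : superDeriv f x = f' := by
  have hex : ∃ f', HasSuperDerivAt f f' x := ⟨f', h⟩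
  rw [superDeriv, dif_pos hex]
  exact hex.choose_spec.unique h

theorem HasSuperDerivAt.superDeriv {E A : Type} [NormedAddCommGroup E] [NormedSpace ℂ E]
    [FiniteDimensional ℂ E] [Ring A] [Algebra ℂ A] {f : E → A} {f' : E →ₗ[ℂ] A} {x : E}
    (h : HasSuperDerivAt f f' x) : HasSuperDerivAt f (SuperGeometry.superDeriv f x) x := by
  rwa [h.superDeriv_eq]

end SuperDeriv

/-! ### Superfunctions on `Π`-symmetric frames -/

section PiSections

variable {U : Opens (TopCat.of P2)}

theorem eventually_mem_cone {z : C3} (hz : z ≠ 0) (hU : coneProj ⟨z, hz⟩ ∈ U) :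
    ∀ᶠ y in 𝓝 z, ∃ hy : y ≠ 0, coneProj ⟨y, hy⟩ ∈ U := by
  filter_upwards [eventually_over isOpen_piFrames piProj_continuous (U := U)
    (⟨⟨z, hz⟩, hU⟩ : Over piProj U) id continuous_id z rfl] with y ⟨u, hu⟩
  have hu' : u.1.1 = y := hu
  subst hu'
  exact ⟨u.1.2, u.2⟩

theorem extZero_pi (s : Over piProj U → ExteriorAlgebra ℂ C3) {z : C3} (hz : z ≠ 0)
    (hU : coneProj ⟨z, hz⟩ ∈ U) : extZero s z = s ⟨⟨z, hz⟩, hU⟩ :=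
  extZero_apply s (⟨⟨z, hz⟩, hU⟩ : Over piProj U)

variable {s : Over piProj U → ExteriorAlgebra ℂ C3}

theorem pi_hasSuperDerivAt (hs : s ∈ piSections.sections U) {z : C3} (hz : z ≠ 0)
    (hU : coneProj ⟨z, hz⟩ ∈ U) : HasSuperDerivAt (extZero s) (superDeriv (extZero s) z) z := by
  obtain ⟨⟨s', hs', -⟩, -⟩ := hs ⟨⟨z, hz⟩, hU⟩
  exact HasSuperDerivAt.superDeriv hs'

/-- A superfunction on the `Π`-projective plane, read as a form on the cone, has its exterior
derivative as its contraction with the Euler field. -/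
theorem pi_contract (hs : s ∈ piSections.sections U) {z : C3} (hz : z ≠ 0)
    (hU : coneProj ⟨z, hz⟩ ∈ U) : CliffordAlgebra.contractLeft (dualOf z) (extZero s z)
      = extDiff (superDeriv (extZero s) z) := by
  obtain ⟨⟨s', hs', h0⟩, -⟩ := hs ⟨⟨z, hz⟩, hU⟩
  rw [oddField_eq, sub_eq_zero] at h0
  rw [HasSuperDerivAt.superDeriv_eq hs', ← h0, extZero_pi s hz hU]

theorem pi_scal (hs : s ∈ piSections.sections U) {z : C3} (hz : z ≠ 0)
    (hU : coneProj ⟨z, hz⟩ ∈ U) {c : ℂ} (hc : c ≠ 0) :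
    ExteriorAlgebra.map (scal c) (extZero s (c • z)) = extZero s z := by
  have hcz : c • z ≠ 0 := smul_ne_zero hc hz
  have hp : coneProj ⟨c • z, hcz⟩ = coneProj ⟨z, hz⟩ := coneProj_smul _ _ c rfl
  have hcU : coneProj ⟨c • z, hcz⟩ ∈ U := hp ▸ hU
  rw [extZero_pi s hz hU, extZero_pi s hcz hcU]
  exact (hs ⟨⟨z, hz⟩, hU⟩).2 c ⟨⟨c • z, hcz⟩, hcU⟩ hc rfl

end PiSections

/-! ### Superfunctions on `(P², ΠΩ¹, l)` and their lifts to frames -/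

section PlaneSections

variable {U : Opens (TopCat.of P2)} {l : ℂ}

/-- The component on the `i`-th chart of a triple of functions on cones, extended by zero. -/
def chartFun (s : Over planeProj U → ExteriorAlgebra ℂ C3) (i : Fin 3) (y : C3) :
    ExteriorAlgebra ℂ C3 := extZero s (i, y)

theorem chartFun_eq (s : Over planeProj U → ExteriorAlgebra ℂ C3) {i : Fin 3} {z : C3}
    (hi : z i ≠ 0) (hz : z ≠ 0) (hU : coneProj ⟨z, hz⟩ ∈ U) :
    chartFun s i z = s ⟨⟨(i, z), hi⟩, hU⟩ :=
  extZero_apply s (⟨⟨(i, z), hi⟩, hU⟩ : Over planeProj U)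

theorem eventually_coord_ne {i : Fin 3} {z : C3} (hi : z i ≠ 0) : ∀ᶠ y in 𝓝 z, y i ≠ 0 :=
  (continuous_apply i).continuousAt.eventually_ne hi

variable {s : Over planeProj U → ExteriorAlgebra ℂ C3}

theorem plane_hasSuperDerivAt (hs : s ∈ (planeSections l).sections U) {i : Fin 3} {z : C3}
    (hi : z i ≠ 0) (hz : z ≠ 0) (hU : coneProj ⟨z, hz⟩ ∈ U) :
    HasSuperDerivAt (chartFun s i) (superDeriv (chartFun s i) z) z := by
  obtain ⟨s', hs', -⟩ := hs ⟨⟨(i, z), hi⟩, hU⟩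
  exact HasSuperDerivAt.superDeriv hs'

theorem plane_contract (hs : s ∈ (planeSections l).sections U) {i : Fin 3} {z : C3}
    (hi : z i ≠ 0) (hz : z ≠ 0) (hU : coneProj ⟨z, hz⟩ ∈ U) :
    CliffordAlgebra.contractLeft (dualOf z) (chartFun s i z) = 0 := by
  obtain ⟨s', -, h, -⟩ := hs ⟨⟨(i, z), hi⟩, hU⟩
  rw [chartFun_eq s hi hz hU]
  exact h

theorem plane_scal (hs : s ∈ (planeSections l).sections U) {i : Fin 3} {z : C3}
    (hi : z i ≠ 0) (hz : z ≠ 0) (hU : coneProj ⟨z, hz⟩ ∈ U) {c : ℂ} (hc : c ≠ 0) :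
    ExteriorAlgebra.map (scal c) (chartFun s i (c • z)) = chartFun s i z := by
  obtain ⟨s', -, -, h, -⟩ := hs ⟨⟨(i, z), hi⟩, hU⟩
  have hcz : c • z ≠ 0 := smul_ne_zero hc hz
  have hci : (c • z) i ≠ 0 := mul_ne_zero hc hi
  have hp : coneProj ⟨c • z, hcz⟩ = coneProj ⟨z, hz⟩ := coneProj_smul _ _ c rfl
  have hcU : coneProj ⟨c • z, hcz⟩ ∈ U := hp ▸ hU
  rw [chartFun_eq s hi hz hU, chartFun_eq s hci hcz hcU]
  exact h c ⟨⟨(i, c • z), hci⟩, hcU⟩ hc rfl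

theorem plane_glue (hs : s ∈ (planeSections l).sections U) {i : Fin 3} {z : C3}
    (hi : z i ≠ 0) (hj : z (i + 1) ≠ 0) (hz : z ≠ 0) (hU : coneProj ⟨z, hz⟩ ∈ U) :
    chartFun s i z = chartFun s (i + 1) z
      + (l * body (superDeriv (chartFun s i) z (stdBasis (i + 2))) / (z i * z (i + 1)))
        • eulerForm z := by
  obtain ⟨s', hs', -, -, h⟩ := hs ⟨⟨(i, z), hi⟩, hU⟩
  have hs'' : superDeriv (chartFun s i) z = s' := HasSuperDerivAt.superDeriv_eq hs'
  rw [chartFun_eq s hi hz hU, chartFun_eq s hj hz hU, hs'']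
  exact h ⟨⟨(i + 1, z), hj⟩, hU⟩ rfl

theorem plane_contract_extDiff (hs : s ∈ (planeSections l).sections U) {i : Fin 3} {z : C3}
    (hi : z i ≠ 0) (hz : z ≠ 0) (hU : coneProj ⟨z, hz⟩ ∈ U) :
    CliffordAlgebra.contractLeft (dualOf z) (extDiff (superDeriv (chartFun s i) z)) = 0 := by
  refine contract_extDiff_eq_zero (plane_hasSuperDerivAt hs hi hz hU) ?_ ?_
  · filter_upwards [isOpen_ne.mem_nhds (one_ne_zero (α := ℂ))] with c hc
    exact plane_scal hs hi hz hU hc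
  · filter_upwards [eventually_mem_cone hz hU, eventually_coord_ne hi] with y ⟨hy, hyU⟩ hyi
    exact plane_contract hs hyi hy hyU

/-- The superfunction on frames that corresponds to the `i`-th component `f` of a section: `f`
plus `dz_i / z_i` times its exterior derivative. It is the only one with horizontal part `f` that is
annihilated by the odd generator of the changes of frame. -/
def frameLift (i : Fin 3) (f : C3 → ExteriorAlgebra ℂ C3) (z : C3) : ExteriorAlgebra ℂ C3 :=
  f z + logForm i z * extDiff (superDeriv f z)

/-- The lifts of the components on two charts agree on the overlap: the difference of the forms
`dz_i / z_i` turns the exterior derivative into the cocycle by which the components differ. -/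
theorem frameLift_succ (hs : s ∈ (planeSections 1).sections U) {i : Fin 3} {z : C3}
    (hi : z i ≠ 0) (hj : z (i + 1) ≠ 0) (hz : z ≠ 0) (hU : coneProj ⟨z, hz⟩ ∈ U) :
    frameLift (i + 1) (chartFun s (i + 1)) z = frameLift i (chartFun s i) z := by
  set F := superDeriv (chartFun s i) z
  set G := superDeriv (chartFun s (i + 1)) z
  -- Both components differ by a form of degree two, so their exterior derivatives differ by a form
  -- of degree three, which is killed by `dz_{i+1}`.
  have hFG : logForm (i + 1) z * extDiff F = logForm (i + 1) z * extDiff G := by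
    rw [← sub_eq_zero, ← mul_sub, ← extDiff_sub, extDiff, Finset.mul_sum]
    refine Finset.sum_eq_zero fun k _ => ?_
    let L : ExteriorAlgebra ℂ C3 →ₗ[ℂ] ExteriorAlgebra ℂ C3 :=
      LinearMap.mulLeft ℂ (ExteriorAlgebra.ι ℂ (stdBasis (i + 1)))
        ∘ₗ LinearMap.mulLeft ℂ (ExteriorAlgebra.ι ℂ (stdBasis k))
    have hF := (plane_hasSuperDerivAt hs hi hz hU).comp_linear L
    have hG := (plane_hasSuperDerivAt hs hj hz hU).comp_linear L
    have heq : L ∘ₗ F = L ∘ₗ G := by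
      refine hF.unique (hG.congr ?_)
      filter_upwards [eventually_mem_cone hz hU, eventually_coord_ne hi, eventually_coord_ne hj]
        with y ⟨hy, hyU⟩ hyi hyj
      rw [plane_glue hs hyi hyj hy hyU, map_add, map_smul]
      have : L (eulerForm y) = 0 := ι_mul_ι_mul_eulerForm _ _ _
      rw [this, smul_zero, add_zero]
    have h1 := DFunLike.congr_fun heq (stdBasis k)
    have h2 : L ((F - G) (stdBasis k)) = 0 := by
      rw [LinearMap.sub_apply, map_sub, sub_eq_zero]; exact h1
    rw [logForm, smul_mul_assoc]
    exact (congrArg _ h2).trans (smul_zero _)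
  have hc := logForm_sub_mul_extDiff hi hj F (plane_contract_extDiff hs hi hz hU)
  rw [frameLift, frameLift, ← hFG, plane_glue hs hi hj hz hU, one_mul, ← hc, sub_mul]
  abel

theorem frameLift_indep (hs : s ∈ (planeSections 1).sections U) {i j : Fin 3} {z : C3}
    (hi : z i ≠ 0) (hj : z j ≠ 0) (hz : z ≠ 0) (hU : coneProj ⟨z, hz⟩ ∈ U) :
    frameLift j (chartFun s j) z = frameLift i (chartFun s i) z := by
  have h : j = i ∨ j = i + 1 ∨ i = j + 1 := by
    fin_cases i <;> fin_cases j <;> simp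
  rcases h with rfl | rfl | rfl
  · rfl
  · exact frameLift_succ hs hi hj hz hU
  · exact (frameLift_succ hs hj hi hz hU).symm

/-- The lift is annihilated by the odd generator of the changes of frame. This uses `d ∘ d = 0`,
that is the symmetry of the second derivative. -/
theorem frameLift_oddField (hs : s ∈ (planeSections l).sections U) {i : Fin 3} {z : C3}
    (hi : z i ≠ 0) (hz : z ≠ 0) (hU : coneProj ⟨z, hz⟩ ∈ U) :
    ∃ g' : C3 →ₗ[ℂ] ExteriorAlgebra ℂ C3,
      HasSuperDerivAt (frameLift i (chartFun s i)) g' z ∧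
      CliffordAlgebra.contractLeft (dualOf z) (frameLift i (chartFun s i) z) = extDiff g' := by
  have hd : ∀ᶠ y in 𝓝 z, HasSuperDerivAt (chartFun s i) (superDeriv (chartFun s i) y) y := by
    filter_upwards [eventually_mem_cone hz hU, eventually_coord_ne hi] with y ⟨hy, hyU⟩ hyi
    exact plane_hasSuperDerivAt hs hyi hy hyU
  obtain ⟨F, hF, hsymm⟩ := HasSuperDerivAt.exists_second hd
  have hext : HasSuperDerivAt (fun y => extDiff (superDeriv (chartFun s i) y)) _ z :=
    HasSuperDerivAt.sum fun k : Fin 3 =>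
      (hF (stdBasis k)).comp_linear (LinearMap.mulLeft ℂ (ExteriorAlgebra.ι ℂ (stdBasis k)))
  obtain ⟨h', hh, hh'⟩ := hext.logForm_mul hi
  refine ⟨_, hd.self_of_nhds.add hh, ?_⟩
  rw [frameLift, map_add, plane_contract hs hi hz hU, contract_logForm_mul hi,
    plane_contract_extDiff hs hi hz hU, mul_zero, sub_zero, zero_add]
  have e : extDiff h' = 0 := by
    have e1 : extDiff h' = logForm i z * -(∑ m, ∑ k, ExteriorAlgebra.ι ℂ (stdBasis m)
        * (ExteriorAlgebra.ι ℂ (stdBasis k) * F (stdBasis k) (stdBasis m)))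
        - ∑ m, ExteriorAlgebra.ι ℂ (stdBasis m) * (((z i ^ 2)⁻¹ * stdBasis m i) •
          (ExteriorAlgebra.ι ℂ (stdBasis i) * extDiff (superDeriv (chartFun s i) z))) := by
      rw [extDiff, ← Finset.sum_neg_distrib, Finset.mul_sum, ← Finset.sum_sub_distrib]
      refine Finset.sum_congr rfl fun m _ => ?_
      rw [hh', mul_sub, mul_logForm_mul, involute_ι, neg_mul]
      congr 3
      simp [Finset.mul_sum]
    rw [e1, sum_ι_mul_ι_mul_symm stdBasis fun k m => hsymm _ _, sum_ι_mul_coord_smul, neg_zero,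
      mul_zero, sub_zero]
  simp only [extDiff, LinearMap.add_apply, mul_add, Finset.sum_add_distrib] at e ⊢
  rw [e, add_zero]

theorem frameLift_scal (hs : s ∈ (planeSections l).sections U) {i : Fin 3} {z : C3}
    (hi : z i ≠ 0) (hz : z ≠ 0) (hU : coneProj ⟨z, hz⟩ ∈ U) {c : ℂ} (hc : c ≠ 0) :
    ExteriorAlgebra.map (scal c) (frameLift i (chartFun s i) (c • z))
      = frameLift i (chartFun s i) z := by
  have hcz : c • z ≠ 0 := smul_ne_zero hc hz
  have hci : (c • z) i ≠ 0 := mul_ne_zero hc hi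
  have hp : coneProj ⟨c • z, hcz⟩ = coneProj ⟨z, hz⟩ := coneProj_smul _ _ c rfl
  have hcU : coneProj ⟨c • z, hcz⟩ ∈ U := hp ▸ hU
  have hd := map_scal_deriv hc (plane_hasSuperDerivAt hs hi hz hU)
    (plane_hasSuperDerivAt hs hci hcz hcU) (by
      filter_upwards [eventually_mem_cone hz hU, eventually_coord_ne hi] with y ⟨hy, hyU⟩ hyi
      exact plane_scal hs hyi hy hyU hc)
  have h4 : ExteriorAlgebra.map (scal c) (extDiff (superDeriv (chartFun s i) (c • z)))
      = extDiff (superDeriv (chartFun s i) z) := by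
    simp only [extDiff, map_sum, map_mul, hd, ExteriorAlgebra.map_apply_ι]
    simp [smul_smul, hc]
  rw [frameLift, frameLift, map_add, map_mul, map_scal_logForm c hc, plane_scal hs hi hz hU hc, h4]

end PlaneSections

/-! ### The comparison of `(P², ΠΩ¹, l)` with the `Π`-projective plane -/

section Comparison

variable {U : Opens (TopCat.of P2)} {l : ℂ}

/-- The components on the affine charts of a superfunction on `Π`-symmetric frames. -/
def planeOfPi (s : Over piProj U → ExteriorAlgebra ℂ C3) :
    Over planeProj U → ExteriorAlgebra ℂ C3 :=
  fun t => horizontalPart t.1.1.1 t.1.1.2 (s ⟨⟨t.1.1.2, planeFrames_ne_zero t.1⟩, t.2⟩)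

theorem chartFun_planeOfPi (s : Over piProj U → ExteriorAlgebra ℂ C3) {i : Fin 3} {z : C3}
    (hi : z i ≠ 0) (hz : z ≠ 0) (hU : coneProj ⟨z, hz⟩ ∈ U) :
    chartFun (planeOfPi s) i z = horizontalPart i z (extZero s z) := by
  rw [chartFun_eq _ hi hz hU, extZero_pi s hz hU]
  rfl

theorem eventually_chartFun_planeOfPi (s : Over piProj U → ExteriorAlgebra ℂ C3) {i : Fin 3}
    {z : C3} (hi : z i ≠ 0) (hz : z ≠ 0) (hU : coneProj ⟨z, hz⟩ ∈ U) :
    chartFun (planeOfPi s) i =ᶠ[𝓝 z] fun y => horizontalPart i y (extZero s y) := by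
  filter_upwards [eventually_mem_cone hz hU, eventually_coord_ne hi] with y ⟨hy, hyU⟩ hyi
  exact chartFun_planeOfPi s hyi hy hyU

theorem planeOfPi_mem {s : Over piProj U → ExteriorAlgebra ℂ C3} (hs : s ∈ piSections.sections U) :
    planeOfPi s ∈ (planeSections 1).sections U := by
  rintro ⟨⟨⟨i, z⟩, hi⟩, hU⟩
  have hz : z ≠ 0 := planeFrames_ne_zero ⟨(i, z), hi⟩
  obtain ⟨g', hg, hg'⟩ := (pi_hasSuperDerivAt hs hz hU).horizontalPart hi
  refine ⟨g', hg.congr (eventually_chartFun_planeOfPi s hi hz hU),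
    contract_horizontalPart hi _, ?_, ?_⟩
  · rintro c ⟨⟨⟨j, w⟩, hj⟩, hw⟩ hc hu
    obtain ⟨rfl, rfl⟩ := Prod.mk.inj hu
    have hcz : c • z ≠ 0 := smul_ne_zero hc hz
    change ExteriorAlgebra.map (scal c) (horizontalPart j (c • z) (s ⟨⟨c • z, hcz⟩, hw⟩))
      = horizontalPart j z (s ⟨⟨z, hz⟩, hU⟩)
    rw [map_scal_horizontalPart c hc, ← extZero_pi s hcz hw, ← extZero_pi s hz hU,
      pi_scal hs hz hU hc]
  · rintro ⟨⟨⟨j, w⟩, hj⟩, hw⟩ hu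
    obtain ⟨rfl, rfl⟩ := Prod.mk.inj hu
    change horizontalPart i w (s ⟨⟨w, hz⟩, hU⟩) = horizontalPart (i + 1) w (s ⟨⟨w, hz⟩, hU⟩)
      + (1 * body (g' (stdBasis (i + 2))) / (w i * w (i + 1))) • eulerForm w
    have hb : body (g' (stdBasis (i + 2)))
        = body (superDeriv (extZero s) w (stdBasis (i + 2))) := by
      rw [hg', map_sub, map_sub, map_smul, body_logForm_mul, map_mul, body_ι, zero_mul, smul_zero,
        sub_zero, sub_zero]
    have hc := pi_contract hs hz hU
    rw [← extZero_pi s hz hU, one_mul, hb, ← logForm_sub_mul_extDiff hi hj, horizontalPart_apply,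
      horizontalPart_apply, hc, sub_mul]
    · abel
    · rw [← hc, CliffordAlgebra.contractLeft_contractLeft]

/-- Multiplication of the odd coordinates by `c`. -/
def rescale (c : ℂ) (s : Over planeProj U → ExteriorAlgebra ℂ C3) :
    Over planeProj U → ExteriorAlgebra ℂ C3 :=
  fun t => ExteriorAlgebra.map (scal c) (s t)

/-- Rescaling the odd coordinates by `c` multiplies `Ω²`, hence the cocycle, by `c ^ 2`. -/
theorem rescale_mem {s : Over planeProj U → ExteriorAlgebra ℂ C3}
    (hs : s ∈ (planeSections l).sections U) (c : ℂ) :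
    rescale c s ∈ (planeSections (c ^ 2 * l)).sections U := by
  intro t
  obtain ⟨s', hs', h0, h1, h2⟩ := hs t
  refine ⟨_, superDeriv_linear isOpen_planeFrames planeProj_continuous t _
    (Continuous.prodMk_right _) _ rfl hs' (ExteriorAlgebra.map (scal c)).toLinearMap, ?_, ?_, ?_⟩
  · rw [rescale, ← map_scal_contract, contract_smul_left, h0, smul_zero, map_zero]
  · intro d u hd hu
    rw [rescale, rescale, ← h1 d u hd hu, ← AlgHom.comp_apply, ← AlgHom.comp_apply,
      ExteriorAlgebra.map_comp_map, ExteriorAlgebra.map_comp_map]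
    congr 2
    ext
    simp [mul_left_comm]
  · intro u hu
    rw [rescale, h2 u hu, map_add, map_smul, map_scal_eulerForm, LinearMap.comp_apply,
      AlgHom.toLinearMap_apply, smul_smul]
    have hb : ∀ a, body (ExteriorAlgebra.map (scal c) a) = body a := body_map _
    rw [hb]
    congr 2
    ring

theorem rescale_inv_mem {c : ℂ} (hc : c ≠ 0) (hl : c ^ 2 = l)
    {s : Over planeProj U → ExteriorAlgebra ℂ C3} (hs : s ∈ (planeSections l).sections U) :
    rescale c⁻¹ s ∈ (planeSections 1).sections U := by
  have h := rescale_mem hs c⁻¹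
  rwa [show c⁻¹ ^ 2 * l = 1 by rw [← hl, ← mul_pow, inv_mul_cancel₀ hc, one_pow]] at h

theorem rescale_rescale {c d : ℂ} (h : c * d = 1) (s : Over planeProj U → ExteriorAlgebra ℂ C3) :
    rescale c (rescale d s) = s := by
  funext t
  rw [rescale, rescale, ← AlgHom.comp_apply, ExteriorAlgebra.map_comp_map]
  have : scal c ∘ₗ scal d = LinearMap.id := by
    ext; simp [← mul_assoc, h]
  rw [this, ExteriorAlgebra.map_id, AlgHom.id_apply]

theorem exists_coord_ne {z : C3} (hz : z ≠ 0) : ∃ i, z i ≠ 0 := by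
  by_contra! h
  exact hz (funext h)

/-- The superfunction on `Π`-symmetric frames with given components on the affine charts. At each
frame it is the lift of the component on some chart that contains it; by `frameLift_indep` the
choice of this chart does not matter. -/
def piOfPlane (s : Over planeProj U → ExteriorAlgebra ℂ C3) :
    Over piProj U → ExteriorAlgebra ℂ C3 :=
  fun t => frameLift (exists_coord_ne t.1.2).choose
    (chartFun s (exists_coord_ne t.1.2).choose) t.1.1

variable {s : Over planeProj U → ExteriorAlgebra ℂ C3}

theorem extZero_piOfPlane (hs : s ∈ (planeSections 1).sections U) {i : Fin 3} {z : C3}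
    (hi : z i ≠ 0) (hz : z ≠ 0) (hU : coneProj ⟨z, hz⟩ ∈ U) :
    extZero (piOfPlane s) z = frameLift i (chartFun s i) z := by
  rw [extZero_pi _ hz hU]
  exact frameLift_indep hs hi (exists_coord_ne hz).choose_spec hz hU

theorem piOfPlane_mem (hs : s ∈ (planeSections 1).sections U) :
    piOfPlane s ∈ piSections.sections U := by
  rintro ⟨⟨z, hz⟩, hU⟩
  obtain ⟨i, hi⟩ := exists_coord_ne hz
  have hev : extZero (piOfPlane s) =ᶠ[𝓝 z] frameLift i (chartFun s i) := by
    filter_upwards [eventually_mem_cone hz hU, eventually_coord_ne hi] with y ⟨hy, hyU⟩ hyi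
    exact extZero_piOfPlane hs hyi hy hyU
  obtain ⟨g', hg, hg'⟩ := frameLift_oddField hs hi hz hU
  refine ⟨⟨g', hg.congr hev, ?_⟩, ?_⟩
  · rw [← extZero_pi (piOfPlane s) hz hU, oddField_eq, extZero_piOfPlane hs hi hz hU, hg', sub_self]
  · rintro c ⟨⟨w, hw⟩, hwU⟩ hc hu
    obtain rfl : w = c • z := hu
    have hci : (c • z) i ≠ 0 := mul_ne_zero hc hi
    rw [← extZero_pi (piOfPlane s) hz hU, ← extZero_pi (piOfPlane s) hw hwU,
      extZero_piOfPlane hs hi hz hU, extZero_piOfPlane hs hci hw hwU,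
      frameLift_scal hs hi hz hU hc]

theorem planeOfPi_piOfPlane (hs : s ∈ (planeSections 1).sections U) :
    planeOfPi (piOfPlane s) = s := by
  funext t
  obtain ⟨⟨⟨i, z⟩, hi⟩, hU⟩ := t
  have hz : z ≠ 0 := planeFrames_ne_zero ⟨(i, z), hi⟩
  rw [← chartFun_eq s hi hz hU, ← chartFun_eq (planeOfPi _) hi hz hU,
    chartFun_planeOfPi _ hi hz hU, extZero_piOfPlane hs hi hz hU, horizontalPart_apply, frameLift,
    map_add, plane_contract hs hi hz hU, contract_logForm_mul hi,
    plane_contract_extDiff hs hi hz hU, mul_zero, sub_zero, zero_add, add_sub_cancel_right]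

theorem piOfPlane_planeOfPi {s : Over piProj U → ExteriorAlgebra ℂ C3}
    (hs : s ∈ piSections.sections U) : piOfPlane (planeOfPi s) = s := by
  funext t
  obtain ⟨⟨z, hz⟩, hU⟩ := t
  obtain ⟨i, hi⟩ := exists_coord_ne hz
  have hmem := planeOfPi_mem hs
  have hd := plane_hasSuperDerivAt hmem hi hz hU
  have hg := hd.congr (eventually_chartFun_planeOfPi s hi hz hU).symm
  rw [← extZero_pi s hz hU, ← extZero_pi (piOfPlane _) hz hU, extZero_piOfPlane hmem hi hz hU,
    frameLift, logForm_mul_extDiff_horizontalPart hi (pi_hasSuperDerivAt hs hz hU) hg,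
    chartFun_planeOfPi s hi hz hU, horizontalPart_apply, pi_contract hs hz hU, sub_add_cancel]

/-- The isomorphism of algebras of sections over `U` that underlies the isomorphism between
`(P², ΠΩ¹, l)` and the `Π`-projective plane, given a square root `c` of `l`. -/
def comparison (U : Opens (TopCat.of P2)) {c : ℂ} (hc : c ≠ 0) (hl : c ^ 2 = l) :
    piSections.sections U ≃ₐ[ℂ] (planeSections l).sections U where
  toFun s := ⟨rescale c (planeOfPi s.1), by
    have h := rescale_mem (planeOfPi_mem s.2) c
    rwa [mul_one, hl] at h⟩
  invFun s := ⟨piOfPlane (rescale c⁻¹ s.1), piOfPlane_mem (rescale_inv_mem hc hl s.2)⟩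
  left_inv s := Subtype.ext (by
    change piOfPlane (rescale c⁻¹ (rescale c (planeOfPi s.1))) = s.1
    rw [rescale_rescale (inv_mul_cancel₀ hc), piOfPlane_planeOfPi s.2])
  right_inv s := Subtype.ext (by
    change rescale c (planeOfPi (piOfPlane (rescale c⁻¹ s.1))) = s.1
    rw [planeOfPi_piOfPlane (rescale_inv_mem hc hl s.2), rescale_rescale (mul_inv_cancel₀ hc)])
  map_mul' s t := Subtype.ext (funext fun u => by
    change ExteriorAlgebra.map (scal c) (horizontalPart _ _ (s.1 _ * t.1 _)) = _
    rw [horizontalPart_mul, map_mul]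
    rfl)
  map_add' s t := Subtype.ext (funext fun u => by
    change ExteriorAlgebra.map (scal c) (horizontalPart _ _ (s.1 _ + t.1 _)) = _
    rw [map_add, map_add]
    rfl)
  commutes' r := Subtype.ext (funext fun u => by
    change ExteriorAlgebra.map (scal c) (horizontalPart _ _ (algebraMap ℂ _ r)) = _
    rw [horizontalPart_algebraMap, AlgHom.commutes]
    rfl)

end Comparison

/-! ### Topology of the reduced spaces -/

section Topology

theorem isOpenMap_coneProj : IsOpenMap coneProj := by
  intro O hO
  have hq : Topology.IsQuotientMap coneProj :=
    isQuotientMap_quotient_mk' (s := projectivizationSetoid ℂ C3)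
  rw [← hq.isOpen_preimage]
  have h : coneProj ⁻¹' (coneProj '' O) = ⋃ c : ℂˣ,
      (fun z : {z : C3 // z ≠ 0} => (⟨c • z.1, smul_ne_zero c.ne_zero z.2⟩ : {z : C3 // z ≠ 0}))
        ⁻¹' O := by
    ext z
    simp only [Set.mem_preimage, Set.mem_image, Set.mem_iUnion]
    constructor
    · rintro ⟨w, hw, hwz⟩
      obtain ⟨c, hc⟩ := (Projectivization.mk_eq_mk_iff ℂ _ _ w.2 z.2).1 hwz
      refine ⟨c, ?_⟩
      convert hw
    · rintro ⟨c, hc⟩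
      exact ⟨_, hc, coneProj_smul _ _ (c : ℂ) rfl⟩
  rw [h]
  exact isOpen_iUnion fun c => hO.preimage
    (Continuous.subtype_mk (continuous_subtype_val.const_smul c) _)

theorem coneProj_surjective : Function.Surjective coneProj := fun p =>
  ⟨⟨p.rep, p.rep_nonzero⟩, p.mk_rep⟩

theorem exists_smul_of_coneProj_eq {z w : {z : C3 // z ≠ 0}} (h : coneProj z = coneProj w) :
    ∃ c : ℂ, c ≠ 0 ∧ z.1 = c • w.1 := by
  obtain ⟨c, hc⟩ := (Projectivization.mk_eq_mk_iff ℂ _ _ z.2 w.2).1 h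
  exact ⟨c, c.ne_zero, hc.symm⟩

instance : T2Space P2 := by
  have hq : IsOpenQuotientMap coneProj :=
    ⟨coneProj_surjective, coneProj_continuous, isOpenMap_coneProj⟩
  rw [t2_iff_isClosed_diagonal, ← (hq.prodMap hq).isQuotientMap.isClosed_preimage]
  -- Two vectors are proportional if and only if their two by two minors vanish.
  have h : Prod.map coneProj coneProj ⁻¹' Set.diagonal P2
      = ⋂ (i : Fin 3) (j : Fin 3), {p | p.1.1 i * p.2.1 j = p.1.1 j * p.2.1 i} := by
    ext ⟨z, w⟩
    simp only [Set.mem_preimage, Prod.map_apply, Set.mem_diagonal_iff, Set.mem_iInter,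
      Set.mem_ofPred_eq]
    constructor
    · intro hzw i j
      obtain ⟨c, -, hc⟩ := exists_smul_of_coneProj_eq hzw
      simp only [hc, Pi.smul_apply, smul_eq_mul]
      ring
    · intro hzw
      obtain ⟨j, hj⟩ := exists_coord_ne w.2
      refine coneProj_smul _ _ (z.1 j / w.1 j) (funext fun i => ?_)
      rw [Pi.smul_apply, smul_eq_mul, div_mul_eq_mul_div, eq_div_iff hj, hzw i j]
  rw [h]
  have h1 : ∀ i : Fin 3, Continuous fun p : {z : C3 // z ≠ 0} × {z : C3 // z ≠ 0} => p.1.1 i :=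
    fun i => (continuous_apply i).comp (continuous_subtype_val.comp continuous_fst)
  have h2 : ∀ i : Fin 3, Continuous fun p : {z : C3 // z ≠ 0} × {z : C3 // z ≠ 0} => p.2.1 i :=
    fun i => (continuous_apply i).comp (continuous_subtype_val.comp continuous_snd)
  exact isClosed_iInter fun i => isClosed_iInter fun j =>
    isClosed_eq ((h1 i).mul (h2 j)) ((h1 j).mul (h2 i))

theorem isOpenMap_grProj : IsOpenMap grProj := by
  let e : GrFrames → {z : C3 // z ≠ 0} × {z : C3 // z ≠ 0} :=
    fun p => (⟨p.1.1, p.2.1⟩, ⟨p.1.2, p.2.2⟩)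
  have he : IsOpenMap e := by
    refine IsOpenMap.of_inverse (f' := fun q => ⟨(q.1.1, q.2.1), q.1.2, q.2.2⟩)
      ?_ (fun _ => rfl) (fun _ => rfl)
    exact Continuous.subtype_mk ((continuous_subtype_val.comp continuous_fst).prodMk
      (continuous_subtype_val.comp continuous_snd)) _
  exact (isOpenMap_coneProj.prodMap isOpenMap_coneProj).comp he

/-- The affine chart `z_i ≠ 0` of the projective plane. -/
def affineChart (i : Fin 3) : Opens (TopCat.of P2) where
  carrier := coneProj '' {z | z.1 i ≠ 0}
  is_open' := isOpenMap_coneProj _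
    (isOpen_ne.preimage ((continuous_apply i).comp continuous_subtype_val))

theorem coneProj_mem_affineChart {i : Fin 3} {z : C3} (hz : z ≠ 0) :
    coneProj ⟨z, hz⟩ ∈ affineChart i ↔ z i ≠ 0 := by
  constructor
  · rintro ⟨w, hw, hwz⟩
    obtain ⟨c, -, hc⟩ := exists_smul_of_coneProj_eq hwz
    intro h0
    exact hw ((congrFun hc i).trans (mul_eq_zero_of_right c h0))
  · exact fun h => ⟨_, h, rfl⟩

/-- The diagonal of the projective plane. -/
def diagonalMap : TopCat.of P2 ⟶ TopCat.of (P2 × P2) :=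
  TopCat.ofHom ⟨fun p => (p, p), continuous_id.prodMk continuous_id⟩

theorem isClosedEmbedding_diagonalMap : Topology.IsClosedEmbedding diagonalMap := by
  refine Topology.IsClosedEmbedding.of_continuous_injective_isClosedMap
    (continuous_id.prodMk continuous_id) (fun p q h => congrArg Prod.fst h) ?_
  refine (Function.LeftInverse.isClosedEmbedding (f := Prod.fst) (g := fun p : P2 => (p, p))
    (fun _ => rfl) continuous_fst (continuous_id.prodMk continuous_id)).isClosedMap

end Topology

/-! ### Invertible superfunctions on the super Grassmannian -/

section Units

variable {V : Opens (TopCat.of (P2 × P2))} {s : Over grProj V → ExteriorAlgebra ℂ (C3 × C3)}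

/-- The inverse of a superfunction that is annihilated by an odd derivation is annihilated too. -/
theorem oddField_inverse {W E κ : Type} [AddCommGroup W] [Module ℂ W] [Module.Finite ℂ W]
    [NormedAddCommGroup E] [NormedSpace ℂ E] [FiniteDimensional ℂ E] [Fintype κ]
    (d : Module.Dual ℂ W) (w : κ → W) (e : κ → E) {f g : E → ExteriorAlgebra ℂ W}
    {f' g' : E →ₗ[ℂ] ExteriorAlgebra ℂ W} {x : E} (hf : HasSuperDerivAt f f' x)
    (hg : HasSuperDerivAt g g' x) (h : ∀ᶠ y in 𝓝 x, f y * g y = 1)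
    (h' : g x * f x = 1) (h0 : oddField d w e (f x) f' = 0) : oddField d w e (g x) g' = 0 := by
  have h1 := oddField_mul d w e (f x) (g x) f' g'
  have h2 := (hf.mul hg).unique ((HasSuperDerivAt.const 1 x).congr h)
  have h3 := oddField_const d w e 1
  rw [map_one] at h3
  rw [h2, h.self_of_nhds, h3, h0, zero_mul, zero_add] at h1
  have h4 := congrArg (CliffordAlgebra.involute (g x) * ·) h1
  simp only [mul_zero, ← mul_assoc] at h4
  rw [← map_mul, h', map_one, one_mul] at h4
  exact h4.symm

theorem eventually_gr_mem {p : C3 × C3} (hp : p ∈ GrFrames) (hV : grProj ⟨p, hp⟩ ∈ V) :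
    ∀ᶠ q in 𝓝 p, ∃ hq : q ∈ GrFrames, grProj ⟨q, hq⟩ ∈ V := by
  filter_upwards [eventually_over isOpen_grFrames grProj_continuous (U := V)
    (⟨⟨p, hp⟩, hV⟩ : Over grProj V) id continuous_id p rfl] with y ⟨u, hu⟩
  have hu' : u.1.1 = y := hu
  subst hu'
  exact ⟨u.1.2, u.2⟩

theorem extZero_gr (s : Over grProj V → ExteriorAlgebra ℂ (C3 × C3)) {p : C3 × C3}
    (hp : p ∈ GrFrames) (hV : grProj ⟨p, hp⟩ ∈ V) : extZero s p = s ⟨⟨p, hp⟩, hV⟩ :=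
  extZero_apply s (⟨⟨p, hp⟩, hV⟩ : Over grProj V)

theorem inverse_mem_grSections (hs : s ∈ grSections.sections V) (hu : ∀ t, IsUnit (s t)) :
    (fun t => Ring.inverse (s t)) ∈ grSections.sections V := by
  obtain ⟨r, hr⟩ : ∃ r : Over grProj V → ExteriorAlgebra ℂ (C3 × C3),
    r = fun t => Ring.inverse (s t) := ⟨_, rfl⟩
  have hsr : ∀ t, s t * r t = 1 := fun t => by rw [hr]; exact Ring.mul_inverse_cancel _ (hu t)
  have hrs : ∀ t, r t * s t = 1 := fun t => by rw [hr]; exact Ring.inverse_mul_cancel _ (hu t)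
  rw [← hr]
  rintro ⟨⟨p, hp⟩, hV⟩
  obtain ⟨⟨s', hs', h0, h1⟩, hsc⟩ := hs ⟨⟨p, hp⟩, hV⟩
  have hev : ∀ᶠ q in 𝓝 p, extZero s q * extZero r q = 1 ∧ extZero r q * extZero s q = 1 := by
    filter_upwards [eventually_gr_mem hp hV] with q ⟨hq, hqV⟩
    rw [extZero_gr s hq hqV, extZero_gr r hq hqV]
    exact ⟨hsr _, hrs _⟩
  obtain ⟨g', hg⟩ := HasSuperDerivAt.exists_inverse hs' hev
  rw [← extZero_gr s hp hV] at h0 h1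
  refine ⟨⟨g', hg, ?_, ?_⟩, fun c d u hc hd huc => ?_⟩
  · rw [← extZero_gr r hp hV]
    exact oddField_inverse _ _ _ hs' hg (hev.mono fun _ h => h.1) hev.self_of_nhds.2 h0
  · rw [← extZero_gr r hp hV]
    exact oddField_inverse _ _ _ hs' hg (hev.mono fun _ h => h.1) hev.self_of_nhds.2 h1
  · have h2 := hsc c d u hc hd huc
    have h3 := congrArg (ExteriorAlgebra.map (LinearMap.prodMap (scal c) (scal d))) (hrs u)
    rw [map_mul, h2, map_one] at h3
    exact left_inv_eq_right_inv h3 (hsr _)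

/-- A section of the super Grassmannian is invertible near every point at which its degree zero
component is not zero. -/
theorem exists_isUnit_gr (s : grSections.sections V) (t : Over grProj V)
    (ht : ExteriorAlgebra.algebraMapInv (s.1 t) ≠ 0) :
    ∃ (W : Opens (TopCat.of (P2 × P2))) (hW : W ≤ V),
      grProj t.1 ∈ W ∧ IsUnit (grSections.resHom hW s) := by
  let b : C3 × C3 → ℂ := fun p => ExteriorAlgebra.algebraMapInv (extZero s.1 p)
  let O : Set GrFrames := {p | grProj p ∈ V ∧ b p.1 ≠ 0}
  have hO : IsOpen O := by
    rw [isOpen_iff_mem_nhds]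
    rintro ⟨p, hp⟩ ⟨hV, hb⟩
    obtain ⟨⟨s', hs', -⟩, -⟩ := s.2 ⟨⟨p, hp⟩, hV⟩
    have hcont : ContinuousAt b p := (hs' ExteriorAlgebra.algebraMapInv.toLinearMap).continuousAt
    have h1 : ∀ᶠ q : GrFrames in 𝓝 ⟨p, hp⟩, b q.1 ≠ 0 :=
      (continuous_subtype_val.tendsto (⟨p, hp⟩ : GrFrames)).eventually (hcont.eventually_ne hb)
    filter_upwards [(V.isOpen.preimage grProj_continuous).mem_nhds hV, h1] with q hqV hqb
    exact ⟨hqV, hqb⟩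
  let W : Opens (TopCat.of (P2 × P2)) := ⟨grProj '' O, isOpenMap_grProj _ hO⟩
  have hW : W ≤ V := by
    rintro _ ⟨p, hp, rfl⟩
    exact hp.1
  refine ⟨W, hW, ⟨t.1, ⟨t.2, ?_⟩, rfl⟩, ?_⟩
  · rwa [show b t.1.1 = _ from congrArg ExteriorAlgebra.algebraMapInv (extZero_apply s.1 t)]
  · have hu : ∀ u, IsUnit ((grSections.resHom hW s).1 u) := by
      rintro ⟨⟨q, hq⟩, hqW⟩
      obtain ⟨⟨p, hp⟩, ⟨hpV, hpb⟩, hpq⟩ := hqW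
      obtain ⟨c, hc, hc'⟩ := exists_smul_of_coneProj_eq (congrArg Prod.fst hpq)
      obtain ⟨d, hd, hd'⟩ := exists_smul_of_coneProj_eq (congrArg Prod.snd hpq)
      have hqV : grProj ⟨q, hq⟩ ∈ V := hW ⟨⟨p, hp⟩, ⟨hpV, hpb⟩, hpq⟩
      have h := (s.2 ⟨⟨q, hq⟩, hqV⟩).2 c d ⟨⟨p, hp⟩, hpV⟩ hc hd (Prod.ext hc' hd')
      -- The degree zero component is invariant under scalings, so it does not vanish on any frame
      -- over `W`.
      refine isUnit_of_body_ne_zero ?_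
      change ExteriorAlgebra.algebraMapInv (s.1 ⟨⟨q, hq⟩, hqV⟩) ≠ 0
      rw [← h, body_map, ← extZero_gr s.1 hp hpV]
      exact hpb
    let g : grSections.sections W := ⟨_, inverse_mem_grSections (grSections.resHom hW s).2 hu⟩
    exact ⟨⟨grSections.resHom hW s, g,
      Subtype.ext (funext fun u => Ring.mul_inverse_cancel _ (hu u)),
      Subtype.ext (funext fun u => Ring.inverse_mul_cancel _ (hu u))⟩, rfl⟩

end Units

/-! ### Restriction of superfunctions to `Π`-symmetric frames -/

section LinearPullback

variable {V : Opens (TopCat.of (P2 × P2))}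

/-- The substitution `ξ ↦ θ`, `η ↦ -θ` in the odd coordinates. -/
abbrev oddPullback : ExteriorAlgebra ℂ (C3 × C3) →ₐ[ℂ] ExteriorAlgebra ℂ C3 :=
  ExteriorAlgebra.map (LinearMap.fst ℂ C3 C3 - LinearMap.snd ℂ C3 C3)

/-- The restriction of a superfunction on frames of `1|1`-subspaces to `Π`-symmetric frames. -/
def piOfGr (s : Over grProj V → ExteriorAlgebra ℂ (C3 × C3)) :
    Over piProj ((Opens.map diagonalMap).obj V) → ExteriorAlgebra ℂ C3 :=
  fun t => oddPullback (s ⟨⟨(t.1.1, t.1.1), t.1.2, t.1.2⟩, t.2⟩)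

theorem extZero_piOfGr (s : Over grProj V → ExteriorAlgebra ℂ (C3 × C3)) {z : C3} (hz : z ≠ 0)
    (hU : coneProj ⟨z, hz⟩ ∈ (Opens.map diagonalMap).obj V) :
    extZero (piOfGr s) z = oddPullback (extZero s (z, z)) := by
  rw [extZero_pi _ hz hU, extZero_gr s (p := (z, z)) ⟨hz, hz⟩ hU]
  rfl

/-- The odd generator of the changes of `Π`-symmetric frames is the difference of the two odd
generators of `GL(1|1)`. -/
theorem oddPullback_oddField (z : C3) (a : ExteriorAlgebra ℂ (C3 × C3))
    (F : C3 × C3 →ₗ[ℂ] ExteriorAlgebra ℂ (C3 × C3)) :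
    CliffordAlgebra.contractLeft (dualOf z) (oddPullback a)
        - ∑ k, ExteriorAlgebra.ι ℂ (stdBasis k) * oddPullback (F (stdBasis k, stdBasis k))
      = oddPullback (oddField (dualOf z ∘ₗ LinearMap.fst ℂ C3 C3) (fun k => (0, stdBasis k))
          (fun k => (stdBasis k, 0)) a F
        - oddField (dualOf z ∘ₗ LinearMap.snd ℂ C3 C3) (fun k => (stdBasis k, 0))
          (fun k => (0, stdBasis k)) a F) := by
  have h : ∀ v : C3, F (v, v) = F (v, 0) + F (0, v) := fun v => by
    rw [← map_add, Prod.mk_add_mk, add_zero, zero_add]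
  rw [contract_map, LinearMap.comp_sub, map_sub, LinearMap.sub_apply]
  simp only [oddField, h, map_sub, map_add, map_sum, map_mul, ExteriorAlgebra.map_apply_ι, mul_add,
    LinearMap.sub_apply, LinearMap.fst_apply, LinearMap.snd_apply, Finset.sum_add_distrib, zero_sub,
    sub_zero, map_neg, neg_mul, Finset.sum_neg_distrib]
  abel

theorem piOfGr_mem {s : Over grProj V → ExteriorAlgebra ℂ (C3 × C3)}
    (hs : s ∈ grSections.sections V) :
    piOfGr s ∈ piSections.sections ((Opens.map diagonalMap).obj V) := by
  rintro ⟨⟨z, hz⟩, hU⟩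
  obtain ⟨⟨s', hs', h0, h1⟩, hsc⟩ := hs ⟨⟨(z, z), hz, hz⟩, hU⟩
  have hd := (HasSuperDerivAt.comp_hasFDerivAt (m := fun y : C3 => (y, y)) (x := z) hs'
    ((hasFDerivAt_id z).prodMk (hasFDerivAt_id z))).comp_linear oddPullback.toLinearMap
  refine ⟨⟨_, hd.congr ?_, ?_⟩, ?_⟩
  · filter_upwards [eventually_mem_cone hz hU] with y ⟨hy, hyU⟩
    exact extZero_piOfGr s hy hyU
  · rw [oddField_eq]
    have h := oddPullback_oddField z (s ⟨⟨(z, z), hz, hz⟩, hU⟩) s'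
    rw [h0, h1, sub_self, map_zero] at h
    exact h
  · rintro c ⟨⟨w, hw⟩, hwU⟩ hc hu
    obtain rfl : w = c • z := hu
    have h := hsc c c ⟨⟨(c • z, c • z), hw, hw⟩, hwU⟩ hc hc rfl
    change ExteriorAlgebra.map (scal c) (oddPullback (s ⟨⟨(c • z, c • z), hw, hw⟩, hwU⟩))
      = oddPullback (s ⟨⟨(z, z), hz, hz⟩, hU⟩)
    rw [← h, ← AlgHom.comp_apply, ← AlgHom.comp_apply, ExteriorAlgebra.map_comp_map,
      ExteriorAlgebra.map_comp_map]
    congr 2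
    ext <;> simp

/-- The pull-back of sections along the linear inclusion of the `Π`-projective plane into the super
Grassmannian. -/
def linearPullback (V : Opens (TopCat.of (P2 × P2))) :
    grSections.sections V →ₐ[ℂ] piSections.sections ((Opens.map diagonalMap).obj V) where
  toFun s := ⟨piOfGr s.1, piOfGr_mem s.2⟩
  map_one' := Subtype.ext (funext fun _ => map_one oddPullback)
  map_mul' _ _ := Subtype.ext (funext fun _ => map_mul oddPullback _ _)
  map_zero' := Subtype.ext (funext fun _ => map_zero oddPullback)
  map_add' _ _ := Subtype.ext (funext fun _ => map_add oddPullback _ _)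
  commutes' _ := Subtype.ext (funext fun _ => AlgHom.commutes oddPullback _)

end LinearPullback

/-! ### Local extension of superfunctions to the super Grassmannian -/

section Extension

/-- The inclusion of the Grassmann algebra on the `ξ_k` into the one on the `ξ_k` and `η_k`. -/
abbrev inclXi : ExteriorAlgebra ℂ C3 →ₐ[ℂ] ExteriorAlgebra ℂ (C3 × C3) :=
  ExteriorAlgebra.map (LinearMap.inl ℂ C3 C3)

/-- `D f` at the point `(x, y)`, for a superfunction `f` of the first row `(x | ξ)` and the odd
field `D = ∑ (y_k ∂/∂ξ_k + η_k ∂/∂x_k)` that adds the second row to it. -/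
def rowField (f : C3 → ExteriorAlgebra ℂ C3) (p : C3 × C3) : ExteriorAlgebra ℂ (C3 × C3) :=
  inclXi (CliffordAlgebra.contractLeft (dualOf p.2) (f p.1))
    + ∑ k, ExteriorAlgebra.ι ℂ (0, stdBasis k) * inclXi (superDeriv f p.1 (stdBasis k))

/-- The superfunction `f - (ξ_i / y_i) D f` on frames. It is `f` evaluated at the row
`(x | ξ) - (ξ_i / y_i) (η | y)`, the combination of the two rows whose `i`-th odd coordinate is
zero. -/
def grExtension (i : Fin 3) (f : C3 → ExteriorAlgebra ℂ C3) (p : C3 × C3) :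
    ExteriorAlgebra ℂ (C3 × C3) :=
  inclXi (f p.1) - (p.2 i)⁻¹ • (ExteriorAlgebra.ι ℂ (stdBasis i, 0) * rowField f p)

variable {f : C3 → ExteriorAlgebra ℂ C3} {p : C3 × C3}

theorem hasSuperDerivAt_rowField (hf : HasSuperDerivAt f (superDeriv f p.1) p.1)
    {F : C3 →ₗ[ℂ] C3 →ₗ[ℂ] ExteriorAlgebra ℂ C3}
    (hF : ∀ e, HasSuperDerivAt (fun y => superDeriv f y e) (F e) p.1) :
    ∃ G : C3 × C3 →ₗ[ℂ] ExteriorAlgebra ℂ (C3 × C3),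
      HasSuperDerivAt (rowField f) G p ∧ ∀ v w, G (v, w) =
        inclXi (CliffordAlgebra.contractLeft (dualOf w) (f p.1))
        + inclXi (CliffordAlgebra.contractLeft (dualOf p.2) (superDeriv f p.1 v))
        + ∑ k, ExteriorAlgebra.ι ℂ (0, stdBasis k) * inclXi (F (stdBasis k) v) := by
  have h1 := HasSuperDerivAt.sum fun k : Fin 3 => HasSuperDerivAt.smul (x := p)
    (((ContinuousLinearMap.proj k : C3 →L[ℂ] ℂ).comp
      (ContinuousLinearMap.snd ℂ C3 C3)).hasFDerivAt)
    ((HasSuperDerivAt.comp_hasFDerivAt (m := Prod.fst) (x := p) hf hasFDerivAt_fst).comp_linear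
      (inclXi.toLinearMap ∘ₗ CliffordAlgebra.contractLeft (dualOf (stdBasis k))))
  have h2 := HasSuperDerivAt.sum fun k : Fin 3 =>
    (HasSuperDerivAt.comp_hasFDerivAt (m := Prod.fst) (x := p) (hF (stdBasis k))
      hasFDerivAt_fst).comp_linear
        (LinearMap.mulLeft ℂ (ExteriorAlgebra.ι ℂ ((0 : C3), stdBasis k)) ∘ₗ inclXi.toLinearMap)
  refine ⟨_, (h1.add h2).congr (Filter.Eventually.of_forall fun q => ?_), fun v w => ?_⟩
  · rw [rowField, contract_eq_sum]
    simp
  · rw [contract_eq_sum w, contract_eq_sum p.2]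
    simp only [LinearMap.add_apply, LinearMap.sum_apply, LinearMap.smul_apply, LinearMap.comp_apply,
      LinearMap.smulRight_apply, Finset.sum_add_distrib, map_sum, map_smul]
    exact congrArg (· + _) (add_comm _ _)

theorem hasSuperDerivAt_grExtension {i : Fin 3} (hi : p.2 i ≠ 0)
    (hf : HasSuperDerivAt f (superDeriv f p.1) p.1)
    {G : C3 × C3 →ₗ[ℂ] ExteriorAlgebra ℂ (C3 × C3)}
    (hG : HasSuperDerivAt (rowField f) G p) :
    ∃ H : C3 × C3 →ₗ[ℂ] ExteriorAlgebra ℂ (C3 × C3),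
      HasSuperDerivAt (grExtension i f) H p ∧ ∀ v w, H (v, w) =
        inclXi (superDeriv f p.1 v)
        - (p.2 i)⁻¹ • (ExteriorAlgebra.ι ℂ (stdBasis i, 0) * G (v, w))
        + ((p.2 i ^ 2)⁻¹ * w i) •
          (ExteriorAlgebra.ι ℂ (stdBasis i, 0) * rowField f p) := by
  have h1 := (HasSuperDerivAt.comp_hasFDerivAt (m := Prod.fst) (x := p) hf
    hasFDerivAt_fst).comp_linear inclXi.toLinearMap
  have h2 := HasSuperDerivAt.smul (c := fun q : C3 × C3 => (q.2 i)⁻¹) (x := p)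
    ((hasFDerivAt_inv_coord hi).comp p hasFDerivAt_snd)
    (hG.comp_linear (LinearMap.mulLeft ℂ (ExteriorAlgebra.ι ℂ (stdBasis i, (0 : C3)))))
  refine ⟨_, (h1.add (h2.comp_linear (-LinearMap.id))).congr
    (Filter.Eventually.of_forall fun q => ?_), fun v w => ?_⟩
  · simp [grExtension, sub_eq_add_neg]
  · simp
    abel

theorem contract_fst_inclXi (y : C3) (a : ExteriorAlgebra ℂ C3) :
    CliffordAlgebra.contractLeft (dualOf y ∘ₗ LinearMap.fst ℂ C3 C3) (inclXi a)
      = inclXi (CliffordAlgebra.contractLeft (dualOf y) a) := by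
  rw [contract_map, LinearMap.comp_assoc, LinearMap.fst_comp_inl, LinearMap.comp_id]

theorem contract_snd_inclXi (x : C3) (a : ExteriorAlgebra ℂ C3) :
    CliffordAlgebra.contractLeft (dualOf x ∘ₗ LinearMap.snd ℂ C3 C3) (inclXi a) = 0 := by
  rw [contract_map, LinearMap.comp_assoc, LinearMap.snd_comp_inl, LinearMap.comp_zero, map_zero,
    LinearMap.zero_apply, map_zero]

/-- The extension is annihilated by `D`, since `D (ξ_i / y_i) = 1` and `D ∘ D = 0`. -/
theorem oddField_fst_grExtension {i : Fin 3} (hi : p.2 i ≠ 0)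
    {F : C3 →ₗ[ℂ] C3 →ₗ[ℂ] ExteriorAlgebra ℂ C3} (hsymm : ∀ u v, F u v = F v u)
    {G H : C3 × C3 →ₗ[ℂ] ExteriorAlgebra ℂ (C3 × C3)}
    (hG : ∀ v w, G (v, w) = inclXi (CliffordAlgebra.contractLeft (dualOf w) (f p.1))
        + inclXi (CliffordAlgebra.contractLeft (dualOf p.2) (superDeriv f p.1 v))
        + ∑ k, ExteriorAlgebra.ι ℂ (0, stdBasis k) * inclXi (F (stdBasis k) v))
    (hH : ∀ v w, H (v, w) = inclXi (superDeriv f p.1 v)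
        - (p.2 i)⁻¹ • (ExteriorAlgebra.ι ℂ (stdBasis i, 0) * G (v, w))
        + ((p.2 i ^ 2)⁻¹ * w i) • (ExteriorAlgebra.ι ℂ (stdBasis i, 0) * rowField f p)) :
    oddField (dualOf p.2 ∘ₗ LinearMap.fst ℂ C3 C3) (fun k => (0, stdBasis k))
      (fun k => (stdBasis k, 0)) (grExtension i f p) H = 0 := by
  have hrow : CliffordAlgebra.contractLeft (dualOf p.2 ∘ₗ LinearMap.fst ℂ C3 C3) (rowField f p)
      = -∑ k, ExteriorAlgebra.ι ℂ (0, stdBasis k)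
        * inclXi (CliffordAlgebra.contractLeft (dualOf p.2) (superDeriv f p.1 (stdBasis k))) := by
    rw [rowField, map_add, contract_fst_inclXi, CliffordAlgebra.contractLeft_contractLeft, map_zero,
      zero_add, map_sum, ← Finset.sum_neg_distrib]
    refine Finset.sum_congr rfl fun k _ => ?_
    rw [contract_ι_mul, contract_fst_inclXi, LinearMap.comp_apply, LinearMap.fst_apply, map_zero,
      zero_smul, zero_sub]
  have hsum : ∑ k, ExteriorAlgebra.ι ℂ ((0 : C3), stdBasis k) * G (stdBasis k, 0)
      = ∑ k, ExteriorAlgebra.ι ℂ (0, stdBasis k)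
        * inclXi (CliffordAlgebra.contractLeft (dualOf p.2) (superDeriv f p.1 (stdBasis k))) := by
    have h0 : CliffordAlgebra.contractLeft (dualOf 0) (f p.1) = 0 := by
      rw [← zero_smul ℂ (0 : C3), contract_smul_left, zero_smul]
    have hz := sum_ι_mul_ι_mul_symm (fun k : Fin 3 => ((0 : C3), stdBasis k))
      (a := fun k m => inclXi (F (stdBasis k) (stdBasis m))) fun k m => by rw [hsymm]
    simp only [hG, h0, map_zero, zero_add, mul_add, Finset.sum_add_distrib, Finset.mul_sum, hz,
      add_zero]
  have hder : ∑ k, ExteriorAlgebra.ι ℂ ((0 : C3), stdBasis k) * H (stdBasis k, 0)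
      = ∑ k, ExteriorAlgebra.ι ℂ (0, stdBasis k) * inclXi (superDeriv f p.1 (stdBasis k))
        + (p.2 i)⁻¹ • (ExteriorAlgebra.ι ℂ (stdBasis i, 0)
          * ∑ k, ExteriorAlgebra.ι ℂ (0, stdBasis k) * G (stdBasis k, 0)) := by
    rw [Finset.mul_sum, Finset.smul_sum, ← Finset.sum_add_distrib]
    refine Finset.sum_congr rfl fun k _ => ?_
    rw [hH, Pi.zero_apply, mul_zero, zero_smul, add_zero, mul_sub, mul_smul_comm, ι_mul_ι_mul_swap,
      smul_neg, sub_neg_eq_add]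
  have hval : (dualOf p.2 ∘ₗ LinearMap.fst ℂ C3 C3) (stdBasis i, 0) = p.2 i := by
    rw [LinearMap.comp_apply, LinearMap.fst_apply, dualOf_stdBasis]
  rw [oddField, hder, hsum, grExtension, map_sub, map_smul, contract_fst_inclXi, contract_ι_mul,
    hrow, hval, smul_sub, inv_smul_smul₀ hi, rowField, mul_neg, smul_neg]
  abel

/-- The extension is annihilated by the odd field `∑ (x_k ∂/∂η_k + ξ_k ∂/∂y_k)` that adds the first
row to the second one: its commutator with `D` is the Euler field on functions of the first row. -/
theorem oddField_snd_grExtension {i : Fin 3}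
    (heuler : superDeriv f p.1 p.1 + degreeOp (f p.1) = 0)
    {F : C3 →ₗ[ℂ] C3 →ₗ[ℂ] ExteriorAlgebra ℂ C3}
    {G H : C3 × C3 →ₗ[ℂ] ExteriorAlgebra ℂ (C3 × C3)}
    (hG : ∀ v w, G (v, w) = inclXi (CliffordAlgebra.contractLeft (dualOf w) (f p.1))
        + inclXi (CliffordAlgebra.contractLeft (dualOf p.2) (superDeriv f p.1 v))
        + ∑ k, ExteriorAlgebra.ι ℂ (0, stdBasis k) * inclXi (F (stdBasis k) v))
    (hH : ∀ v w, H (v, w) = inclXi (superDeriv f p.1 v)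
        - (p.2 i)⁻¹ • (ExteriorAlgebra.ι ℂ (stdBasis i, 0) * G (v, w))
        + ((p.2 i ^ 2)⁻¹ * w i) • (ExteriorAlgebra.ι ℂ (stdBasis i, 0) * rowField f p)) :
    oddField (dualOf p.1 ∘ₗ LinearMap.snd ℂ C3 C3) (fun k => (stdBasis k, 0))
      (fun k => (0, stdBasis k)) (grExtension i f p) H = 0 := by
  have hrow : CliffordAlgebra.contractLeft (dualOf p.1 ∘ₗ LinearMap.snd ℂ C3 C3) (rowField f p)
      = inclXi (superDeriv f p.1 p.1) := by
    conv_rhs => rw [eq_sum_stdBasis p.1, map_sum, map_sum]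
    rw [← eq_sum_stdBasis, rowField, map_add, contract_snd_inclXi, zero_add, map_sum]
    refine Finset.sum_congr rfl fun k _ => ?_
    rw [contract_ι_mul, contract_snd_inclXi, mul_zero, sub_zero, LinearMap.comp_apply,
      LinearMap.snd_apply, dualOf_stdBasis, map_smul, map_smul]
  have hder : ∑ k, ExteriorAlgebra.ι ℂ (stdBasis k, (0 : C3)) * H (0, stdBasis k)
      = (p.2 i)⁻¹ • (ExteriorAlgebra.ι ℂ (stdBasis i, 0) * inclXi (degreeOp (f p.1))) := by
    rw [degreeOp, map_sum, Finset.mul_sum, Finset.smul_sum]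
    refine Finset.sum_congr rfl fun k _ => ?_
    have h1 : ExteriorAlgebra.ι ℂ (stdBasis k, (0 : C3)) * ((p.2 i ^ 2)⁻¹ * stdBasis k i) •
        (ExteriorAlgebra.ι ℂ (stdBasis i, 0) * rowField f p) = 0 := by
      rcases eq_or_ne k i with rfl | hk
      · rw [mul_smul_comm, ι_mul_ι_mul_self, smul_zero]
      · have : stdBasis k i = 0 := by simp [stdBasis, hk.symm]
        rw [this, mul_zero, zero_smul, mul_zero]
    have h2 : G (0, stdBasis k)
        = inclXi (CliffordAlgebra.contractLeft (dualOf (stdBasis k)) (f p.1)) := by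
      rw [hG]
      simp
    rw [hH, mul_add, h1, add_zero, map_zero, map_zero, zero_sub, h2, mul_neg, mul_smul_comm,
      ι_mul_ι_mul_swap, smul_neg, neg_neg, map_mul, ExteriorAlgebra.map_apply_ι]
    rfl
  have hval : (dualOf p.1 ∘ₗ LinearMap.snd ℂ C3 C3) (stdBasis i, 0) = 0 := by simp
  rw [oddField, hder, grExtension, map_sub, map_smul, contract_snd_inclXi, contract_ι_mul, hrow,
    hval, zero_smul, zero_sub, zero_sub, smul_neg, neg_neg, ← smul_add, ← mul_add, ← map_add,
    heuler, map_zero, mul_zero, smul_zero]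

variable {U : Opens (TopCat.of P2)} {s : Over piProj U → ExteriorAlgebra ℂ C3}

/-- Euler's identity for superfunctions on `Π`-symmetric frames. -/
theorem pi_euler (hs : s ∈ piSections.sections U) {z : C3} (hz : z ≠ 0)
    (hU : coneProj ⟨z, hz⟩ ∈ U) :
    superDeriv (extZero s) z z + degreeOp (extZero s z) = 0 := by
  refine euler_identity (pi_hasSuperDerivAt hs hz hU) ?_
  filter_upwards [isOpen_ne.mem_nhds (one_ne_zero (α := ℂ))] with c hc
  exact pi_scal hs hz hU hc

theorem grExtension_scal (hs : s ∈ piSections.sections U) {x y : C3} (hx : x ≠ 0)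
    (hU : coneProj ⟨x, hx⟩ ∈ U) (i : Fin 3) {c d : ℂ} (hc : c ≠ 0) (hd : d ≠ 0) :
    ExteriorAlgebra.map (LinearMap.prodMap (scal c) (scal d))
        (grExtension i (extZero s) (c • x, d • y)) = grExtension i (extZero s) (x, y) := by
  have hcx : c • x ≠ 0 := smul_ne_zero hc hx
  have hp : coneProj ⟨c • x, hcx⟩ = coneProj ⟨x, hx⟩ := coneProj_smul _ _ c rfl
  have hcU : coneProj ⟨c • x, hcx⟩ ∈ U := hp ▸ hU
  have hJ : ∀ a, ExteriorAlgebra.map (LinearMap.prodMap (scal c) (scal d)) (inclXi a)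
      = inclXi (ExteriorAlgebra.map (scal c) a) := fun a => by
    rw [← AlgHom.comp_apply, ← AlgHom.comp_apply, ExteriorAlgebra.map_comp_map,
      ExteriorAlgebra.map_comp_map]
    congr 2
    ext <;> simp
  have hderiv := map_scal_deriv hc (pi_hasSuperDerivAt hs hx hU) (pi_hasSuperDerivAt hs hcx hcU) (by
    filter_upwards [eventually_mem_cone hx hU] with y ⟨hy, hyU⟩
    exact pi_scal hs hy hyU hc)
  have hcontr : ExteriorAlgebra.map (scal c)
      (CliffordAlgebra.contractLeft (dualOf (d • y)) (extZero s (c • x)))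
        = (d / c) • CliffordAlgebra.contractLeft (dualOf y) (extZero s x) := by
    have e : d • y = c • ((d / c) • y) := by rw [smul_smul, mul_div_cancel₀ _ hc]
    rw [e, map_scal_contract, contract_smul_left, pi_scal hs hx hU hc]
  have hη : ∀ v : C3, ExteriorAlgebra.map (LinearMap.prodMap (scal c) (scal d))
      (ExteriorAlgebra.ι ℂ (0, v)) = d • ExteriorAlgebra.ι ℂ (0, v) := fun v => by
    rw [ExteriorAlgebra.map_apply_ι, ← map_smul]
    simp
  have hξ : ∀ v : C3, ExteriorAlgebra.map (LinearMap.prodMap (scal c) (scal d))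
      (ExteriorAlgebra.ι ℂ (v, 0)) = c • ExteriorAlgebra.ι ℂ (v, 0) := fun v => by
    rw [ExteriorAlgebra.map_apply_ι, ← map_smul]
    simp
  have hrow : ExteriorAlgebra.map (LinearMap.prodMap (scal c) (scal d))
      (rowField (extZero s) (c • x, d • y)) = (d / c) • rowField (extZero s) (x, y) := by
    simp only [rowField, map_add, map_sum, map_mul, hJ, hη, hcontr, hderiv, map_smul, smul_add,
      Finset.smul_sum, smul_mul_assoc, mul_smul_comm, smul_smul, div_eq_mul_inv, mul_comm]
  rw [grExtension, grExtension, map_sub, map_smul, map_mul, hrow, hJ, hξ, pi_scal hs hx hU hc,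
    smul_mul_assoc, mul_smul_comm, smul_smul, smul_smul]
  congr 2
  change (d * y i)⁻¹ * c * (d / c) = (y i)⁻¹
  field_simp

/-- The restriction of the extension to `Π`-symmetric frames is the given section. -/
theorem oddPullback_grExtension (hs : s ∈ piSections.sections U) {z : C3} (hz : z ≠ 0)
    (hU : coneProj ⟨z, hz⟩ ∈ U) (i : Fin 3) :
    oddPullback (grExtension i (extZero s) (z, z)) = extZero s z := by
  have hJ : ∀ a, oddPullback (inclXi a) = a := fun a => by
    rw [← AlgHom.comp_apply, ExteriorAlgebra.map_comp_map]
    have : (LinearMap.fst ℂ C3 C3 - LinearMap.snd ℂ C3 C3) ∘ₗ LinearMap.inl ℂ C3 C3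
        = LinearMap.id := by ext; simp
    rw [this, ExteriorAlgebra.map_id, AlgHom.id_apply]
  have hrow : oddPullback (rowField (extZero s) (z, z)) = 0 := by
    rw [rowField, map_add, hJ, pi_contract hs hz hU, extDiff, map_sum, ← Finset.sum_add_distrib]
    refine Finset.sum_eq_zero fun k _ => ?_
    rw [map_mul, hJ, ExteriorAlgebra.map_apply_ι]
    simp
  rw [grExtension, map_sub, map_smul, map_mul, hrow, mul_zero, smul_zero, sub_zero, hJ]

/-- The open subset `U × U_i` of the reduced space of the super Grassmannian. -/
def prodChart (U : Opens (TopCat.of P2)) (i : Fin 3) : Opens (TopCat.of (P2 × P2)) :=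
  ⟨(U : Set P2) ×ˢ (affineChart i : Set P2), U.isOpen.prod (affineChart i).isOpen⟩

theorem grExtension_mem (hs : s ∈ piSections.sections U) (i : Fin 3) :
    (fun t : Over grProj (prodChart U i) => grExtension i (extZero s) t.1.1)
      ∈ grSections.sections (prodChart U i) := by
  obtain ⟨r, hr⟩ : ∃ r : Over grProj (prodChart U i) → ExteriorAlgebra ℂ (C3 × C3),
    r = fun t => grExtension i (extZero s) t.1.1 := ⟨_, rfl⟩
  rw [← hr]
  rintro ⟨⟨⟨x, y⟩, hx, hy⟩, hU, hi⟩
  have hyi : y i ≠ 0 := (coneProj_mem_affineChart hy).1 hi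
  have hd : ∀ᶠ z in 𝓝 x, HasSuperDerivAt (extZero s) (superDeriv (extZero s) z) z := by
    filter_upwards [eventually_mem_cone hx hU] with z ⟨hz, hzU⟩
    exact pi_hasSuperDerivAt hs hz hzU
  obtain ⟨F, hF, hsymm⟩ := HasSuperDerivAt.exists_second hd
  obtain ⟨G, hG, hG'⟩ := hasSuperDerivAt_rowField (p := (x, y)) hd.self_of_nhds hF
  obtain ⟨H, hH, hH'⟩ := hasSuperDerivAt_grExtension (p := (x, y)) hyi hd.self_of_nhds hG
  refine ⟨⟨H, hH.congr ?_, ?_, ?_⟩, ?_⟩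
  · filter_upwards [eventually_gr_mem (V := prodChart U i) (p := (x, y)) ⟨hx, hy⟩ ⟨hU, hi⟩]
      with q ⟨hq, hqV⟩
    rw [extZero_gr r hq hqV, hr]
  · rw [hr]
    exact oddField_fst_grExtension hyi hsymm hG' hH'
  · rw [hr]
    exact oddField_snd_grExtension (pi_euler hs hx hU) hG' hH'
  · intro c d u hc hd hu
    rw [hr]
    beta_reduce
    rw [hu]
    exact grExtension_scal hs hx hU i hc hd

end Extension

/-! ### Morphisms of superspaces given by pull-backs of functions -/

section Morphisms

variable {X Y : TopCat.{0}} {T T' V V' : Type} [AddCommGroup V] [Module ℂ V] [AddCommGroup V']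
  [Module ℂ V'] {π : T → X} {π' : T' → Y}
  {S : LocalSubalgebra π (ExteriorAlgebra ℂ V)} {S' : LocalSubalgebra π' (ExteriorAlgebra ℂ V')}
  {hS : ∀ (U : Opens X) (f : Over π U → ExteriorAlgebra ℂ V) (t : Over π U),
      S.P U f t → S.P U (fun u => CliffordAlgebra.involute (f u)) t}
  {hS' : ∀ (U : Opens Y) (f : Over π' U → ExteriorAlgebra ℂ V') (t : Over π' U),
      S'.P U f t → S'.P U (fun u => CliffordAlgebra.involute (f u)) t}

/-- The morphism of sheafed spaces between superspaces of Grassmann algebra valued functions given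
by a pull-back of sections. -/
def sheafedHom (f : X ⟶ Y)
    (φ : ∀ U : Opens Y, S'.sections U →ₐ[ℂ] S.sections ((Opens.map f).obj U))
    (hres : ∀ (U W : Opens Y) (h : W ≤ U) (s : S'.sections U),
      φ W (S'.resHom h s) = S.resHom ((Opens.map f).map (homOfLE h)).le (φ U s)) :
    (S.toSuperSpace hS).toSheafedSpace ⟶ (S'.toSuperSpace hS').toSheafedSpace :=
  InducedCategory.homMk
    { base := f
      c :=
      { app := fun U => AlgCat.ofHom (φ U.unop)
        naturality := fun U W i => by
          ext s
          exact hres U.unop W.unop i.unop.le s } }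

/-- A morphism between superspaces of Grassmann algebra valued functions, given by its action on
sections. -/
def homOfPullback (f : X ⟶ Y)
    (φ : ∀ U : Opens Y, S'.sections U →ₐ[ℂ] S.sections ((Opens.map f).obj U))
    (hres : ∀ (U W : Opens Y) (h : W ≤ U) (s : S'.sections U),
      φ W (S'.resHom h s) = S.resHom ((Opens.map f).map (homOfLE h)).le (φ U s))
    (hpar : ∀ (U : Opens Y) (s s' : S'.sections U),
      (∀ t, s'.1 t = CliffordAlgebra.involute (s.1 t)) →
        ∀ t, (φ U s').1 t = CliffordAlgebra.involute ((φ U s).1 t))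
    (hloc : ∀ (U : Opens Y) (s : S'.sections U) (x : X) (W : Opens X)
      (hW : W ≤ (Opens.map f).obj U), x ∈ W → IsUnit (S.resHom hW (φ U s)) →
        ∃ (W' : Opens Y) (hW' : W' ≤ U), f x ∈ W' ∧ IsUnit (S'.resHom hW' s)) :
    S.toSuperSpace hS ⟶ S'.toSuperSpace hS' :=
  show SuperSpace.Hom (S.toSuperSpace hS) (S'.toSuperSpace hS') from
  { toHom := sheafedHom f φ hres
    parity_comm := fun U s => Subtype.ext (funext fun t => hpar U s
      ⟨fun u => CliffordAlgebra.involute (s.1 u), fun t => hS' _ _ t (s.2 t)⟩ (fun _ => rfl) t)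
    isLocal := by
      rintro U s x ⟨W, hW, hx, hu⟩
      exact hloc U s x W hW hx hu }

end Morphisms

/-! ### The isomorphism of superspaces -/

section Comparison

variable {l c : ℂ}

theorem comparison_res (hc : c ≠ 0) (hl : c ^ 2 = l) {U W : Opens (TopCat.of P2)} (h : W ≤ U)
    (s : piSections.sections U) :
    comparison W hc hl (piSections.resHom h s)
      = (planeSections l).resHom h (comparison U hc hl s) := rfl

theorem comparison_involute (hc : c ≠ 0) (hl : c ^ 2 = l) {U : Opens (TopCat.of P2)}
    {s s' : piSections.sections U} (h : ∀ t, s'.1 t = CliffordAlgebra.involute (s.1 t)) (t) :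
    (comparison U hc hl s').1 t = CliffordAlgebra.involute ((comparison U hc hl s).1 t) := by
  change ExteriorAlgebra.map (scal c) (horizontalPart _ _ (s'.1 _)) = CliffordAlgebra.involute
    (ExteriorAlgebra.map (scal c) (horizontalPart _ _ (s.1 _)))
  rw [h, horizontalPart_involute, map_involute]

theorem comparison_symm_res (hc : c ≠ 0) (hl : c ^ 2 = l) {U W : Opens (TopCat.of P2)}
    (h : W ≤ U) (s : (planeSections l).sections U) :
    (comparison W hc hl).symm ((planeSections l).resHom h s)
      = piSections.resHom h ((comparison U hc hl).symm s) := by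
  rw [AlgEquiv.symm_apply_eq, comparison_res, AlgEquiv.apply_symm_apply]

theorem comparison_symm_involute (hc : c ≠ 0) (hl : c ^ 2 = l) {U : Opens (TopCat.of P2)}
    {s s' : (planeSections l).sections U} (h : ∀ t, s'.1 t = CliffordAlgebra.involute (s.1 t)) (t) :
    ((comparison U hc hl).symm s').1 t
      = CliffordAlgebra.involute (((comparison U hc hl).symm s).1 t) := by
  let inv : piSections.sections U → piSections.sections U := fun r =>
    piPlane.parity.app (op U) r
  have h1 : s' = comparison U hc hl (inv ((comparison U hc hl).symm s)) := by
    refine Subtype.ext (funext fun u => ?_)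
    rw [h, comparison_involute hc hl (s := (comparison U hc hl).symm s) (fun _ => rfl),
      AlgEquiv.apply_symm_apply]
  rw [h1, AlgEquiv.symm_apply_apply]
  rfl

theorem isUnit_of_isUnit_comparison (hc : c ≠ 0) (hl : c ^ 2 = l) {U W : Opens (TopCat.of P2)}
    (h : W ≤ U) {s : piSections.sections U}
    (hu : IsUnit ((planeSections l).resHom h (comparison U hc hl s))) :
    IsUnit (piSections.resHom h s) := by
  have h2 := hu.map (comparison W hc hl).symm
  rwa [comparison_symm_res, AlgEquiv.symm_apply_apply] at h2

theorem isUnit_of_isUnit_comparison_symm (hc : c ≠ 0) (hl : c ^ 2 = l)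
    {U W : Opens (TopCat.of P2)} (h : W ≤ U) {s : (planeSections l).sections U}
    (hu : IsUnit (piSections.resHom h ((comparison U hc hl).symm s))) :
    IsUnit ((planeSections l).resHom h s) := by
  have h2 := hu.map (comparison W hc hl)
  rwa [comparison_res, AlgEquiv.apply_symm_apply] at h2

/-- The morphism from `(P², ΠΩ¹, l)` to the `Π`-projective plane that is the identity on the reduced
spaces and `comparison` on sections. -/
def toPiPlane (hc : c ≠ 0) (hl : c ^ 2 = l) : omegaPlane l ⟶ piPlane :=
  homOfPullback (𝟙 (TopCat.of P2)) (fun U => (comparison U hc hl).toAlgHom)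
    (fun _ _ h s => comparison_res hc hl h s)
    (fun _ _ _ h t => comparison_involute hc hl h t)
    (fun _ _ _ W hW hx hu => ⟨W, hW, hx, isUnit_of_isUnit_comparison hc hl hW hu⟩)

/-- The morphism inverse to `toPiPlane`, given by the inverse of `comparison` on sections. -/
def ofPiPlane (hc : c ≠ 0) (hl : c ^ 2 = l) : piPlane ⟶ omegaPlane l :=
  homOfPullback (𝟙 (TopCat.of P2)) (fun U => (comparison U hc hl).symm.toAlgHom)
    (fun _ _ h s => comparison_symm_res hc hl h s)
    (fun _ _ _ h t => comparison_symm_involute hc hl h t)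
    (fun _ _ _ W hW hx hu => ⟨W, hW, hx, isUnit_of_isUnit_comparison_symm hc hl hW hu⟩)

theorem SuperSpace.hom_ext {X Y : SuperSpace} {f g : X ⟶ Y}
    (h : SuperSpace.Hom.toHom f = SuperSpace.Hom.toHom g) : f = g := by
  obtain ⟨f, _, _⟩ : SuperSpace.Hom X Y := f
  obtain ⟨g, _, _⟩ : SuperSpace.Hom X Y := g
  obtain rfl : f = g := h
  rfl

/-- The isomorphism between `(P², ΠΩ¹, l)` and the `Π`-projective plane, for a non-zero square root
`c` of `l`. -/
def isoPiPlane (hc : c ≠ 0) (hl : c ^ 2 = l) : omegaPlane l ≅ piPlane where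
  hom := toPiPlane hc hl
  inv := ofPiPlane hc hl
  hom_inv_id := by
    refine SuperSpace.hom_ext (InducedCategory.hom_ext
      (AlgebraicGeometry.PresheafedSpace.hext _ _ rfl (heq_of_eq ?_)))
    ext U s
    exact (comparison U hc hl).apply_symm_apply s
  inv_hom_id := by
    refine SuperSpace.hom_ext (InducedCategory.hom_ext
      (AlgebraicGeometry.PresheafedSpace.hext _ _ rfl (heq_of_eq ?_)))
    ext U s
    exact (comparison U hc hl).symm_apply_apply s

end Comparison

/-! ### The linear inclusion as a closed embedding -/

section Inclusion

/-- The tautological inclusion of the `Π`-projective plane into the super Grassmannian. -/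
def linearInclusion : piPlane ⟶ superGrassmannian :=
  homOfPullback diagonalMap linearPullback (fun _ _ _ _ => rfl)
    (fun U s s' h t => by
      change oddPullback (s'.1 _) = CliffordAlgebra.involute (oddPullback (s.1 _))
      rw [h, map_involute])
    (fun U s x W hW hx hu => by
      obtain ⟨⟨z, hz⟩, rfl⟩ := coneProj_surjective x
      have h := hu.map ((Pi.evalAlgHom ℂ (fun _ : Over piProj W => ExteriorAlgebra ℂ C3)
        ⟨⟨z, hz⟩, hx⟩).comp (piSections.sections W).val)
      -- The substitution of the odd coordinates preserves the degree zero component, which is not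
      -- zero for an invertible superfunction.
      refine exists_isUnit_gr s ⟨⟨(z, z), hz, hz⟩, hW hx⟩ ?_
      rw [← body_map (LinearMap.fst ℂ C3 C3 - LinearMap.snd ℂ C3 C3)]
      exact (h.map (ExteriorAlgebra.algebraMapInv : ExteriorAlgebra ℂ C3 →ₐ[ℂ] ℂ)).ne_zero)

theorem isLinearInclusion_linearInclusion : IsLinearInclusion linearInclusion where
  base _ := rfl
  pullback _ _ _ _ _ := rfl

/-- Sections of the `Π`-projective plane extend locally to the super Grassmannian. -/
theorem exists_extension {U : Opens (TopCat.of P2)} (s : piSections.sections U) {x : P2}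
    (hx : x ∈ U) : ∃ (V : Opens (TopCat.of (P2 × P2))) (t : grSections.sections V)
      (W : Opens (TopCat.of P2)) (hWU : W ≤ U) (hWV : W ≤ (Opens.map diagonalMap).obj V), x ∈ W ∧
      piSections.resHom hWU s = piSections.resHom hWV (linearPullback V t) := by
  obtain ⟨⟨z, hz⟩, rfl⟩ := coneProj_surjective x
  obtain ⟨i, hi⟩ := exists_coord_ne hz
  refine ⟨prodChart U i, ⟨_, grExtension_mem s.2 i⟩, U ⊓ affineChart i, inf_le_left,
    fun y hy => hy, ⟨hx, (coneProj_mem_affineChart hz).2 hi⟩, ?_⟩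
  refine Subtype.ext (funext fun u => ?_)
  obtain ⟨⟨w, hw⟩, hwU⟩ := u
  exact (extZero_pi s.1 hw hwU.1).symm.trans (oddPullback_grExtension s.2 hw hwU.1 i).symm

/-- Sections of `(P², ΠΩ¹, l)` extend locally to the super Grassmannian, through the isomorphism
with the `Π`-projective plane. -/
theorem exists_extension_comparison {l c : ℂ} (hc : c ≠ 0) (hl : c ^ 2 = l)
    {U : Opens (TopCat.of P2)} (s : (planeSections l).sections U) {x : P2} (hx : x ∈ U) :
    ∃ (V : Opens (TopCat.of (P2 × P2))) (t : grSections.sections V)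
      (W : Opens (TopCat.of P2)) (hWU : W ≤ U) (hWV : W ≤ (Opens.map diagonalMap).obj V), x ∈ W ∧
      (planeSections l).resHom hWU s
        = (planeSections l).resHom hWV (comparison _ hc hl (linearPullback V t)) := by
  obtain ⟨V, t, W, hWU, hWV, hxW, h⟩ := exists_extension ((comparison U hc hl).symm s) hx
  refine ⟨V, t, W, hWU, hWV, hxW, ?_⟩
  have h2 := congrArg (comparison W hc hl) h
  rwa [comparison_res, comparison_res, AlgEquiv.apply_symm_apply] at h2

theorem isClosedEmbedding_linearInclusion :
    SuperSpace.IsClosedEmbedding linearInclusion where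
  base := isClosedEmbedding_diagonalMap
  locally_surjective _ s _ hx := exists_extension s hx

theorem isClosedEmbedding_toPiPlane_comp {l c : ℂ} (hc : c ≠ 0) (hl : c ^ 2 = l) :
    SuperSpace.IsClosedEmbedding (toPiPlane hc hl ≫ linearInclusion) where
  base := isClosedEmbedding_diagonalMap
  locally_surjective U s x hx := by
    exact exists_extension_comparison hc hl s hx

end Inclusion

end SuperGeometry
end

theorem mainTheorem8 (l : ℂ) (hl : l ≠ 0) :
    ∃ (Φ : SuperGeometry.omegaPlane l ≅ SuperGeometry.piPlane)
      (j : SuperGeometry.piPlane ⟶ SuperGeometry.superGrassmannian),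
      SuperGeometry.IsLinearInclusion j ∧ SuperGeometry.SuperSpace.IsClosedEmbedding j ∧
      SuperGeometry.SuperSpace.IsClosedEmbedding (Φ.hom ≫ j) := by
  obtain ⟨c, hc⟩ := IsAlgClosed.exists_pow_nat_eq l two_pos
  have hc0 : c ≠ 0 := by
    rintro rfl
    exact hl (by rw [← hc, zero_pow two_ne_zero])
  exact ⟨SuperGeometry.isoPiPlane hc0 hc, SuperGeometry.linearInclusion,
    SuperGeometry.isLinearInclusion_linearInclusion,
    SuperGeometry.isClosedEmbedding_linearInclusion,
    SuperGeometry.isClosedEmbedding_toPiPlane_comp hc0 hc⟩
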